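/- Consider circuits on the qubits of an $L\times L$ grid, one qubit per cell. A circuit is a sequence of layers. Each layer consists of gates from $\{Z,\mathrm{CZ},\mathrm{CNOT}\}$ acting on pairwise disjoint sets of qubits, and every two-qubit gate acts on two horizontally or vertically neighbouring cells. The depth is the number of layers, and there are no further (ancilla) qubits, no measurements and no feedforward. Let $T$ be a binary tree with $N$ nodes, the nodes being labelled by the qubits $0,\dots,N-1$ in inorder. Regard $T$ as a full ordered ternary tree by giving every node a leaf as middle child and replacing each missing left or right child by a leaf. For $0\le i<2N$ the encoding of $N$ fermionic modes given by $T$ represents the Majorana operator $\gamma_i$ by the Pauli string of the $i$-th leaf from the left (the last of the $2N+1$ leaves is unused): the root-to-leaf path contributes, at each node $k$ it passes, $X_k$, $Y_k$ or $Z_k$ according to whether it continues to the left, middle or right child. The right spine gives the Jordan–Wigner (JW) encoding, the left spine the Parity encoding, and balanced binary trees (trees of the least height possible for their number of nodes; for $N=2^k-1$ only the perfect tree) give the Bravyi–Kitaev (BK) encoding. For $\pi\in S_N$, the fermionic permutation $F_\pi$ in an encoding is the unitary, unique up to a global phase, with $F_\pi\gamma_{2j+\alpha}F_\pi^\dagger=\gamma_{2\pi(j)+\alpha}$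 for all modes $j$ and $\alpha\in\{0,1\}$. There is a universal constant $C$ such that the following holds for all $L$ and all $N\le L^2$, for the BK encoding (any balanced $T$) and the Parity encoding of $N$ modes, for every placement $\ell$ of the $N$ qubits on distinct cells of the $L\times L$ grid (for instance along a Hilbert curve), and for every $\pi\in S_N$. The fermionic permutation $F_\pi$ of this encoding is implemented by a circuit of the above kind of depth at most $CL$ with at most $CL^3$ gates. In particular, for $N=L^2$ the depth is $O(\sqrt N)$ and the number of gates is $O(N\sqrt N)$, with no ancillas. If $N<L^2$, the circuit acts as the identity on the qubits of the unused cells, whatever their state. Moreover, the circuit can be taken of the form: $A$, then $R$, then $J$, then the inverse of $R$, then the inverse of $A$, where - $A$ consists of CNOT gates only and converts the given encoding to JW with the same placement $\ell$, that is, conjugation by $A$ maps each $\gamma_i$ of the given encoding to the $\gamma_i$ of JW; - $R$ is an ordinary permutation of the qubits of the grid that moves the qubit $i$ from $\ell(i)$ to the $i$-th cell in the row-major snake order (even rows left to right, odd rows right to left, rows counted from $0$), for every $i<N$; - $J$ implements $F_\pi$ in the JW encoding with the qubits in snake order. -/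

import Mathlib

open scoped Matrix

noncomputable section

namespace FermionicPermutation

/-! ### Qubits, Pauli operators and tensor products -/

/-- Operators on the Hilbert space of the qubits indexed by `V`, as matrices in the
computational basis, whose elements are the bit strings `V → Fin 2`. -/
abbrev Operator (V : Type) : Type := Matrix (V → Fin 2) (V → Fin 2) ℂ

/-- The Pauli matrix `X`. -/
def pauliX : Matrix (Fin 2) (Fin 2) ℂ := !![0, 1; 1, 0]

/-- The Pauli matrix `Y`. -/
def pauliY : Matrix (Fin 2) (Fin 2) ℂ := !![0, -Complex.I; Complex.I, 0]

/-- The Pauli matrix `Z`. -/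
def pauliZ : Matrix (Fin 2) (Fin 2) ℂ := !![1, 0; 0, -1]

section Qubits

variable {V : Type} [Fintype V] [DecidableEq V]

/-- The tensor product `⨂ v, P v` of one-qubit operators. -/
def tensorOp (P : V → Matrix (Fin 2) (Fin 2) ℂ) : Operator V :=
  Matrix.of fun s t => ∏ v, P v (s v) (t v)

/-- The one-qubit operator `M` acting on the qubit `v`, and the identity on all other qubits. -/
def onQubit (v : V) (M : Matrix (Fin 2) (Fin 2) ℂ) : Operator V :=
  tensorOp (Function.update (fun _ => 1) v M)

/-- The controlled `Z` gate: `|s⟩ ↦ (-1) ^ (s u * s v) |s⟩`. -/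
def czOp (u v : V) : Operator V :=
  Matrix.diagonal fun s => if s u = 1 ∧ s v = 1 then -1 else 1

/-- The controlled not gate with control `u` and target `v`:
`|t⟩ ↦ |t with t v replaced by t v + t u (mod 2)⟩`. -/
def cnotOp (u v : V) : Operator V :=
  Matrix.of fun s t => if s = Function.update t v (t v + t u) then 1 else 0

/-- The operator that moves the content of each qubit `v` to the qubit `ρ v`. -/
def qubitPermOp (ρ : Equiv.Perm V) : Operator V :=
  Matrix.of fun s t => if s = t ∘ ρ.symm then 1 else 0

end Qubits

/-! ### Circuits with nearest-neighbour gates -/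

/-- An elementary gate on the qubits at the vertices of the graph `G`;
two-qubit gates act along edges of `G` only. -/
inductive Gate {V : Type} (G : SimpleGraph V) : Type
  | z (v : V) : Gate G
  | cz (u v : V) (h : G.Adj u v) : Gate G
  | cnot (u v : V) (h : G.Adj u v) : Gate G

section Circuits

variable {V : Type} [Fintype V] [DecidableEq V] {G : SimpleGraph V}

/-- The qubits on which a gate acts. -/
def Gate.support : Gate G → Finset V
  | .z v => {v}
  | .cz u v _ => {u, v}
  | .cnot u v _ => {u, v}

/-- The unitary of a gate. -/
def Gate.op : Gate G → Operator V
  | .z v => onQubit v pauliZ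
  | .cz u v _ => czOp u v
  | .cnot u v _ => cnotOp u v

/-- The gate is a controlled not gate. -/
def Gate.IsCNOT : Gate G → Prop
  | .z _ => False
  | .cz _ _ _ => False
  | .cnot _ _ _ => True

/-- A layer: gates that act on pairwise disjoint sets of qubits, hence simultaneously. -/
structure Layer {V : Type} [DecidableEq V] (G : SimpleGraph V) : Type where
  gates : List (Gate G)
  disjoint : gates.Pairwise fun g h => Disjoint g.support h.support

/-- The unitary of a layer (the order of its factors, which commute, is immaterial). -/
def Layer.op (l : Layer G) : Operator V := (l.gates.map Gate.op).prod

/-- A circuit is a sequence of layers, listed in the order in which they are applied. It acts on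
the qubits at the vertices of `G` and on nothing else: there are neither ancillas nor
measurements. Every gate is its own inverse, so `List.reverse` gives the inverse circuit. -/
abbrev Circuit {V : Type} [DecidableEq V] (G : SimpleGraph V) : Type := List (Layer G)

/-- The unitary of a circuit. -/
def Circuit.op : Circuit G → Operator V
  | [] => 1
  | l :: c => Circuit.op c * l.op

/-- The depth: the number of layers, those of one-qubit gates included. -/
def Circuit.depth (c : Circuit G) : ℕ := c.length

/-- The number of gates, one-qubit gates included. -/
def Circuit.size (c : Circuit G) : ℕ := (c.map fun l => l.gates.length).sum

/-- All gates of the circuit are controlled not gates. -/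
def Circuit.IsCNOTOnly (c : Circuit G) : Prop := ∀ l ∈ c, ∀ g ∈ l.gates, g.IsCNOT

end Circuits

/-! ### The grid and its snake order -/

/-- The `L × L` grid graph on the cells `(row, column)`. -/
def gridGraph (L : ℕ) : SimpleGraph (Fin L × Fin L) :=
  SimpleGraph.boxProd (SimpleGraph.pathGraph L) (SimpleGraph.pathGraph L)

/-- The position of a cell in the row-major snake order: even rows are traversed left to right,
odd rows right to left. -/
def snakeIndex {L : ℕ} (v : Fin L × Fin L) : ℕ :=
  if Even (v.1 : ℕ) then v.1 * L + v.2 else v.1 * L + (L - 1 - v.2)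

/-! ### Binary-shaped ternary tree encodings

The shape of such an encoding is a binary tree with one node for every qubit. It is read as a full
ordered ternary tree in which the middle child of every node is a leaf, the left and right children
are the two subtrees, and every empty subtree is a leaf. -/

/-- The left spine: a path of `N` nodes, each the left child of the previous one. -/
def leftSpine : ℕ → BinaryTree Unit
  | 0 => .nil
  | n + 1 => .node () (leftSpine n) .nil

/-- The right spine: a path of `N` nodes, each the right child of the previous one. -/
def rightSpine : ℕ → BinaryTree Unit
  | 0 => .nil
  | n + 1 => .node () .nil (rightSpine n)

/-- A binary tree is balanced if its height is the least possible for its number of nodes. The only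
such tree with `2 ^ k - 1` nodes is the perfect one. -/
def IsBalanced (T : BinaryTree Unit) : Prop :=
  ∀ T' : BinaryTree Unit, T'.numNodes = T.numNodes → T.height ≤ T'.height

/-- The Pauli strings of the leaves of the ternary tree of shape `T`, from left to right. The nodes
are labelled by consecutive qubits in inorder, starting with the qubit `o`. A root-to-leaf path
contributes at the node of qubit `k` the matrix `X`, `Y` or `Z` at `k` according to whether it
continues to the left, middle or right child. A string assigns a matrix to every qubit label. -/
def leafStrings : BinaryTree Unit → ℕ → List (ℕ → Matrix (Fin 2) (Fin 2) ℂ)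
  | .nil, _ => [fun _ => 1]
  | .node _ l r, o =>
    (leafStrings l o).map (fun p => Function.update p (o + l.numNodes) pauliX) ++
      Function.update (fun _ => 1) (o + l.numNodes) pauliY ::
        (leafStrings r (o + l.numNodes + 1)).map
          (fun p => Function.update p (o + l.numNodes) pauliZ)

section Encodings

variable {V : Type} [Fintype V] [DecidableEq V] {N : ℕ}

/-- The `i`-th Majorana operator, `i < 2 * N`, of the encoding of `N` modes of shape `T`
(with `N` nodes), where the qubit `k` is placed at the vertex `ℓ k`: the Pauli string of the `i`-th
leaf from the left. The last one of the `2 * N + 1` leaves is not used. -/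
def majorana (T : BinaryTree Unit) (ℓ : Fin N ↪ V) (i : ℕ) : Operator V :=
  tensorOp (Function.extend ℓ (fun k : Fin N => (leafStrings T 0).getD i (fun _ => 1) k)
    (fun _ => 1))

/-- `U` acts trivially on all qubits that carry no label in the placement `ℓ`. -/
def IsTrivialOff (ℓ : Fin N ↪ V) (U : Operator V) : Prop :=
  ∀ v, v ∉ Set.range ℓ → Commute U (onQubit v pauliX) ∧ Commute U (onQubit v pauliZ)

/-- `U` is the fermionic permutation of `π` in the encoding of shape `T` with placement `ℓ`:
`U γ_{2j+α} U† = γ_{2π(j)+α}`. For a unitary `U` this determines `U` up to a global phase. -/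
def ImplementsFermionicPerm (T : BinaryTree Unit) (ℓ : Fin N ↪ V) (π : Equiv.Perm (Fin N))
    (U : Operator V) : Prop :=
  (∀ (j : Fin N) (α : Fin 2),
    U * majorana T ℓ (2 * (j : ℕ) + α) * Uᴴ = majorana T ℓ (2 * (π j : ℕ) + α)) ∧
  IsTrivialOff ℓ U

/-- `U` converts the encoding of shape `T` to the encoding of shape `T'`, for the same
placement `ℓ` of the qubits. -/
def ConvertsEncoding (T T' : BinaryTree Unit) (ℓ : Fin N ↪ V) (U : Operator V) : Prop :=
  (∀ i < 2 * N, U * majorana T ℓ i * Uᴴ = majorana T' ℓ i) ∧ IsTrivialOff ℓ U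

end Encodings

end FermionicPermutation

end

set_option linter.unusedSectionVars false

noncomputable section

/-! Every gate is a signed permutation `mono f q` of the computational basis, |t⟩ ↦ (-1)^(q t) |f
t⟩, so circuit identities reduce to identities of bit maps and of polynomial functions over F_2.
Only the depth has to be bounded: a layer contains at most L² gates, hence depth O(L) gives O(L³)
gates.

The conversion A. In the encoding of a tree, each node stores the parity of the occupation numbers
in its left subtree and at itself. This linear bit map carries the Jordan–Wigner Majorana operators
to the Pauli strings of the leaves (`semiconjBy_encBits`), so A has to invert it. The occupation
number of a node is its own bit plus the bits on the right spine of its left subtree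
(`sum_treeEnc_children`). Sorted by depth, these additions become passes of CNOTs on disjoint pairs.
Pass d involves only nodes of depth at most d, fewer than 2^(d+1) of them. They are laid out in a
square of side O(2^(d/2)), where arbitrary routing costs O(2^(d/2)), and the geometric sum over d is
O(L) (`feasible_iterMaps`). A left spine is too high for this. Its bits are the prefix parities, and
a second family of passes computes them from the bits of a low tree (`treeEnc_add_prefix`), so the
Parity encoding is converted by way of such a tree.

The routing R. A permutation of the grid factors into column, row and column permutations, by edge
colouring of a regular bipartite multigraph (`exists_col_row_col`). On a path of n vertices,
pipelined insertion realises any permutation by 2n layers of neighbour swaps (`exists_pathLayers`).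
A swap is three CNOTs.

The Jordan–Wigner part J. Here the fermionic permutation is a permutation of the bits with the sign
of the inverted pairs of occupied modes. This sign is a cocycle (`crossPhase_triangle`).
Consequently fermionic permutations multiply, and a change of the order of the modes is conjugation
by a diagonal sign (`fermPerm_conj`). Row moves exchange neighbours of the snake order and column
moves exchange neighbours of a column order; an exchange of neighbours is a swap with one extra CZ.
The sign between the two orders counts pairs of occupied cells. Running sums along rows and columns
turn it into Z gates and CZ gates between adjacent cells (`crossPhase_snake_col`, `diagPairs_eq`),
so it also has depth O(L). -/

namespace FermionicPermutation

open scoped Matrix Fin.CommRing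

/-! ### Signed permutations of the computational basis -/

/-- Bit strings. -/
abbrev Bits (V : Type) : Type := V → Fin 2

/-- The sign `(-1) ^ a`. -/
def sgn (a : Fin 2) : ℂ := if a = 0 then 1 else -1

theorem sgn_zero : sgn 0 = 1 := by simp [sgn]

theorem bit_cases (a : Fin 2) : a = 0 ∨ a = 1 := by
  revert a; decide

theorem sgn_add (a b : Fin 2) : sgn (a + b) = sgn a * sgn b := by
  rcases bit_cases a with rfl | rfl <;> rcases bit_cases b with rfl | rfl <;>
    simp [sgn, CharTwo.add_self_eq_zero]

theorem star_sgn (a : Fin 2) : star (sgn a) = sgn a := by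
  rcases bit_cases a with rfl | rfl <;> simp [sgn]

section Monomial

variable {V : Type} [Fintype V] [DecidableEq V]

/-- The operator `|t⟩ ↦ (-1) ^ q t |f t⟩`. -/
def mono (f : Bits V → Bits V) (q : Bits V → Fin 2) : Operator V :=
  Matrix.of fun s t => if s = f t then sgn (q t) else 0

theorem mono_apply (f : Bits V → Bits V) (q : Bits V → Fin 2) (s t : Bits V) :
    mono f q s t = if s = f t then sgn (q t) else 0 := rfl

theorem mono_mul_apply (f : Bits V → Bits V) (q : Bits V → Fin 2) (M : Operator V)
    (s t : Bits V) : (M * mono f q) s t = M s (f t) * sgn (q t) := by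
  rw [Matrix.mul_apply, Finset.sum_eq_single (f t)]
  · rw [mono_apply, if_pos rfl]
  · intro u _ hu
    rw [mono_apply, if_neg hu, mul_zero]
  · intro h
    exact absurd (Finset.mem_univ _) h

/-- Closure under products is what allows operator identities to be checked separately on bit
strings and on signs. -/
theorem mono_mul (g f : Bits V → Bits V) (p q : Bits V → Fin 2) :
    mono g p * mono f q = mono (g ∘ f) (fun t => q t + p (f t)) := by
  ext s t
  refine (mono_mul_apply f q (mono g p) s t).trans ?_
  rw [mono_apply, mono_apply, sgn_add, Function.comp_apply, ite_mul, zero_mul, mul_comm]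

theorem mono_one : mono (V := V) id 0 = 1 := by
  ext s t
  rw [mono_apply, Matrix.one_apply]
  simp [sgn_zero]

theorem mono_conjTranspose {g f : Bits V → Bits V} {p q : Bits V → Fin 2}
    (hgf : Function.LeftInverse g f) (hfg : Function.RightInverse g f)
    (hp : ∀ t, p t = q (g t)) : (mono f q)ᴴ = mono g p := by
  ext s t
  rw [Matrix.conjTranspose_apply, mono_apply, mono_apply, hp]
  by_cases h : t = f s
  · rw [if_pos h, if_pos (by rw [h, hgf s]), star_sgn, h, hgf s]
  · rw [if_neg h, if_neg (fun h' => h (by rw [h', hfg t])), star_zero]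

theorem mono_congr {g f : Bits V → Bits V} {p q : Bits V → Fin 2}
    (h : ∀ t, f t = g t) (h' : ∀ t, q t = p t) : mono f q = mono g p := by
  rw [funext h, funext h']

theorem qubitPermOp_eq_mono (ρ : Equiv.Perm V) :
    qubitPermOp ρ = mono (fun t => t ∘ ρ.symm) 0 := by
  ext s t
  rw [mono_apply]
  simp only [Pi.zero_apply, sgn_zero]
  rfl

theorem czOp_eq_mono (u v : V) : czOp u v = mono id fun t => t u * t v := by
  ext s t
  change (Matrix.diagonal fun s : Bits V => if s u = 1 ∧ s v = 1 then (-1 : ℂ) else 1) s t =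
    mono id (fun t => t u * t v) s t
  rw [mono_apply, Matrix.diagonal_apply]
  by_cases h : s = t
  · subst h
    simp only [id, if_true]
    rcases bit_cases (s u) with h1 | h1 <;> rcases bit_cases (s v) with h2 | h2 <;>
      simp [h1, h2, sgn]
  · simp [h]

theorem cnotOp_eq_mono (u v : V) :
    cnotOp u v = mono (fun t => Function.update t v (t v + t u)) 0 := by
  ext s t
  rw [mono_apply]
  simp only [Pi.zero_apply, sgn_zero]
  rfl

theorem onQubit_apply (v : V) (M : Matrix (Fin 2) (Fin 2) ℂ) (s t : Bits V) :
    onQubit v M s t = if ∀ w, w ≠ v → s w = t w then M (s v) (t v) else 0 := by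
  change (∏ w, Function.update (fun _ => (1 : Matrix (Fin 2) (Fin 2) ℂ)) v M w (s w) (t w)) = _
  rw [← Finset.mul_prod_erase _ _ (Finset.mem_univ v), Function.update_self]
  by_cases h : ∀ w, w ≠ v → s w = t w
  · rw [if_pos h, Finset.prod_eq_one, mul_one]
    intro w hw
    have hw' := Finset.ne_of_mem_erase hw
    rw [Function.update_of_ne hw', h w hw']
    exact Matrix.one_apply_eq _
  · rw [if_neg h]
    push Not at h
    obtain ⟨w, hw, hne⟩ := h
    rw [Finset.prod_eq_zero (i := w) (by simp [hw]), mul_zero]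
    rw [Function.update_of_ne hw]
    exact Matrix.one_apply_ne hne

theorem onQubit_pauliZ_eq_mono (v : V) : onQubit v pauliZ = mono id fun t => t v := by
  ext s t
  refine (onQubit_apply v _ s t).trans ?_
  rw [mono_apply]
  by_cases h : s = t
  · subst h
    simp only [id, if_true, implies_true]
    rcases bit_cases (s v) with h1 | h1 <;> rw [h1] <;> simp [sgn, pauliZ]
  · rw [id, if_neg h]
    by_cases h' : ∀ w, w ≠ v → s w = t w
    · rw [if_pos h']
      have hv : s v ≠ t v := fun hv => h (funext fun w => by
        by_cases hw : w = v
        · rw [hw, hv]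
        · exact h' w hw)
      rcases bit_cases (s v) with h1 | h1 <;> rcases bit_cases (t v) with h2 | h2 <;>
        rw [h1, h2] at hv ⊢ <;> first | exact absurd rfl hv | simp [pauliZ]
    · rw [if_neg h']

theorem onQubit_pauliX_eq_mono (v : V) :
    onQubit v pauliX = mono (fun t => Function.update t v (t v + 1)) 0 := by
  ext s t
  refine (onQubit_apply v _ s t).trans ?_
  rw [mono_apply]
  simp only [Pi.zero_apply, sgn_zero]
  by_cases h' : ∀ w, w ≠ v → s w = t w
  · rw [if_pos h']
    have key : s = Function.update t v (t v + 1) ↔ s v = t v + 1 := by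
      constructor
      · intro h
        rw [h, Function.update_self]
      · intro h
        funext w
        by_cases hw : w = v
        · rw [hw, Function.update_self, h]
        · rw [Function.update_of_ne hw, h' w hw]
    simp only [key]
    rcases bit_cases (s v) with h1 | h1 <;> rcases bit_cases (t v) with h2 | h2 <;>
      rw [h1, h2] <;> simp [pauliX, CharTwo.add_self_eq_zero]
  · rw [if_neg h', if_neg]
    intro h
    exact h' fun w hw => by rw [h, Function.update_of_ne hw]

end Monomial

/-! ### The action of gates and layers -/

section Gates

variable {V : Type} [Fintype V] [DecidableEq V] {G : SimpleGraph V}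

/-- The permutation of the bit strings underlying a gate. -/
def Gate.act : Gate G → Bits V → Bits V
  | .z _ => id
  | .cz _ _ _ => id
  | .cnot u v _ => fun t => Function.update t v (t v + t u)

/-- The sign of a gate. -/
def Gate.phase : Gate G → Bits V → Fin 2
  | .z v => fun t => t v
  | .cz u v _ => fun t => t u * t v
  | .cnot _ _ _ => 0

theorem Gate.op_eq_mono (g : Gate G) : g.op = mono g.act g.phase := by
  cases g with
  | z v => exact onQubit_pauliZ_eq_mono v
  | cz u v h => exact czOp_eq_mono u v
  | cnot u v h => exact cnotOp_eq_mono u v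

theorem Gate.act_of_notMem (g : Gate G) (t : Bits V) {v : V} (hv : v ∉ g.support) :
    g.act t v = t v := by
  cases g with
  | z v => rfl
  | cz u v h => rfl
  | cnot u w h =>
    have : v ≠ w := by rintro rfl; simp [Gate.support] at hv
    simp [Gate.act, this]

theorem Gate.act_congr (g : Gate G) {t t' : Bits V} (h : ∀ w ∈ g.support, t w = t' w) {v : V}
    (hv : v ∈ g.support) : g.act t v = g.act t' v := by
  cases g with
  | z v => exact h _ hv
  | cz u v _ => exact h _ hv
  | cnot u w _ =>
    have h1 := h v hv
    have h2 := h u (by simp [Gate.support])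
    have h3 := h w (by simp [Gate.support])
    simp only [Gate.act, Function.update_apply, h1, h2, h3]

theorem Gate.phase_congr (g : Gate G) {t t' : Bits V} (h : ∀ w ∈ g.support, t w = t' w) :
    g.phase t = g.phase t' := by
  cases g with
  | z v => exact h _ (by simp [Gate.support])
  | cz u v _ =>
    have h2 := h u (by simp [Gate.support])
    have h3 := h v (by simp [Gate.support])
    simp only [Gate.phase, h2, h3]
  | cnot u w _ => rfl

/-- A gate changes only bits of its support, and both the change and the sign depend only on those
bits. -/
theorem Gate.commute_of_disjoint {g h : Gate G} (hd : Disjoint g.support h.support) :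
    Commute g.op h.op := by
  have hg : ∀ t : Bits V, ∀ w ∈ g.support, h.act t w = t w := fun t w hw =>
    h.act_of_notMem t (Finset.disjoint_left.1 hd hw)
  have hh : ∀ t : Bits V, ∀ w ∈ h.support, g.act t w = t w := fun t w hw =>
    g.act_of_notMem t (Finset.disjoint_right.1 hd hw)
  rw [commute_iff_eq, g.op_eq_mono, h.op_eq_mono, mono_mul, mono_mul]
  refine mono_congr (fun t => ?_) fun t => ?_
  · funext v
    simp only [Function.comp_apply]
    by_cases h1 : v ∈ g.support
    · rw [g.act_congr (hg t) h1, h.act_of_notMem _ (Finset.disjoint_left.1 hd h1)]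
    · rw [g.act_of_notMem _ h1]
      by_cases h2 : v ∈ h.support
      · rw [h.act_congr (hh t) h2]
      · rw [h.act_of_notMem _ h2, h.act_of_notMem _ h2, g.act_of_notMem _ h1]
  · rw [g.phase_congr (hg t), h.phase_congr (hh t), add_comm]

theorem Gate.act_act (g : Gate G) (t : Bits V) : g.act (g.act t) = t := by
  cases g with
  | z v => rfl
  | cz u v h => rfl
  | cnot u w h =>
    have hne : u ≠ w := h.ne
    funext v
    by_cases hv : v = w
    · subst hv
      simp [Gate.act, hne, add_assoc, CharTwo.add_self_eq_zero]
    · simp [Gate.act, hv]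

theorem Gate.phase_act (g : Gate G) (t : Bits V) : g.phase (g.act t) = g.phase t := by
  cases g <;> rfl

theorem Gate.conjTranspose_op (g : Gate G) : g.opᴴ = g.op := by
  rw [g.op_eq_mono]
  exact mono_conjTranspose g.act_act g.act_act fun t => (g.phase_act t).symm

theorem Gate.op_mul_self (g : Gate G) : g.op * g.op = 1 := by
  rw [g.op_eq_mono, mono_mul, ← mono_one]
  refine mono_congr (fun t => g.act_act t) fun t => ?_
  rw [g.phase_act, CharTwo.add_self_eq_zero]
  rfl

theorem Layer.pairwise_commute (l : Layer G) : (l.gates.map Gate.op).Pairwise Commute := by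
  rw [List.pairwise_map]
  exact l.disjoint.imp fun h => Gate.commute_of_disjoint h

/-- The adjoint reverses the product of self-adjoint gates, which is harmless because they commute.
This is why a reversed circuit is the adjoint. -/
theorem Layer.conjTranspose_op (l : Layer G) : l.opᴴ = l.op := by
  rw [Layer.op, Matrix.conjTranspose_list_prod, List.map_map]
  have h : (Matrix.conjTranspose ∘ Gate.op : Gate G → Operator V) = Gate.op :=
    funext fun g => g.conjTranspose_op
  rw [h]
  exact (List.Perm.prod_eq' (List.reverse_perm _).symm l.pairwise_commute).symm

theorem prod_mul_prod_of_pairwise_commute {M : Type} [Monoid M] (l : List M)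
    (hc : l.Pairwise Commute) (hs : ∀ x ∈ l, x * x = 1) : l.prod * l.prod = 1 := by
  induction l with
  | nil => simp
  | cons a l ih =>
    rw [List.pairwise_cons] at hc
    have hcomm : Commute a l.prod := Commute.list_prod_right _ _ hc.1
    rw [List.prod_cons, mul_assoc, ← mul_assoc l.prod, ← hcomm.eq, mul_assoc,
      ih hc.2 fun x hx => hs x (List.mem_cons_of_mem _ hx), mul_one, hs a List.mem_cons_self]

theorem Layer.op_mul_self (l : Layer G) : l.op * l.op = 1 := by
  refine prod_mul_prod_of_pairwise_commute _ l.pairwise_commute ?_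
  simp only [List.mem_map]
  rintro _ ⟨g, _, rfl⟩
  exact g.op_mul_self

theorem Circuit.op_append (c d : Circuit G) :
    Circuit.op (c ++ d) = Circuit.op d * Circuit.op c := by
  induction c with
  | nil => simp [Circuit.op]
  | cons l c ih => simp [Circuit.op, ih, mul_assoc]

theorem Circuit.op_reverse (c : Circuit G) : Circuit.op c.reverse = (Circuit.op c)ᴴ := by
  induction c with
  | nil => simp [Circuit.op]
  | cons l c ih =>
    rw [List.reverse_cons, Circuit.op_append, ih]
    simp [Circuit.op, Matrix.conjTranspose_mul, l.conjTranspose_op]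

theorem Circuit.conjTranspose_mul_op (c : Circuit G) : (Circuit.op c)ᴴ * Circuit.op c = 1 := by
  induction c with
  | nil => simp [Circuit.op]
  | cons l c ih =>
    rw [Circuit.op, Matrix.conjTranspose_mul, l.conjTranspose_op, mul_assoc,
      ← mul_assoc (Circuit.op c)ᴴ, ih, one_mul, l.op_mul_self]

theorem Circuit.op_mul_conjTranspose (c : Circuit G) : Circuit.op c * (Circuit.op c)ᴴ = 1 :=
  mul_eq_one_comm.1 c.conjTranspose_mul_op

/-- Supports are nonempty and disjoint, so one qubit picked from each gate gives distinct vertices.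
-/
theorem Layer.length_gates_le (l : Layer G) : l.gates.length ≤ Fintype.card V := by
  obtain ⟨gs, hgs⟩ := l
  have key : ∀ gs : List (Gate G), (gs.Pairwise fun g h => Disjoint g.support h.support) →
      ∃ S : Finset V, gs.length ≤ S.card ∧ ∀ v ∈ S, ∃ g ∈ gs, v ∈ g.support := by
    intro gs
    induction gs with
    | nil => exact fun _ => ⟨∅, by simp⟩
    | cons g gs ih =>
      intro h
      rw [List.pairwise_cons] at h
      obtain ⟨S, hS, hS'⟩ := ih h.2
      obtain ⟨v, hv⟩ : ∃ v, v ∈ g.support := by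
        cases g <;> simp [Gate.support]
      have hvS : v ∉ S := fun hvS => by
        obtain ⟨g', hg', hv'⟩ := hS' v hvS
        exact Finset.disjoint_left.1 (h.1 g' hg') hv hv'
      refine ⟨insert v S, by simp [Finset.card_insert_of_notMem hvS, hS], ?_⟩
      intro w hw
      rcases Finset.mem_insert.1 hw with rfl | hw
      · exact ⟨g, by simp, hv⟩
      · obtain ⟨g', hg', hv'⟩ := hS' w hw
        exact ⟨g', by simp [hg'], hv'⟩
  obtain ⟨S, hS, -⟩ := key gs hgs
  exact hS.trans (Finset.card_le_univ S)

/-- Makes the gate count a consequence of the depth bound. -/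
theorem Circuit.size_le (c : Circuit G) : c.size ≤ c.depth * Fintype.card V := by
  induction c with
  | nil => simp [Circuit.size]
  | cons l c ih =>
    simp only [Circuit.size, Circuit.depth, List.map_cons, List.sum_cons, List.length_cons,
      add_mul, one_mul] at ih ⊢
    have := l.length_gates_le
    omega

end Gates

/-! ### Layers given by a matching -/

section MatchingLayers

variable {V : Type} [Fintype V] [DecidableEq V] {G : SimpleGraph V}

/-- The pairs `(src v, v)`, for `v` in `S`, are pairwise disjoint edges of `G`. -/
structure IsMatchingOn (G : SimpleGraph V) (S : Finset V) (src : V → V) : Prop where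
  adj : ∀ v ∈ S, G.Adj (src v) v
  src_notMem : ∀ v ∈ S, src v ∉ S
  injOn : Set.InjOn src S

/-- Add to every bit in `S` the bit at its source. -/
def addSrc (S : Finset V) (src : V → V) (t : Bits V) : Bits V :=
  fun v => if v ∈ S then t v + t (src v) else t v

theorem IsMatchingOn.pair_disjoint {S : Finset V} {src : V → V} (h : IsMatchingOn G S src)
    {v w : V} (hv : v ∈ S) (hw : w ∈ S) (hne : v ≠ w) :
    Disjoint ({src v, v} : Finset V) {src w, w} := by
  have h1 : src v ≠ src w := fun e => hne (h.injOn hv hw e)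
  have h2 : src v ≠ w := fun e => h.src_notMem v hv (e ▸ hw)
  have h3 : v ≠ src w := fun e => h.src_notMem w hw (e ▸ hv)
  simp [h1.symm, h2.symm, h3.symm, hne.symm]

/-- The layer of the gates `gate v`, for `v` in `S`, each supported on the edge of `v`. -/
def IsMatchingOn.layer {S : Finset V} {src : V → V} (h : IsMatchingOn G S src)
    (gate : ∀ u v : V, G.Adj u v → Gate G) (hgate : ∀ u v e, (gate u v e).support ⊆ {u, v}) :
    Layer G where
  gates := S.toList.pmap (fun v hv => gate (src v) v (h.adj v hv)) fun v hv => Finset.mem_toList.1 hv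
  disjoint := by
    refine List.Pairwise.pmap S.nodup_toList _ ?_
    intro v hv w hw hne
    exact ((h.pair_disjoint hv hw hne).mono_left (hgate _ _ _)).mono_right (hgate _ _ _)

/-- No control is a target, so the gates applied one after another read the same bits as a
simultaneous update. -/
theorem IsMatchingOn.cnot_op {S : Finset V} {src : V → V} (h : IsMatchingOn G S src) :
    (h.layer Gate.cnot fun _ _ _ => subset_rfl).op = mono (addSrc S src) 0 := by
  have key : ∀ (l : List V) (hl : ∀ v ∈ l, v ∈ S), l.Nodup →
      ((l.pmap (fun v hv => Gate.cnot (G := G) (src v) v (h.adj v hv)) hl).map Gate.op).prod =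
        mono (addSrc l.toFinset src) 0 := by
    intro l
    induction l with
    | nil =>
      intro _ _
      simp only [List.pmap_nil, List.map_nil, List.prod_nil, ← mono_one]
      exact mono_congr (fun t => by funext v; simp [addSrc]) fun t => rfl
    | cons a l ih =>
      intro hl hnd
      rw [List.nodup_cons] at hnd
      simp only [List.pmap_cons, List.map_cons, List.prod_cons]
      rw [ih (fun v hv => hl v (List.mem_cons_of_mem _ hv)) hnd.2, Gate.op, cnotOp_eq_mono,
        mono_mul]
      refine mono_congr (fun t => ?_) fun t => by simp
      funext v
      have ha : src a ∉ l := fun hs => h.src_notMem a (hl a List.mem_cons_self)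
        (hl _ (List.mem_cons_of_mem _ hs))
      by_cases hv : v = a
      · subst hv
        simp [addSrc, hnd.1, ha]
      · simp [addSrc, hv]
  unfold Layer.op IsMatchingOn.layer
  simpa using key S.toList (fun v hv => Finset.mem_toList.1 hv) S.nodup_toList

theorem IsMatchingOn.cz_op {S : Finset V} {src : V → V} (h : IsMatchingOn G S src) :
    (h.layer Gate.cz fun _ _ _ => subset_rfl).op =
      mono id fun t => ∑ v ∈ S, t (src v) * t v := by
  have key : ∀ (l : List V) (hl : ∀ v ∈ l, v ∈ S), l.Nodup →
      ((l.pmap (fun v hv => Gate.cz (G := G) (src v) v (h.adj v hv)) hl).map Gate.op).prod =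
        mono id fun t => ∑ v ∈ l.toFinset, t (src v) * t v := by
    intro l
    induction l with
    | nil =>
      intro _ _
      simp only [List.pmap_nil, List.map_nil, List.prod_nil, ← mono_one]
      exact mono_congr (fun t => rfl) fun t => by simp
    | cons a l ih =>
      intro hl hnd
      rw [List.nodup_cons] at hnd
      simp only [List.pmap_cons, List.map_cons, List.prod_cons]
      rw [ih (fun v hv => hl v (List.mem_cons_of_mem _ hv)) hnd.2, Gate.op, czOp_eq_mono,
        mono_mul]
      refine mono_congr (fun t => rfl) fun t => ?_
      rw [List.toFinset_cons, Finset.sum_insert (by simpa using hnd.1), add_comm]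
      rfl
  unfold Layer.op IsMatchingOn.layer
  simpa using key S.toList (fun v hv => Finset.mem_toList.1 hv) S.nodup_toList

/-- The layer of `Z` gates on the qubits in `S`. -/
def zLayer (G : SimpleGraph V) (S : Finset V) : Layer G where
  gates := S.toList.map Gate.z
  disjoint := by
    rw [List.pairwise_map]
    exact S.nodup_toList.imp fun {a b} h => by simpa [Gate.support] using h

theorem zLayer_op (S : Finset V) : (zLayer G S).op = mono id fun t => ∑ v ∈ S, t v := by
  have key : ∀ l : List V, l.Nodup → ((l.map (Gate.z (G := G))).map Gate.op).prod =
      mono id fun t => ∑ v ∈ l.toFinset, t v := by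
    intro l
    induction l with
    | nil =>
      intro _
      simp only [List.map_nil, List.prod_nil, ← mono_one]
      exact mono_congr (fun t => rfl) fun t => by simp
    | cons a l ih =>
      intro hnd
      rw [List.nodup_cons] at hnd
      rw [List.map_cons, List.map_cons, List.prod_cons, ih hnd.2, Gate.op, onQubit_pauliZ_eq_mono,
        mono_mul]
      refine mono_congr (fun t => rfl) fun t => ?_
      rw [List.toFinset_cons, Finset.sum_insert (by simpa using hnd.1), add_comm]
      rfl
  rw [Layer.op, zLayer]
  simpa using key S.toList S.nodup_toList

end MatchingLayers

/-! ### Operators with a shallow circuit -/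

section Feasible

variable {V : Type} [Fintype V] [DecidableEq V] {G : SimpleGraph V}

/-- `U` is the unitary of a circuit of depth at most `d`, which consists of controlled not gates
only if `cn` holds. -/
def Feasible (G : SimpleGraph V) (cn : Prop) (d : ℕ) (U : Operator V) : Prop :=
  ∃ c : Circuit G, (cn → c.IsCNOTOnly) ∧ c.depth ≤ d ∧ Circuit.op c = U

variable {cn : Prop} {d e : ℕ} {U W : Operator V}

theorem Feasible.one : Feasible G cn 0 1 :=
  ⟨[], fun _ l hl => by simp at hl, le_rfl, rfl⟩

theorem Feasible.mono_depth (h : Feasible G cn d U) (hde : d ≤ e) : Feasible G cn e U := by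
  obtain ⟨c, h1, h2, h3⟩ := h
  exact ⟨c, h1, h2.trans hde, h3⟩

theorem Feasible.of_cnot (h : Feasible G True d U) : Feasible G cn d U := by
  obtain ⟨c, h1, h2, h3⟩ := h
  exact ⟨c, fun _ => h1 trivial, h2, h3⟩

theorem Feasible.mul (hU : Feasible G cn d U) (hW : Feasible G cn e W) :
    Feasible G cn (d + e) (W * U) := by
  obtain ⟨c, h1, h2, h3⟩ := hU
  obtain ⟨c', h1', h2', h3'⟩ := hW
  refine ⟨c ++ c', fun h l hl => ?_, ?_, ?_⟩
  · rcases List.mem_append.1 hl with hl | hl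
    · exact h1 h l hl
    · exact h1' h l hl
  · simp only [Circuit.depth, List.length_append] at *
    omega
  · rw [Circuit.op_append, h3, h3']

theorem Feasible.conjTranspose (hU : Feasible G cn d U) : Feasible G cn d Uᴴ := by
  obtain ⟨c, h1, h2, h3⟩ := hU
  refine ⟨c.reverse, fun h l hl => h1 h l (List.mem_reverse.1 hl), ?_, ?_⟩
  · simpa [Circuit.depth] using h2
  · rw [Circuit.op_reverse, h3]

theorem Feasible.conjTranspose_mul (hU : Feasible G cn d U) : Uᴴ * U = 1 := by
  obtain ⟨c, h1, h2, rfl⟩ := hU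
  exact c.conjTranspose_mul_op

theorem IsMatchingOn.feasible_cnot {S : Finset V} {src : V → V} (h : IsMatchingOn G S src) :
    Feasible G cn 1 (mono (addSrc S src) 0) := by
  refine ⟨[h.layer Gate.cnot fun _ _ _ => subset_rfl], fun _ l hl g hg => ?_, le_rfl, ?_⟩
  · rw [List.mem_singleton] at hl
    subst hl
    obtain ⟨v, hv, rfl⟩ := List.mem_pmap.1 hg
    trivial
  · rw [Circuit.op, Circuit.op, one_mul, h.cnot_op]

theorem IsMatchingOn.feasible_cz {S : Finset V} {src : V → V} (h : IsMatchingOn G S src) :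
    Feasible G False 1 (mono id fun t => ∑ v ∈ S, t (src v) * t v) :=
  ⟨[h.layer Gate.cz fun _ _ _ => subset_rfl], False.elim, le_rfl, by
    rw [Circuit.op, Circuit.op, one_mul, h.cz_op]⟩

theorem feasible_z (S : Finset V) : Feasible G False 1 (mono id fun t => ∑ v ∈ S, t v) :=
  ⟨[zLayer G S], False.elim, le_rfl, by rw [Circuit.op, Circuit.op, one_mul, zLayer_op]⟩

/-- Diagonal signs add up. -/
theorem Feasible.add_phase {p q : Bits V → Fin 2} (hp : Feasible G cn d (mono id p))
    (hq : Feasible G cn e (mono id q)) : Feasible G cn (d + e) (mono id fun t => p t + q t) := by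
  have := hp.mul hq
  rwa [mono_mul] at this

/-- A diagonal sign, evaluated after a change of variables. -/
theorem Feasible.conj_phase {f : Bits V → Bits V} {q : Bits V → Fin 2}
    (hf : Feasible G True d (mono f 0)) (hq : Feasible G False e (mono id q)) :
    Feasible G False (d + e + d) (mono id fun t => q (f t)) := by
  have h1 : Feasible G False (d + e + d) _ :=
    (hf.of_cnot.mul hq).mul hf.of_cnot.conjTranspose
  -- The sign is pulled through the bit map, which then cancels against its adjoint.
  have h2 : mono id q * mono f 0 = mono f 0 * mono id fun t => q (f t) := by
    rw [mono_mul, mono_mul]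
    exact mono_congr (fun t => rfl) fun t => by simp
  rwa [h2, ← mul_assoc, hf.conjTranspose_mul, one_mul] at h1

end Feasible

/-! ### Permutations by layers of swaps -/

section Swaps

variable {V : Type} {G H : SimpleGraph V}

/-- The permutation `τ` exchanges the ends of pairwise disjoint edges of `G`. -/
structure IsSwapLayer (G : SimpleGraph V) (τ : Equiv.Perm V) : Prop where
  invol : ∀ v, τ (τ v) = v
  adj : ∀ v, τ v ≠ v → G.Adj v (τ v)

theorem IsSwapLayer.one : IsSwapLayer G 1 := ⟨fun _ => rfl, fun _ h => absurd rfl h⟩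

theorem IsSwapLayer.mul {τ τ' : Equiv.Perm V} (h : IsSwapLayer G τ) (h' : IsSwapLayer G τ')
    (hd : τ.Disjoint τ') : IsSwapLayer G (τ * τ') := by
  have key : ∀ v, (τ * τ') v = τ v ∧ τ' v = v ∨ (τ * τ') v = τ' v ∧ τ v = v := by
    intro v
    rcases hd v with hv | hv
    · right
      exact ⟨by rw [hd.commute.eq, Equiv.Perm.mul_apply, hv], hv⟩
    · left
      exact ⟨by rw [Equiv.Perm.mul_apply, hv], hv⟩
  constructor
  · intro v
    have hc : (τ * τ') * (τ * τ') = 1 := by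
      have e1 : τ * τ = 1 := Equiv.ext h.invol
      have e2 : τ' * τ' = 1 := Equiv.ext h'.invol
      have e3 := hd.commute.eq
      calc (τ * τ') * (τ * τ') = τ * (τ' * τ) * τ' := by group
        _ = (τ * τ) * (τ' * τ') := by rw [← e3]; group
        _ = 1 := by rw [e1, e2, one_mul]
    exact congrArg (fun f : Equiv.Perm V => f v) hc
  · intro v hv
    rcases key v with ⟨e, -⟩ | ⟨e, -⟩
    · rw [e] at hv ⊢; exact h.adj v hv
    · rw [e] at hv ⊢; exact h'.adj v hv

theorem IsSwapLayer.mono_graph {τ : Equiv.Perm V} (h : IsSwapLayer G τ) (hGH : G ≤ H) :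
    IsSwapLayer H τ := ⟨h.invol, fun v hv => hGH (h.adj v hv)⟩

theorem IsSwapLayer.inv {τ : Equiv.Perm V} (h : IsSwapLayer G τ) : τ⁻¹ = τ :=
  inv_eq_of_mul_eq_one_left (Equiv.ext h.invol)

theorem isSwapLayer_swap [DecidableEq V] {u v : V} (h : G.Adj u v) :
    IsSwapLayer G (Equiv.swap u v) := by
  refine ⟨Equiv.swap_apply_self u v, fun w hw => ?_⟩
  by_cases h1 : w = u
  · subst h1; rwa [Equiv.swap_apply_left]
  · by_cases h2 : w = v
    · subst h2; rw [Equiv.swap_apply_right]; exact h.symm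
    · exact absurd (Equiv.swap_apply_of_ne_of_ne h1 h2) hw

/-- The permutation is the product of `d` layers of swaps along edges of `G`. -/
inductive SwapDepth (G : SimpleGraph V) : ℕ → Equiv.Perm V → Prop
  | one : SwapDepth G 0 1
  | step {d : ℕ} {τ σ : Equiv.Perm V} (hσ : SwapDepth G d σ) (hτ : IsSwapLayer G τ) :
      SwapDepth G (d + 1) (τ * σ)

theorem SwapDepth.mul {d e : ℕ} {σ ρ : Equiv.Perm V} (h : SwapDepth G d σ)
    (h' : SwapDepth G e ρ) : SwapDepth G (d + e) (ρ * σ) := by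
  induction h' with
  | one => simpa using h
  | step hσ hτ ih => rw [mul_assoc]; exact ih.step hτ

theorem SwapDepth.mono_graph {d : ℕ} {σ : Equiv.Perm V} (h : SwapDepth G d σ) (hGH : G ≤ H) :
    SwapDepth H d σ := by
  induction h with
  | one => exact .one
  | step hσ hτ ih => exact ih.step (hτ.mono_graph hGH)

theorem viaEmbedding_mul {W : Type} (ι : V ↪ W) (σ τ : Equiv.Perm V) :
    (σ * τ).viaEmbedding ι = σ.viaEmbedding ι * τ.viaEmbedding ι :=
  map_mul (Equiv.Perm.viaEmbeddingHom ι) σ τ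

theorem viaEmbedding_one {W : Type} (ι : V ↪ W) : (1 : Equiv.Perm V).viaEmbedding ι = 1 :=
  map_one (Equiv.Perm.viaEmbeddingHom ι)

theorem SwapDepth.viaEmbedding {W : Type} {K : SimpleGraph W} (ι : V ↪ W)
    (hι : ∀ u v, G.Adj u v → K.Adj (ι u) (ι v)) {d : ℕ} {σ : Equiv.Perm V}
    (h : SwapDepth G d σ) : SwapDepth K d (σ.viaEmbedding ι) := by
  induction h with
  | one => rw [viaEmbedding_one]; exact .one
  | step hσ hτ ih =>
    rw [viaEmbedding_mul]
    refine ih.step ⟨fun w => ?_, fun w hw => ?_⟩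
    · by_cases hw : w ∈ Set.range ι
      · obtain ⟨v, rfl⟩ := hw
        rw [Equiv.Perm.viaEmbedding_apply, Equiv.Perm.viaEmbedding_apply, hτ.invol]
      · rw [Equiv.Perm.viaEmbedding_apply_of_notMem _ _ _ hw,
          Equiv.Perm.viaEmbedding_apply_of_notMem _ _ _ hw]
    · by_cases hw' : w ∈ Set.range ι
      · obtain ⟨v, rfl⟩ := hw'
        rw [Equiv.Perm.viaEmbedding_apply] at hw ⊢
        exact hι _ _ (hτ.adj v fun e => hw (by rw [e]))
      · exact absurd (Equiv.Perm.viaEmbedding_apply_of_notMem _ _ _ hw') hw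

end Swaps

/-! ### Swap layers as circuits of CNOTs -/

section SwapCircuits

variable {V : Type} [Fintype V] [DecidableEq V] {G : SimpleGraph V}

/-- The vertices that `τ` moves upwards with respect to the key `k`. -/
def lowerEnds (k : V → ℕ) (τ : Equiv.Perm V) : Finset V :=
  Finset.univ.filter fun v => k v < k (τ v)

theorem IsSwapLayer.isMatchingOn_lowerEnds {τ : Equiv.Perm V} (h : IsSwapLayer G τ)
    (k : V → ℕ) : IsMatchingOn G (lowerEnds k τ) τ where
  adj v hv := by
    simp only [lowerEnds, Finset.mem_filter, Finset.mem_univ, true_and] at hv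
    exact (h.adj v fun e => by rw [e] at hv; exact lt_irrefl _ hv).symm
  src_notMem v hv := by
    simp only [lowerEnds, Finset.mem_filter, Finset.mem_univ, true_and, h.invol] at hv ⊢
    exact hv.le.not_gt
  injOn := τ.injective.injOn

theorem IsSwapLayer.isMatchingOn_upperEnds {τ : Equiv.Perm V} (h : IsSwapLayer G τ)
    (k : V → ℕ) : IsMatchingOn G (Finset.univ.filter fun v => k (τ v) < k v) τ where
  adj v hv := by
    simp only [Finset.mem_filter, Finset.mem_univ, true_and] at hv
    exact (h.adj v fun e => by rw [e] at hv; exact lt_irrefl _ hv).symm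
  src_notMem v hv := by
    simp only [Finset.mem_filter, Finset.mem_univ, true_and, h.invol] at hv ⊢
    exact hv.le.not_gt
  injOn := τ.injective.injOn

/-- A swap is three CNOTs of alternating direction. An arbitrary injective key decides which end of
each pair is the target of the first and third one. -/
theorem IsSwapLayer.feasible {τ : Equiv.Perm V} (h : IsSwapLayer G τ) (cn : Prop) :
    Feasible G cn 3 (qubitPermOp τ) := by
  obtain ⟨k, hk⟩ : ∃ k : V → ℕ, Function.Injective k :=
    ⟨fun v => (Fintype.equivFin V v : ℕ),
      fun _ _ e => (Fintype.equivFin V).injective (Fin.ext e)⟩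
  have h1 := (h.isMatchingOn_lowerEnds k).feasible_cnot (cn := cn)
  have h2 := (h.isMatchingOn_upperEnds k).feasible_cnot (cn := cn)
  have h3 := (h1.mul h2).mul h1
  rw [mono_mul, mono_mul] at h3
  convert h3 using 1
  rw [qubitPermOp_eq_mono]
  refine mono_congr (fun t => ?_) fun t => by simp
  funext v
  have hs : τ.symm = τ := h.inv
  have h2v : ∀ a b : Fin 2, a + b + b = a ∧ a + (b + a) = b ∧ a + b + a = b := by decide
  simp only [hs, Function.comp_apply, addSrc, lowerEnds, Finset.mem_filter, Finset.mem_univ,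
    true_and, h.invol]
  rcases lt_trichotomy (k v) (k (τ v)) with hlt | heq | hgt
  · simp [hlt, hlt.le.not_gt, h2v]
  · have := hk heq
    simp [← this]
  · simp [hgt, hgt.le.not_gt, h2v]

theorem qubitPermOp_mul (σ τ : Equiv.Perm V) :
    qubitPermOp (σ * τ) = qubitPermOp σ * qubitPermOp τ := by
  rw [qubitPermOp_eq_mono, qubitPermOp_eq_mono, qubitPermOp_eq_mono, mono_mul]
  exact mono_congr (fun t => rfl) fun t => by simp

theorem qubitPermOp_one : qubitPermOp (1 : Equiv.Perm V) = 1 := by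
  rw [qubitPermOp_eq_mono, ← mono_one]
  exact mono_congr (fun t => rfl) fun t => rfl

theorem SwapDepth.feasible {d : ℕ} {σ : Equiv.Perm V} (h : SwapDepth G d σ) (cn : Prop) :
    Feasible G cn (3 * d) (qubitPermOp σ) := by
  induction h with
  | one => rw [qubitPermOp_one]; exact .one
  | step hσ hτ ih => rw [qubitPermOp_mul]; exact ih.mul (hτ.feasible cn)

end SwapCircuits

/-! ### Routing on a path -/

section PathRouting

variable {V : Type}

/-- The product of the first `n` terms of `τ`, later terms on the left. -/
def prodUpTo (τ : ℕ → Equiv.Perm V) : ℕ → Equiv.Perm V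
  | 0 => 1
  | n + 1 => τ n * prodUpTo τ n

theorem swapDepth_prodUpTo {G : SimpleGraph V} {τ : ℕ → Equiv.Perm V}
    (h : ∀ t, IsSwapLayer G (τ t)) (n : ℕ) : SwapDepth G n (prodUpTo τ n) := by
  induction n with
  | zero => exact .one
  | succ n ih => exact ih.step (h n)

/-- The swaps of neighbours that move the element at `n` down to `k`, the first one at time
`n + 1`. -/
def chainSwap (N n k : ℕ) (hn : n < N) (t : ℕ) : Equiv.Perm (Fin N) :=
  if h : n + 1 ≤ t ∧ t + k ≤ 2 * n then
    Equiv.swap ⟨2 * n - t, by omega⟩ ⟨2 * n + 1 - t, by omega⟩ else 1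

theorem chainSwap_of_lt {N n k : ℕ} (hn : n < N) (t : ℕ) (x : Fin N)
    (h : x + t < 2 * n ∨ 2 * n + 1 < x + t ∨ n < x) : chainSwap N n k hn t x = x := by
  unfold chainSwap
  split_ifs with h'
  · exact Equiv.swap_apply_of_ne_of_ne (fun e => by rw [e] at h; simp at h; omega)
      (fun e => by rw [e] at h; simp at h; omega)
  · rfl

theorem isSwapLayer_chainSwap {N n k : ℕ} (hn : n < N) (t : ℕ) :
    IsSwapLayer (SimpleGraph.pathGraph N) (chainSwap N n k hn t) := by
  unfold chainSwap
  split_ifs with h'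
  · refine isSwapLayer_swap ?_
    rw [SimpleGraph.pathGraph_adj]
    left
    simp only
    omega
  · exact .one

theorem prodUpTo_chainSwap_of_lt {N n k : ℕ} (hn : n < N) (t : ℕ) (x : Fin N)
    (h : x + t ≤ 2 * n ∨ n < x) : prodUpTo (chainSwap N n k hn) t x = x := by
  induction t with
  | zero => rfl
  | succ t ih =>
    rw [prodUpTo, Equiv.Perm.mul_apply, ih (by omega), chainSwap_of_lt]
    omega

theorem prodUpTo_chainSwap_apply {N n k : ℕ} (hn : n < N) (hk : k ≤ n) (t : ℕ) :
    (prodUpTo (chainSwap N n k hn) t ⟨n, hn⟩ : ℕ) =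
      if t ≤ n + 1 then n else max k (2 * n + 1 - t) := by
  induction t with
  | zero => simp [prodUpTo]
  | succ t ih =>
    rw [prodUpTo, Equiv.Perm.mul_apply]
    set y := prodUpTo (chainSwap N n k hn) t ⟨n, hn⟩ with hy
    by_cases h : n + 1 ≤ t ∧ t + k ≤ 2 * n
    · have hyv : y = ⟨2 * n + 1 - t, by omega⟩ := Fin.ext (by simp only; split_ifs at ih <;> omega)
      rw [chainSwap, dif_pos h, hyv, Equiv.swap_apply_right]
      simp only
      split_ifs <;> omega
    · rw [chainSwap, dif_neg h, Equiv.Perm.one_apply]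
      split_ifs at ih ⊢ <;> omega

/-- Pipelined insertion: the element at `n` is moved to its place by a chain of swaps that at time
`t` occupies the positions with `x + t` equal to `2 * n` or `2 * n + 1`, just behind the chains of
the smaller elements. The second conclusion, which keeps the layers ahead of the next chain, is
there for the induction. -/
theorem exists_pathLayers (N n : ℕ) (hn : n ≤ N) (σ : Equiv.Perm (Fin N))
    (hσ : ∀ x : Fin N, n ≤ x → σ x = x) :
    ∃ τ : ℕ → Equiv.Perm (Fin N), (∀ t, IsSwapLayer (SimpleGraph.pathGraph N) (τ t)) ∧
      (∀ (t : ℕ) (x : Fin N), 2 * n ≤ x + t → τ t x = x) ∧ prodUpTo τ (2 * n) = σ := by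
  induction n generalizing σ with
  | zero =>
    exact ⟨fun _ => 1, fun _ => .one, fun _ _ _ => rfl,
      Equiv.ext fun x => (hσ x (Nat.zero_le _)).symm⟩
  | succ n ih =>
    have hn' : n < N := hn
    have hk : (σ ⟨n, hn'⟩ : ℕ) ≤ n := by
      by_contra! h
      have h1 := hσ (σ ⟨n, hn'⟩) h
      have h2 := σ.injective h1
      rw [h2] at h
      simp at h
    set k : ℕ := (σ ⟨n, hn'⟩ : Fin N).val with hkdef
    set w := chainSwap N n k hn' with hw
    set C := prodUpTo w (2 * n + 2) with hC
    have hCy : C ⟨n, hn'⟩ = σ ⟨n, hn'⟩ := by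
      apply Fin.ext
      rw [hC, hw, prodUpTo_chainSwap_apply hn' hk, if_neg (by omega), ← hkdef]
      omega
    -- With the new chain split off on the left, the remaining permutation fixes `n` as well.
    obtain ⟨τ, h1, h2, h3⟩ := ih hn'.le (C⁻¹ * σ) (by
      intro x hx
      rw [Equiv.Perm.mul_apply, Equiv.Perm.inv_eq_iff_eq]
      rcases hx.eq_or_lt with e | hlt
      · have : x = ⟨n, hn'⟩ := Fin.ext e.symm
        rw [this, hCy]
      · rw [hσ x hlt, hC, hw, prodUpTo_chainSwap_of_lt hn' _ _ (Or.inr hlt)])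
    -- At time `t` the old layers move only positions with `x + t < 2 * n`, and the new chain only
    -- larger ones.
    have hdisj : ∀ t, (w t).Disjoint (τ t) := by
      intro t x
      by_cases hx : 2 * n ≤ x + t
      · exact Or.inr (h2 t x hx)
      · exact Or.inl (chainSwap_of_lt hn' t x (by omega))
    -- Before time `t` the new chain has touched only positions with `x + t > 2 * n`, so the old
    -- layer at time `t` can be moved past all of it.
    have hcomm : ∀ t, Commute (τ t) (prodUpTo w t) := by
      intro t
      refine Equiv.Perm.Disjoint.commute fun x => ?_
      by_cases hx : 2 * n ≤ x + t
      · exact Or.inl (h2 t x hx)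
      · exact Or.inr (prodUpTo_chainSwap_of_lt hn' t x (by omega))
    have hprod : ∀ t, prodUpTo (fun t => w t * τ t) t = prodUpTo w t * prodUpTo τ t := by
      intro t
      induction t with
      | zero => rfl
      | succ t iht =>
        simp only [prodUpTo]
        rw [iht, mul_assoc, ← mul_assoc (τ t), (hcomm t).eq]
        group
    refine ⟨fun t => w t * τ t, fun t => (isSwapLayer_chainSwap hn' t).mul (h1 t) (hdisj t), ?_, ?_⟩
    · intro t x hx
      rw [Equiv.Perm.mul_apply, h2 t x (by omega)]
      exact chainSwap_of_lt hn' t x (by omega)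
    -- The two additional time steps serve the new chain alone.
    · have e0 : τ (2 * n) = 1 := Equiv.ext fun x => h2 _ x (by omega)
      have e1 : τ (2 * n + 1) = 1 := Equiv.ext fun x => h2 _ x (by omega)
      have e2 : prodUpTo τ (2 * n + 2) = C⁻¹ * σ := by
        rw [prodUpTo, prodUpTo, e0, e1, h3, one_mul, one_mul]
      rw [show 2 * (n + 1) = 2 * n + 2 by ring, hprod, e2, ← hC, mul_inv_cancel_left]

theorem swapDepth_pathGraph {n : ℕ} (σ : Equiv.Perm (Fin n)) :
    SwapDepth (SimpleGraph.pathGraph n) (2 * n) σ := by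
  obtain ⟨τ, h1, -, rfl⟩ := exists_pathLayers n n le_rfl σ fun x hx => absurd x.2 (by omega)
  exact swapDepth_prodUpTo h1 _

end PathRouting

/-! ### Routing on the grid -/

section GridRouting

/-- The horizontal edges of the grid. -/
def rowGraph (n : ℕ) : SimpleGraph (Fin n × Fin n) where
  Adj u v := u.1 = v.1 ∧ (SimpleGraph.pathGraph n).Adj u.2 v.2
  symm.symm := fun _ _ h => ⟨h.1.symm, h.2.symm⟩
  loopless := ⟨fun _ h => h.2.ne rfl⟩

/-- The vertical edges of the grid. -/
def colGraph (n : ℕ) : SimpleGraph (Fin n × Fin n) where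
  Adj u v := u.2 = v.2 ∧ (SimpleGraph.pathGraph n).Adj u.1 v.1
  symm.symm := fun _ _ h => ⟨h.1.symm, h.2.symm⟩
  loopless := ⟨fun _ h => h.2.ne rfl⟩

theorem rowGraph_le (n : ℕ) : rowGraph n ≤ gridGraph n := fun _ _ h =>
  SimpleGraph.boxProd_adj.2 (Or.inr ⟨h.2, h.1⟩)

theorem colGraph_le (n : ℕ) : colGraph n ≤ gridGraph n := fun _ _ h =>
  SimpleGraph.boxProd_adj.2 (Or.inl ⟨h.2, h.1⟩)

/-- The index of `SwapDepth` is the exact number of layers, so all rows run in lockstep and their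
simultaneous layers form one layer of the grid. -/
theorem swapDepth_prodShear {n d : ℕ} (σ : Fin n → Equiv.Perm (Fin n))
    (h : ∀ r, SwapDepth (SimpleGraph.pathGraph n) d (σ r)) :
    SwapDepth (rowGraph n) d (Equiv.prodShear (Equiv.refl _) σ) := by
  induction d generalizing σ with
  | zero =>
    have : Equiv.prodShear (Equiv.refl _) σ = 1 := by
      ext ⟨r, c⟩ : 1
      have : ∀ s, SwapDepth (SimpleGraph.pathGraph n) 0 s → s = 1 := fun s hs => by cases hs; rfl
      have := this _ (h r)
      simp [this]
    rw [this]
    exact .one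
  | succ d ih =>
    have : ∀ r, ∃ τ ρ, SwapDepth (SimpleGraph.pathGraph n) d ρ ∧
        IsSwapLayer (SimpleGraph.pathGraph n) τ ∧ σ r = τ * ρ := by
      intro r
      generalize hσ : σ r = s
      have hr := h r
      rw [hσ] at hr
      cases hr with
      | step h1 h2 => exact ⟨_, _, h1, h2, rfl⟩
    choose τ ρ h1 h2 h3 using this
    have e : Equiv.prodShear (Equiv.refl _) σ =
        (Equiv.prodShear (Equiv.refl _) τ : Equiv.Perm (Fin n × Fin n)) *
          Equiv.prodShear (Equiv.refl _) ρ := by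
      ext ⟨r, c⟩ : 1
      simp [h3, Equiv.Perm.mul_apply]
    rw [e]
    refine (ih ρ h1).step ⟨fun v => ?_, fun v hv => ?_⟩
    · ext : 1 <;> simp [(h2 _).invol]
    · refine ⟨rfl, (h2 v.1).adj v.2 fun e => hv ?_⟩
      ext : 1 <;> simp [e]

theorem swapDepth_rowGraph {n : ℕ} (p : Equiv.Perm (Fin n × Fin n)) (hp : ∀ v, (p v).1 = v.1) :
    SwapDepth (rowGraph n) (2 * n) p := by
  have hinj : ∀ r : Fin n, Function.Injective fun c => (p (r, c)).2 := by
    intro r c c' h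
    have : p (r, c) = p (r, c') := Prod.ext ((hp (r, c)).trans (hp (r, c')).symm) h
    exact congrArg Prod.snd (p.injective this)
  have e : p = Equiv.prodShear (Equiv.refl _) fun r =>
      Equiv.ofBijective _ (Finite.injective_iff_bijective.1 (hinj r)) := by
    ext ⟨r, c⟩ : 1
    exact Prod.ext (hp _) rfl
  rw [e]
  exact swapDepth_prodShear _ fun r => swapDepth_pathGraph _

theorem swapDepth_colGraph {n : ℕ} (p : Equiv.Perm (Fin n × Fin n)) (hp : ∀ v, (p v).2 = v.2) :
    SwapDepth (colGraph n) (2 * n) p := by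
  have h := swapDepth_rowGraph ((Equiv.prodComm _ _).trans (p.trans (Equiv.prodComm _ _)))
    fun v => hp v.swap
  have h' := h.viaEmbedding (K := colGraph n) (Equiv.prodComm (Fin n) (Fin n)).toEmbedding
    fun u v huv => huv
  convert h' using 1
  ext v : 1
  obtain ⟨w, rfl⟩ := (Equiv.prodComm (Fin n) (Fin n)).surjective v
  have := Equiv.Perm.viaEmbedding_apply ((Equiv.prodComm (Fin n) (Fin n)).trans
    (p.trans (Equiv.prodComm _ _))) (Equiv.prodComm (Fin n) (Fin n)).toEmbedding w
  simp only [Equiv.coe_toEmbedding] at this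
  rw [this]
  simp

theorem card_filter_mem_eq {E ι : Type} [DecidableEq ι] (S : Finset E) (a : E → ι) (s : Finset ι)
    (d : ℕ) (ha : ∀ i, (S.filter fun e => a e = i).card = d) :
    (S.filter fun e => a e ∈ s).card = s.card * d := by
  rw [Finset.card_eq_sum_card_fiberwise (s := S.filter fun e => a e ∈ s) (f := a) (t := s)
    fun e he => Finset.mem_coe.2 (Finset.mem_filter.1 he).2]
  refine Finset.sum_const_nat fun i hi => ?_
  rw [← ha i, Finset.filter_filter]
  congr 1
  ext e
  simp only [Finset.mem_filter]
  exact ⟨fun h => ⟨h.1, h.2.2⟩, fun h => ⟨h.1, h.2 ▸ hi, h.2⟩⟩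

/-- A bipartite multigraph with constant degree `d` has a proper edge colouring by `d` colours. -/
theorem exists_edgeColoring {E ι : Type} [DecidableEq E] [Fintype ι] [DecidableEq ι] (d : ℕ)
    (a b : E → ι) (S : Finset E) (ha : ∀ i, (S.filter fun e => a e = i).card = d)
    (hb : ∀ i, (S.filter fun e => b e = i).card = d) :
    ∃ col : E → ℕ, (∀ e ∈ S, col e < d) ∧
      (∀ e ∈ S, ∀ e' ∈ S, a e = a e' → col e = col e' → e = e') ∧
      (∀ e ∈ S, ∀ e' ∈ S, b e = b e' → col e = col e' → e = e') := by
  induction d generalizing S with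
  | zero =>
    have : ∀ e, e ∉ S := by
      intro e he
      have := Finset.card_eq_zero.1 (ha (a e))
      exact Finset.notMem_empty e (this ▸ Finset.mem_filter.2 ⟨he, rfl⟩)
    exact ⟨fun _ => 0, fun e he => absurd he (this e), fun e he => absurd he (this e),
      fun e he => absurd he (this e)⟩
  | succ d ih =>
    -- Hall's condition by counting: the `s.card * (d + 1)` edges that start in `s` all end in the
    -- neighbourhood `B`, where only `B.card * (d + 1)` edges end.
    obtain ⟨f, hf, hf'⟩ := (Finset.all_card_le_biUnion_card_iff_exists_injective
      (fun i => (S.filter fun e => a e = i).image b)).1 (by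
        intro s
        set B := s.biUnion fun i => (S.filter fun e => a e = i).image b
        have h1 : (S.filter fun e => a e ∈ s).card = s.card * (d + 1) :=
          card_filter_mem_eq S a s (d + 1) ha
        have h2 : (S.filter fun e => b e ∈ B).card = B.card * (d + 1) :=
          card_filter_mem_eq S b B (d + 1) hb
        have h3 : (S.filter fun e => a e ∈ s).card ≤ (S.filter fun e => b e ∈ B).card := by
          refine Finset.card_le_card fun e he => ?_
          rw [Finset.mem_filter] at he ⊢
          refine ⟨he.1, Finset.mem_biUnion.2 ⟨a e, he.2, Finset.mem_image.2 ⟨e, ?_, rfl⟩⟩⟩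
          exact Finset.mem_filter.2 ⟨he.1, rfl⟩
        rw [h1, h2] at h3
        exact Nat.le_of_mul_le_mul_right h3 (Nat.succ_pos d))
    have hbij := Finite.injective_iff_bijective.1 hf
    have : ∀ i, ∃ e ∈ S, a e = i ∧ b e = f i := by
      intro i
      obtain ⟨e, he, h⟩ := Finset.mem_image.1 (hf' i)
      rw [Finset.mem_filter] at he
      exact ⟨e, he.1, he.2, h⟩
    -- The edges of a perfect matching. Removing them lowers all degrees by one, and they receive
    -- the new colour `d`.
    choose g hgS hga hgb using this
    obtain ⟨col, h1, h2, h3⟩ := ih (S.filter fun e => g (a e) ≠ e) (by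
        intro i
        have : ((S.filter fun e => g (a e) ≠ e).filter fun e => a e = i) =
            (S.filter fun e => a e = i).erase (g i) := by
          ext e
          simp only [Finset.mem_filter, Finset.mem_erase]
          constructor
          · rintro ⟨⟨h1, h2⟩, rfl⟩
            exact ⟨h2.symm, h1, rfl⟩
          · rintro ⟨h2, h1, rfl⟩
            exact ⟨⟨h1, h2.symm⟩, rfl⟩
        rw [this, Finset.card_erase_of_mem (by simp [hgS, hga]), ha]
        rfl) (by
        intro i
        obtain ⟨j, rfl⟩ := hbij.2 i
        have : ((S.filter fun e => g (a e) ≠ e).filter fun e => b e = f j) =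
            (S.filter fun e => b e = f j).erase (g j) := by
          ext e
          simp only [Finset.mem_filter, Finset.mem_erase]
          constructor
          · rintro ⟨⟨h1, h2⟩, h3⟩
            exact ⟨fun h => h2 (by rw [h, hga]), h1, h3⟩
          · rintro ⟨h2, h1, h3⟩
            refine ⟨⟨h1, fun h => h2 ?_⟩, h3⟩
            have := hgb (a e)
            rw [h, h3] at this
            rw [hf this, h]
        rw [this, Finset.card_erase_of_mem (by simp [hgS, hgb]), hb]
        rfl)
    refine ⟨fun e => if g (a e) = e then d else col e, ?_, ?_, ?_⟩
    · intro e he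
      by_cases hg : g (a e) = e
      · simp [hg]
      · have := h1 e (Finset.mem_filter.2 ⟨he, hg⟩)
        simp only [hg, if_false]
        omega
    · intro e he e' he' hab
      by_cases hg : g (a e) = e <;> by_cases hg' : g (a e') = e' <;> simp only [hg, hg', if_true,
        if_false]
      · intro _
        rw [← hg, ← hg', hab]
      · intro h
        have := h1 e' (Finset.mem_filter.2 ⟨he', hg'⟩)
        omega
      · intro h
        have := h1 e (Finset.mem_filter.2 ⟨he, hg⟩)
        omega
      · exact h2 e (Finset.mem_filter.2 ⟨he, hg⟩) e' (Finset.mem_filter.2 ⟨he', hg'⟩) hab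
    · intro e he e' he' hab
      by_cases hg : g (a e) = e <;> by_cases hg' : g (a e') = e' <;> simp only [hg, hg', if_true,
        if_false]
      · intro _
        have e1 := hgb (a e)
        have e2 := hgb (a e')
        rw [hg] at e1
        rw [hg'] at e2
        rw [← hg, ← hg', hf (e1.symm.trans (hab.trans e2))]
      · intro h
        have := h1 e' (Finset.mem_filter.2 ⟨he', hg'⟩)
        omega
      · intro h
        have := h1 e (Finset.mem_filter.2 ⟨he, hg⟩)
        omega
      · exact h3 e (Finset.mem_filter.2 ⟨he, hg⟩) e' (Finset.mem_filter.2 ⟨he', hg'⟩) hab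

/-- Every permutation of the grid is a product of three permutations that preserve the columns,
the rows and the columns, respectively. -/
theorem exists_col_row_col {n : ℕ} (π : Equiv.Perm (Fin n × Fin n)) :
    ∃ p q r : Equiv.Perm (Fin n × Fin n), π = r * q * p ∧ (∀ v, (p v).2 = v.2) ∧
      (∀ v, (q v).1 = v.1) ∧ ∀ v, (r v).2 = v.2 := by
  have hcard : ∀ i : Fin n, (Finset.univ.filter fun e : Fin n × Fin n => e.2 = i).card = n := by
    intro i
    have : (Finset.univ.filter fun e : Fin n × Fin n => e.2 = i) =
        Finset.univ ×ˢ {i} := by ext e; simp only [Finset.mem_filter, Finset.mem_product,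
          Finset.mem_univ, true_and, Finset.mem_singleton]
    rw [this]
    simp
  -- Each cell is an edge from its own column to the column of its image. The colour serves as an
  -- intermediate row: cells that share a source or a target column get different rows.
  obtain ⟨col, h1, h2, h3⟩ := exists_edgeColoring n (fun e : Fin n × Fin n => e.2)
    (fun e => (π e).2) Finset.univ hcard (by
      intro i
      refine Eq.trans ?_ (hcard i)
      refine Finset.card_bij (fun e _ => π e) ?_ ?_ ?_
      · intro e he
        simpa using he
      · intro e _ e' _ h
        exact π.injective h
      · intro e he
        exact ⟨π.symm e, by simpa using he, by simp⟩)
  -- Cell `e` waits in row `col e`, in its old column after the first phase and in its new column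
  -- after the second.
  let m (x : Fin n × Fin n → Fin n) : Fin n × Fin n → Fin n × Fin n :=
    fun e => (⟨col e, h1 e (Finset.mem_univ e)⟩, x e)
  have hm1 : Function.Injective (m fun e => e.2) := by
    intro e e' h
    simp only [m, Prod.mk.injEq, Fin.mk.injEq] at h
    exact h2 e (Finset.mem_univ _) e' (Finset.mem_univ _) h.2 h.1
  have hm2 : Function.Injective (m fun e => (π e).2) := by
    intro e e' h
    simp only [m, Prod.mk.injEq, Fin.mk.injEq] at h
    exact h3 e (Finset.mem_univ _) e' (Finset.mem_univ _) h.2 h.1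
  let p : Equiv.Perm (Fin n × Fin n) :=
    Equiv.ofBijective _ (Finite.injective_iff_bijective.1 hm1)
  let q : Equiv.Perm (Fin n × Fin n) :=
    Equiv.ofBijective _ (Finite.injective_iff_bijective.1 hm2)
  refine ⟨p, q * p⁻¹, π * q⁻¹, by group, fun v => rfl, fun v => ?_, fun v => ?_⟩
  · obtain ⟨w, rfl⟩ := p.surjective v
    rw [Equiv.Perm.mul_apply, Equiv.Perm.inv_def, Equiv.symm_apply_apply]
    rfl
  · obtain ⟨w, rfl⟩ := q.surjective v
    rw [Equiv.Perm.mul_apply, Equiv.Perm.inv_def, Equiv.symm_apply_apply]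
    rfl

theorem swapDepth_gridGraph {n : ℕ} (π : Equiv.Perm (Fin n × Fin n)) :
    SwapDepth (gridGraph n) (6 * n) π := by
  obtain ⟨p, q, r, rfl, hp, hq, hr⟩ := exists_col_row_col π
  have h1 := (swapDepth_colGraph p hp).mono_graph (colGraph_le n)
  have h2 := (swapDepth_rowGraph q hq).mono_graph (rowGraph_le n)
  have h3 := (swapDepth_colGraph r hr).mono_graph (colGraph_le n)
  have := (h1.mul h2).mul h3
  rw [show 2 * n + 2 * n + 2 * n = 6 * n by ring, ← mul_assoc] at this
  exact this

end GridRouting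

/-! ### The signs of fermionic permutations -/

section CrossPhase

variable {V : Type} [Fintype V] [DecidableEq V] {G H : SimpleGraph V}

theorem bit_add_self (a : Fin 2) : a + a = 0 := by revert a; decide

/-- The number modulo two of the pairs of occupied vertices whose orders with respect to the keys
`k` and `k'` differ. -/
def crossPhase (k k' : V → ℕ) (t : Bits V) : Fin 2 :=
  ∑ p : V × V, if k p.1 < k p.2 ∧ k' p.2 < k' p.1 then t p.1 * t p.2 else 0

/-- Among three linear orders, the number of pairs of orders that disagree on given `u` and `v` is 0
or 2. Hence the terms of `(u, v)` and `(v, u)` in the three phases cancel. -/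
theorem crossPhase_triangle {k k' k'' : V → ℕ} (hk : Function.Injective k)
    (hk' : Function.Injective k') (hk'' : Function.Injective k'') (t : Bits V) :
    crossPhase k k'' t = crossPhase k k' t + crossPhase k' k'' t := by
  have h : crossPhase k k'' t + (crossPhase k k' t + crossPhase k' k'' t) = 0 := by
    unfold crossPhase
    rw [← Finset.sum_add_distrib, ← Finset.sum_add_distrib]
    refine Finset.sum_involution (fun p _ => p.swap) ?_ ?_ (fun _ _ => Finset.mem_univ _)
      fun p _ => p.swap_swap
    · rintro ⟨u, v⟩ -
      simp only [Prod.fst_swap, Prod.snd_swap]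
      by_cases huv : u = v
      · subst huv; simp
      have h1 := hk.ne huv
      have h2 := hk'.ne huv
      have h3 := hk''.ne huv
      rw [mul_comm (t v)]
      generalize t u * t v = x
      rcases h1.lt_or_gt with h1 | h1 <;> rcases h2.lt_or_gt with h2 | h2 <;>
        rcases h3.lt_or_gt with h3 | h3 <;>
        simp [h1, h2, h3, h1.le.not_gt, h2.le.not_gt, h3.le.not_gt, bit_add_self]
    -- The fixed points of the involution are diagonal pairs, whose terms vanish.
    · rintro ⟨u, v⟩ - hne heq
      simp only [Prod.swap_prod_mk, Prod.mk.injEq] at heq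
      obtain rfl := heq.1
      simp at hne
  have h' : ∀ a b : Fin 2, a + b = 0 → a = b := by decide
  exact h' _ _ h

theorem crossPhase_self (k : V → ℕ) (t : Bits V) : crossPhase k k t = 0 := by
  refine Finset.sum_eq_zero fun p _ => if_neg ?_
  rintro ⟨h1, h2⟩
  exact h1.le.not_gt h2

theorem crossPhase_comm {k k' : V → ℕ} (hk : Function.Injective k)
    (hk' : Function.Injective k') (t : Bits V) : crossPhase k k' t = crossPhase k' k t := by
  have h := crossPhase_triangle hk hk' hk t
  rw [crossPhase_self] at h
  have h' : ∀ a b : Fin 2, 0 = a + b → a = b := by decide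
  exact h' _ _ h

theorem crossPhase_comp (k k' : V → ℕ) (π : Equiv.Perm V) (t : Bits V) :
    crossPhase k k' (t ∘ π.symm) = crossPhase (k ∘ π) (k' ∘ π) t := by
  unfold crossPhase
  rw [← (Equiv.prodCongr π π).sum_comp]
  simp

/-- The fermionic permutation of `π` for modes ordered by the key `k`. -/
def fermPerm (k : V → ℕ) (π : Equiv.Perm V) : Operator V :=
  mono (fun t => t ∘ π.symm) (crossPhase k (k ∘ π))

/-- The cocycle identity with `k ∘ σ` as the middle order. -/
theorem fermPerm_mul {k : V → ℕ} (hk : Function.Injective k) (π σ : Equiv.Perm V) :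
    fermPerm k (π * σ) = fermPerm k π * fermPerm k σ := by
  unfold fermPerm
  rw [mono_mul]
  refine mono_congr (fun t => rfl) fun t => ?_
  rw [crossPhase_comp, crossPhase_triangle hk (hk.comp σ.injective)
    (hk.comp (π * σ).injective)]
  rfl

theorem fermPerm_one (k : V → ℕ) : fermPerm k (1 : Equiv.Perm V) = 1 := by
  rw [← mono_one]
  exact mono_congr (fun t => rfl) fun t => crossPhase_self k t

/-- A change of the order of the modes. -/
theorem fermPerm_conj {k k' : V → ℕ} (hk : Function.Injective k) (hk' : Function.Injective k')
    (π : Equiv.Perm V) :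
    mono id (crossPhase k k') * (fermPerm k' π * mono id (crossPhase k k')) = fermPerm k π := by
  unfold fermPerm
  rw [mono_mul, mono_mul]
  refine mono_congr (fun t => rfl) fun t => ?_
  -- The orders are traversed along `k`, `k'`, `k' ∘ π`, `k ∘ π`. The last leg is the diagonal sign
  -- evaluated after the permutation.
  have h1 := crossPhase_triangle hk hk' (hk.comp π.injective) t
  have h2 := crossPhase_triangle hk' (hk'.comp π.injective) (hk.comp π.injective) t
  have h3 := crossPhase_comp k k' π t
  have h4 := crossPhase_comm (hk.comp π.injective) (hk'.comp π.injective) t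
  simp only [Function.comp_id, id]
  rw [h1, h2, h3, h4]
  ring

/-- A layer of swaps between consecutive keys changes each key by at most one, so only exchanged
pairs can be inverted. -/
theorem IsSwapLayer.crossPhase_eq {τ : Equiv.Perm V} {k : V → ℕ} (hτ : IsSwapLayer H τ)
    (hk : Function.Injective k) (hH : ∀ u v, H.Adj u v → k u + 1 = k v ∨ k v + 1 = k u)
    (t : Bits V) :
    crossPhase k (k ∘ τ) t = ∑ v ∈ lowerEnds k τ, t (τ v) * t v := by
  unfold crossPhase lowerEnds
  rw [Fintype.sum_prod_type, Finset.sum_filter]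
  refine Finset.sum_congr rfl fun u _ => ?_
  rw [Finset.sum_eq_single (τ u)]
  · simp only [Function.comp_apply, hτ.invol, and_self]
    rw [mul_comm]
  · intro v _ hv
    refine if_neg ?_
    simp only [Function.comp_apply]
    rintro ⟨h1, h2⟩
    have step : ∀ w, k (τ w) = k w ∨ k w + 1 = k (τ w) ∨ k (τ w) + 1 = k w := by
      intro w
      by_cases hw : τ w = w
      · exact Or.inl (by rw [hw])
      · exact Or.inr (hH _ _ (hτ.adj w hw))
    have hu := step u
    have hv' := step v
    exact hv (hk (by omega))
  · intro h
    exact absurd (Finset.mem_univ _) h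

/-- A fermionic swap of consecutive modes is a CZ, for the sign when both are occupied, and a swap:
depth 1 + 3. -/
theorem IsSwapLayer.feasible_fermPerm {τ : Equiv.Perm V} {k : V → ℕ} (hτ : IsSwapLayer H τ)
    (hHG : H ≤ G) (hk : Function.Injective k)
    (hH : ∀ u v, H.Adj u v → k u + 1 = k v ∨ k v + 1 = k u) :
    Feasible G False 4 (fermPerm k τ) := by
  have h1 := ((hτ.mono_graph hHG).isMatchingOn_lowerEnds k).feasible_cz
  have h2 := h1.mul ((hτ.mono_graph hHG).feasible False)
  rw [qubitPermOp_eq_mono, mono_mul] at h2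
  convert h2 using 1
  exact mono_congr (fun t => rfl) fun t => by simp [hτ.crossPhase_eq hk hH]

theorem SwapDepth.feasible_fermPerm {d : ℕ} {σ : Equiv.Perm V} {k : V → ℕ}
    (hσ : SwapDepth H d σ) (hHG : H ≤ G) (hk : Function.Injective k)
    (hH : ∀ u v, H.Adj u v → k u + 1 = k v ∨ k v + 1 = k u) :
    Feasible G False (4 * d) (fermPerm k σ) := by
  induction hσ with
  | one => rw [fermPerm_one]; exact .one
  | step hσ hτ ih => rw [fermPerm_mul hk]; exact ih.mul (hτ.feasible_fermPerm hHG hk hH)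

/-- Running sums along chains of edges. -/
theorem exists_feasible_chain (prev : V → V) (rank : V → ℕ) (S : Finset V) (n : ℕ)
    (hadj : ∀ v ∈ S, G.Adj (prev v) v) (hrank : ∀ v ∈ S, rank (prev v) + 1 = rank v)
    (hn : ∀ v, rank v < n) (hinj : Set.InjOn prev S) :
    ∃ f : Bits V → Bits V, Feasible G True n (mono f 0) ∧
      ∀ t v, f t v = t v + if v ∈ S then f t (prev v) else 0 := by
  -- After `j` layers the sums are final at all ranks below `j`; the next layer completes rank `j`
  -- from rank `j - 1`.
  have key : ∀ j, ∃ f : Bits V → Bits V, Feasible G True j (mono f 0) ∧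
      ∀ t v, f t v = if rank v < j then t v + (if v ∈ S then f t (prev v) else 0) else t v := by
    intro j
    induction j with
    | zero => exact ⟨id, by rw [mono_one]; exact .one, fun t v => by simp⟩
    | succ j ih =>
      obtain ⟨f, hf, hspec⟩ := ih
      have hm : IsMatchingOn G (S.filter fun v => rank v = j) prev :=
        ⟨fun v hv => hadj v (Finset.mem_filter.1 hv).1, fun v hv hv' => by
          rw [Finset.mem_filter] at hv hv'
          have := hrank v hv.1
          omega, hinj.mono fun v hv => (Finset.mem_filter.1 hv).1⟩
      refine ⟨addSrc (S.filter fun v => rank v = j) prev ∘ f, ?_, fun t v => ?_⟩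
      · have := hf.mul (hm.feasible_cnot (cn := True))
        rw [mono_mul] at this
        convert this using 1
        exact mono_congr (fun t => rfl) fun t => by simp
      · have hlow : ∀ w, rank w ≠ j →
            addSrc (S.filter fun v => rank v = j) prev (f t) w = f t w := by
          intro w hw
          simp [addSrc, hw]
        simp only [Function.comp_apply]
        rcases lt_trichotomy (rank v) j with h | h | h
        · have h' : rank v < j + 1 := by omega
          have hs := hspec t v
          rw [if_pos h] at hs
          rw [hlow v h.ne, if_pos h', hs]
          by_cases hv : v ∈ S
          · have := hrank v hv
            rw [if_pos hv, if_pos hv, hlow (prev v) (by omega)]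
          · rw [if_neg hv, if_neg hv]
        · have h' : rank v < j + 1 := by omega
          have hs := hspec t v
          rw [if_neg (by omega)] at hs
          rw [if_pos h']
          by_cases hv : v ∈ S
          · have := hrank v hv
            rw [if_pos hv, hlow (prev v) (by omega), addSrc,
              if_pos (Finset.mem_filter.2 ⟨hv, h⟩), hs]
          · rw [if_neg hv, addSrc, if_neg fun hv' => hv (Finset.mem_filter.1 hv').1, hs, add_zero]
        · have hs := hspec t v
          rw [if_neg (by omega)] at hs
          rw [hlow v h.ne', hs, if_neg (by omega)]
  obtain ⟨f, hf, hspec⟩ := key n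
  exact ⟨f, hf, fun t v => by rw [hspec, if_pos (hn v)]⟩

/-- The product of controlled `Z` gates along all edges of chains. -/
theorem feasible_cz_chain (prev : V → V) (rank : V → ℕ) (S : Finset V)
    (hadj : ∀ v ∈ S, G.Adj (prev v) v) (hrank : ∀ v ∈ S, rank (prev v) + 1 = rank v)
    (hinj : Set.InjOn prev S) :
    Feasible G False 2 (mono id fun t => ∑ v ∈ S, t (prev v) * t v) := by
  -- Consecutive edges of a chain share a vertex, so the edges are split into two matchings by the
  -- parity of the rank.
  have hm : ∀ p : Prop, [Decidable p] → IsMatchingOn G (S.filter fun v => Even (rank v) ↔ p) prev :=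
    fun p _ => ⟨fun v hv => hadj v (Finset.mem_filter.1 hv).1, fun v hv hv' => by
      rw [Finset.mem_filter] at hv hv'
      have h1 := hv.2
      have h2 := hv'.2
      rw [← hrank v hv.1, Nat.even_add_one] at h1
      tauto, hinj.mono fun v hv => (Finset.mem_filter.1 hv).1⟩
  have h := (hm True).feasible_cz.add_phase (hm False).feasible_cz
  convert h using 1
  refine mono_congr (fun t => rfl) fun t => ?_
  simp only [iff_true, iff_false]
  exact (Finset.sum_filter_add_sum_filter_not S _ _).symm

end CrossPhase

/-! ### Row and column sums -/

section GridSums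

variable {L : ℕ}

/-- The predecessor, with `0` sent to itself. -/
def predFin (c : Fin L) : Fin L := ⟨c - 1, by omega⟩

theorem predFin_injOn : Set.InjOn (predFin (L := L)) {c | 0 < (c : ℕ)} := by
  intro c hc c' hc' h
  simp only [predFin, Fin.mk.injEq, Set.mem_ofPred_eq] at *
  exact Fin.ext (by omega)

theorem sum_Iio_eq (x : Fin L → Fin 2) (c : Fin L) :
    ∑ i ∈ Finset.Iio c, x i = if 0 < (c : ℕ) then ∑ i ∈ Finset.Iic (predFin c), x i else 0 := by
  split_ifs with h
  · congr 1
    ext i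
    simp only [Finset.mem_Iio, Finset.mem_Iic, predFin, Fin.lt_def, Fin.le_def]
    omega
  · refine Finset.sum_eq_zero fun i hi => ?_
    simp only [Finset.mem_Iio, Fin.lt_def] at hi
    omega

theorem sum_Iic_eq (x : Fin L → Fin 2) (c : Fin L) :
    ∑ i ∈ Finset.Iic c, x i = x c + ∑ i ∈ Finset.Iio c, x i := by
  rw [← Finset.Iio_insert, Finset.sum_insert (by simp)]

theorem eq_sum_Iic_of_rec (x y : Fin L → Fin 2)
    (h : ∀ c, y c = x c + if 0 < (c : ℕ) then y (predFin c) else 0) (c : Fin L) :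
    y c = ∑ i ∈ Finset.Iic c, x i := by
  obtain ⟨n, hn⟩ := c
  induction n with
  | zero => rw [h, sum_Iic_eq, sum_Iio_eq]; simp
  | succ n ih =>
    rw [h, sum_Iic_eq, sum_Iio_eq, if_pos (Nat.succ_pos n), if_pos (Nat.succ_pos n)]
    congr 1
    exact ih _

theorem pathGraph_adj_predFin {c : Fin L} (h : 0 < (c : ℕ)) :
    (SimpleGraph.pathGraph L).Adj (predFin c) c := by
  rw [SimpleGraph.pathGraph_adj]
  left
  simp only [predFin]
  omega

/-- The cells with a left neighbour in the rows of `B`. -/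
def rowTail (B : Finset (Fin L)) : Finset (Fin L × Fin L) :=
  Finset.univ.filter fun v => v.1 ∈ B ∧ 0 < (v.2 : ℕ)

/-- The cells with an upper neighbour. -/
def colTail (L : ℕ) : Finset (Fin L × Fin L) := Finset.univ.filter fun v => 0 < (v.1 : ℕ)

/-- The left neighbour. -/
def leftCell (v : Fin L × Fin L) : Fin L × Fin L := (v.1, predFin v.2)

/-- The upper neighbour. -/
def upCell (v : Fin L × Fin L) : Fin L × Fin L := (predFin v.1, v.2)

theorem leftCell_adj (B : Finset (Fin L)) : ∀ v ∈ rowTail B, (gridGraph L).Adj (leftCell v) v := by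
  intro v hv
  simp only [rowTail, Finset.mem_filter, Finset.mem_univ, true_and] at hv
  exact rowGraph_le L ⟨rfl, pathGraph_adj_predFin hv.2⟩

theorem leftCell_rank (B : Finset (Fin L)) :
    ∀ v ∈ rowTail B, ((leftCell v).2 : ℕ) + 1 = (v.2 : ℕ) := by
  intro v hv
  simp only [rowTail, Finset.mem_filter, Finset.mem_univ, true_and] at hv
  simp only [leftCell, predFin]
  omega

theorem leftCell_injOn (B : Finset (Fin L)) : Set.InjOn leftCell (rowTail B : Set (Fin L × Fin L)) := by
  intro v hv w hw h
  simp only [rowTail, Finset.coe_filter, Finset.mem_univ, true_and, Set.mem_ofPred_eq] at hv hw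
  simp only [leftCell, Prod.mk.injEq] at h
  exact Prod.ext h.1 (predFin_injOn hv.2 hw.2 h.2)

theorem upCell_adj : ∀ v ∈ colTail L, (gridGraph L).Adj (upCell v) v := by
  intro v hv
  simp only [colTail, Finset.mem_filter, Finset.mem_univ, true_and] at hv
  exact colGraph_le L ⟨rfl, pathGraph_adj_predFin hv⟩

theorem upCell_rank : ∀ v ∈ colTail L, ((upCell v).1 : ℕ) + 1 = (v.1 : ℕ) := by
  intro v hv
  simp only [colTail, Finset.mem_filter, Finset.mem_univ, true_and] at hv
  simp only [upCell, predFin]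
  omega

theorem upCell_injOn : Set.InjOn upCell (colTail L : Set (Fin L × Fin L)) := by
  intro v hv w hw h
  simp only [colTail, Finset.coe_filter, Finset.mem_univ, true_and, Set.mem_ofPred_eq] at hv hw
  simp only [upCell, Prod.mk.injEq] at h
  exact Prod.ext (predFin_injOn hv hw h.1) h.2

/-- Running sums from the left in the rows of `B`. -/
def rowSums (B : Finset (Fin L)) (t : Bits (Fin L × Fin L)) : Bits (Fin L × Fin L) :=
  fun v => if v.1 ∈ B then ∑ c ∈ Finset.Iic v.2, t (v.1, c) else t v

/-- Running sums from the top in all columns. -/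
def colSums (t : Bits (Fin L × Fin L)) : Bits (Fin L × Fin L) :=
  fun v => ∑ r ∈ Finset.Iic v.1, t (r, v.2)

theorem feasible_rowSums (B : Finset (Fin L)) :
    Feasible (gridGraph L) True L (mono (rowSums B) 0) := by
  obtain ⟨f, hf, h⟩ := exists_feasible_chain leftCell (fun v => (v.2 : ℕ)) (rowTail B) L
    (leftCell_adj B) (leftCell_rank B) (fun v => v.2.2) (leftCell_injOn B)
  convert hf using 1
  refine mono_congr (fun t => ?_) fun t => rfl
  funext ⟨r, c⟩
  by_cases hr : r ∈ B
  · simp only [rowSums, hr, if_true]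
    refine (eq_sum_Iic_of_rec (fun c => t (r, c)) (fun c => f t (r, c)) (fun c => ?_) c).symm
    simp only [h t (r, c), rowTail, Finset.mem_filter, Finset.mem_univ, true_and, hr, leftCell]
  · simp [rowSums, hr, h t (r, c), rowTail]

theorem feasible_colSums : Feasible (gridGraph L) True L (mono colSums 0) := by
  obtain ⟨f, hf, h⟩ := exists_feasible_chain upCell (fun v => (v.1 : ℕ)) (colTail L) L
    upCell_adj upCell_rank (fun v => v.1.2) upCell_injOn
  convert hf using 1
  refine mono_congr (fun t => ?_) fun t => rfl
  funext ⟨r, c⟩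
  simp only [colSums]
  refine (eq_sum_Iic_of_rec (fun r => t (r, c)) (fun r => f t (r, c)) (fun r => ?_) r).symm
  simp only [h t (r, c), colTail, Finset.mem_filter, Finset.mem_univ, true_and, upCell]

/-- The number modulo two of the pairs of occupied cells within the rows of `B`. -/
def rowPairs (B : Finset (Fin L)) (t : Bits (Fin L × Fin L)) : Fin 2 :=
  ∑ r ∈ B, ∑ c, t (r, c) * ∑ c' ∈ Finset.Iio c, t (r, c')

/-- With the running sums P of a row, t_c = P_c + P_(c-1) over F_2, hence t_c P_(c-1) = P_c P_(c-1)
+ P_(c-1): a CZ between neighbours and a Z on the left one. -/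
theorem rowPairs_eq (B : Finset (Fin L)) (t : Bits (Fin L × Fin L)) :
    rowPairs B t = ∑ v ∈ rowTail B, rowSums B t (leftCell v) * rowSums B t v +
      ∑ v ∈ (rowTail B).image leftCell, rowSums B t v := by
  rw [Finset.sum_image (leftCell_injOn B), ← Finset.sum_add_distrib, rowPairs]
  have hset : rowTail B = B ×ˢ Finset.univ.filter fun c : Fin L => 0 < (c : ℕ) := by
    ext ⟨r, c⟩
    simp [rowTail]
  rw [hset, Finset.sum_product]
  refine Finset.sum_congr rfl fun r hr => ?_
  rw [Finset.sum_filter]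
  refine Finset.sum_congr rfl fun c _ => ?_
  rw [sum_Iio_eq]
  split_ifs with hc
  · simp only [rowSums, leftCell, hr, if_true]
    rw [sum_Iic_eq _ c, sum_Iio_eq, if_pos hc]
    generalize ∑ i ∈ Finset.Iic (predFin c), t (r, i) = y
    have : ∀ a b : Fin 2, a * b = b * (a + b) + b := by decide
    exact this _ _
  · rw [mul_zero]

theorem feasible_rowPairs (B : Finset (Fin L)) :
    Feasible (gridGraph L) False (2 * L + 3) (mono id (rowPairs B)) := by
  have h1 := feasible_cz_chain leftCell (fun v => (v.2 : ℕ)) (rowTail B)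
    (leftCell_adj B) (leftCell_rank B) (leftCell_injOn B)
  have h2 := h1.add_phase (feasible_z ((rowTail B).image leftCell))
  have h3 := ((feasible_rowSums B).conj_phase h2).mono_depth (e := 2 * L + 3) (by omega)
  convert h3 using 1
  exact mono_congr (fun t => rfl) fun t => rowPairs_eq B t

/-- The number modulo two of the pairs of occupied cells of which the first one is above and to
the left of the second one. -/
def diagPairs (t : Bits (Fin L × Fin L)) : Fin 2 :=
  ∑ r, ∑ c, t (r, c) * ∑ r' ∈ Finset.Iio r, ∑ c' ∈ Finset.Iio c, t (r', c')

/-- The rows with even index if `b` is true, and with odd index otherwise. -/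
def parityRows (L : ℕ) (b : Bool) : Finset (Fin L) :=
  Finset.univ.filter fun r => Even (r : ℕ) ↔ b = true

/-- The cells with an upper neighbour in the rows of `parityRows L b`. -/
def parityTail (L : ℕ) (b : Bool) : Finset (Fin L × Fin L) :=
  (colTail L).filter fun v => predFin v.1 ∈ parityRows L b

theorem parityTail_isMatchingOn (b : Bool) :
    IsMatchingOn (gridGraph L) (parityTail L b) upCell where
  adj v hv := upCell_adj v (Finset.mem_filter.1 hv).1
  src_notMem v hv hv' := by
    have h1 := upCell_rank v (Finset.mem_filter.1 hv).1
    have h2 := upCell_rank _ (Finset.mem_filter.1 hv').1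
    have h3 := (Finset.mem_filter.1 (Finset.mem_filter.1 hv).2).2
    have h4 := (Finset.mem_filter.1 (Finset.mem_filter.1 hv').2).2
    have h3' : Even ((upCell v).1 : ℕ) ↔ b = true := h3
    have h4' : Even ((upCell (upCell v)).1 : ℕ) ↔ b = true := h4
    rw [← h2, Nat.even_add_one] at h3'
    tauto
  injOn := upCell_injOn.mono fun _ hv => (Finset.mem_filter.1 hv).1

/-- Let U be the running sums of the columns and P the running sum of row r-1 of U up to column c.
Then t(r,c) = U(r,c) + U(r-1,c), and the cells above and to the left of (r,c) sum to P + U(r-1,c).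
The product is P U(r,c) + U(r-1,c) U(r,c) + U(r-1,c) (P + U(r-1,c)), the last part counting pairs
within row r-1 of U. The first part needs row r-1 summed while row r is not, hence the separate
treatment of the two parities of rows. -/
theorem diagPairs_eq (t : Bits (Fin L × Fin L)) :
    diagPairs t =
      ((∑ v ∈ parityTail L true, rowSums (parityRows L true) (colSums t) (upCell v) *
          rowSums (parityRows L true) (colSums t) v) +
        ∑ v ∈ parityTail L false, rowSums (parityRows L false) (colSums t) (upCell v) *
          rowSums (parityRows L false) (colSums t) v) +
      ((∑ v ∈ colTail L, colSums t (upCell v) * colSums t v) +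
        rowPairs ((Finset.univ.filter fun r : Fin L => 0 < (r : ℕ)).image predFin)
          (colSums t)) := by
  set U := colSums t with hU
  -- The upper cell lies in a summed row, the lower one in an unsummed row.
  have hpar : ∀ (b : Bool), ∀ v ∈ parityTail L b,
      rowSums (parityRows L b) U (upCell v) * rowSums (parityRows L b) U v =
        (∑ c ∈ Finset.Iic v.2, U (predFin v.1, c)) * U v := by
    intro b v hv
    have h1 := upCell_rank v (Finset.mem_filter.1 hv).1
    have h2 := (Finset.mem_filter.1 hv).2
    have h3 : v.1 ∉ parityRows L b := by
      intro h
      have h3' : Even ((upCell v).1 : ℕ) ↔ b = true := (Finset.mem_filter.1 h2).2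
      have h4' : Even (v.1 : ℕ) ↔ b = true := (Finset.mem_filter.1 h).2
      rw [← h1, Nat.even_add_one] at h4'
      tauto
    simp only [rowSums, upCell, h2, h3, if_true, if_false]
  rw [Finset.sum_congr rfl (hpar true), Finset.sum_congr rfl (hpar false)]
  have hsplit : ∀ F : Fin L × Fin L → Fin 2,
      ∑ v ∈ parityTail L true, F v + ∑ v ∈ parityTail L false, F v = ∑ v ∈ colTail L, F v := by
    intro F
    rw [← Finset.sum_filter_add_sum_filter_not (colTail L)
      (fun v => predFin v.1 ∈ parityRows L true)]
    congr 1
    refine Finset.sum_congr (Finset.filter_congr fun v _ => ?_) fun _ _ => rfl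
    simp [parityRows]
  rw [hsplit, rowPairs, Finset.sum_image fun r hr r' hr' => predFin_injOn (by simpa using hr)
    (by simpa using hr')]
  have hset : colTail L = (Finset.univ.filter fun r : Fin L => 0 < (r : ℕ)) ×ˢ Finset.univ := by
    ext ⟨r, c⟩
    simp [colTail]
  rw [hset, Finset.sum_product, Finset.sum_product, ← Finset.sum_add_distrib,
    ← Finset.sum_add_distrib, Finset.sum_filter, diagPairs]
  refine Finset.sum_congr rfl fun r _ => ?_
  split_ifs with hr
  · rw [← Finset.sum_add_distrib, ← Finset.sum_add_distrib]
    refine Finset.sum_congr rfl fun c _ => ?_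
    have e1 : ∀ c, U (r, c) = t (r, c) + U (predFin r, c) := by
      intro c
      rw [hU]
      simp only [colSums]
      rw [sum_Iic_eq, sum_Iio_eq, if_pos hr]
    have e2 : ∑ r' ∈ Finset.Iio r, ∑ c' ∈ Finset.Iio c, t (r', c') =
        ∑ c' ∈ Finset.Iio c, U (predFin r, c') := by
      rw [Finset.sum_comm]
      refine Finset.sum_congr rfl fun c' _ => ?_
      rw [sum_Iio_eq, if_pos hr]
      rfl
    rw [e2]
    simp only [upCell]
    rw [sum_Iic_eq, e1 c]
    generalize ∑ i ∈ Finset.Iio c, U (predFin r, i) = y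
    generalize U (predFin r, c) = z
    generalize t (r, c) = x
    revert x y z
    decide
  · refine Finset.sum_eq_zero fun c _ => ?_
    rw [sum_Iio_eq, if_neg hr, mul_zero]

/-- Two vertical terms of depth 4L + 1, one of depth 2L + 2, and the row pairs of depth 4L + 3. -/
theorem feasible_diagPairs :
    Feasible (gridGraph L) False (14 * L + 7) (mono id (diagPairs (L := L))) := by
  have hU := feasible_colSums (L := L)
  have h1 := fun b => hU.conj_phase ((feasible_rowSums (parityRows L b)).conj_phase
    (parityTail_isMatchingOn b).feasible_cz)
  have h2 := hU.conj_phase (feasible_cz_chain upCell (fun v => (v.1 : ℕ)) (colTail L)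
    upCell_adj upCell_rank upCell_injOn)
  have h3 := hU.conj_phase (feasible_rowPairs
    ((Finset.univ.filter fun r : Fin L => 0 < (r : ℕ)).image predFin))
  have h4 := (((h1 true).add_phase (h1 false)).add_phase (h2.add_phase h3)).mono_depth
    (e := 14 * L + 7) (by omega)
  convert h4 using 1
  exact mono_congr (fun t => rfl) fun t => diagPairs_eq t

end GridSums

/-! ### Snake order and column order -/

section Snake

variable {L : ℕ}

theorem lex_lt_iff {a b x y : ℕ} (hx : x < L) (hy : y < L) :
    a * L + x < b * L + y ↔ a < b ∨ a = b ∧ x < y := by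
  constructor
  · intro h
    rcases lt_trichotomy a b with hab | hab | hab
    · exact Or.inl hab
    · subst hab; exact Or.inr ⟨rfl, by omega⟩
    · exfalso
      have : (b + 1) * L ≤ a * L := Nat.mul_le_mul_right L hab
      rw [add_mul] at this
      omega
  · rintro (hab | ⟨rfl, h⟩)
    · have : (a + 1) * L ≤ b * L := Nat.mul_le_mul_right L hab
      rw [add_mul] at this
      omega
    · omega

/-- The position of a cell in its row in the direction of the snake. -/
def snakeOffset (v : Fin L × Fin L) : ℕ := if Even (v.1 : ℕ) then v.2 else L - 1 - v.2

theorem snakeOffset_lt (v : Fin L × Fin L) : snakeOffset v < L := by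
  unfold snakeOffset
  have := v.2.2
  split_ifs <;> omega

theorem snakeIndex_eq (v : Fin L × Fin L) : snakeIndex v = v.1 * L + snakeOffset v := by
  unfold snakeIndex snakeOffset
  split_ifs <;> rfl

theorem snakeIndex_lt_iff (u v : Fin L × Fin L) :
    snakeIndex u < snakeIndex v ↔ (u.1 : ℕ) < v.1 ∨ (u.1 : ℕ) = v.1 ∧
      snakeOffset u < snakeOffset v := by
  rw [snakeIndex_eq, snakeIndex_eq, lex_lt_iff (snakeOffset_lt u) (snakeOffset_lt v)]

theorem snakeIndex_injective : Function.Injective (snakeIndex (L := L)) := by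
  intro u v h
  have h1 := snakeIndex_lt_iff u v
  have h2 := snakeIndex_lt_iff v u
  rw [h] at h1 h2
  have e1 : u.1 = v.1 := Fin.ext (by
    by_contra hne
    rcases Nat.lt_or_gt_of_ne hne with h | h
    · exact lt_irrefl _ (h1.2 (Or.inl h))
    · exact lt_irrefl _ (h2.2 (Or.inl h)))
  have e2 : snakeOffset u = snakeOffset v := by
    by_contra hne
    rcases Nat.lt_or_gt_of_ne hne with h | h
    · exact lt_irrefl _ (h1.2 (Or.inr ⟨by rw [e1], h⟩))
    · exact lt_irrefl _ (h2.2 (Or.inr ⟨by rw [e1], h⟩))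
  refine Prod.ext e1 (Fin.ext ?_)
  unfold snakeOffset at e2
  rw [e1] at e2
  have := u.2.2
  have := v.2.2
  split_ifs at e2 <;> omega

theorem snakeIndex_rowGraph {u v : Fin L × Fin L} (h : (rowGraph L).Adj u v) :
    snakeIndex u + 1 = snakeIndex v ∨ snakeIndex v + 1 = snakeIndex u := by
  obtain ⟨h1, h2⟩ := h
  rw [SimpleGraph.pathGraph_adj] at h2
  rw [snakeIndex_eq, snakeIndex_eq, ← h1]
  unfold snakeOffset
  rw [← h1]
  have := u.2.2
  have := v.2.2
  split_ifs <;> omega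

/-- The position of a cell in the order of the columns from right to left, each from top to
bottom. -/
def colIndex (v : Fin L × Fin L) : ℕ := (L - 1 - v.2) * L + v.1

theorem colIndex_lt_iff (u v : Fin L × Fin L) :
    colIndex u < colIndex v ↔ (v.2 : ℕ) < u.2 ∨ (u.2 : ℕ) = v.2 ∧ (u.1 : ℕ) < v.1 := by
  unfold colIndex
  rw [lex_lt_iff u.1.2 v.1.2]
  have := u.2.2
  have := v.2.2
  omega

theorem colIndex_injective : Function.Injective (colIndex (L := L)) := by
  intro u v h
  have h1 := colIndex_lt_iff u v
  have h2 := colIndex_lt_iff v u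
  rw [h] at h1 h2
  simp only [lt_self_iff_false, false_iff] at h1 h2
  refine Prod.ext (Fin.ext ?_) (Fin.ext ?_) <;> omega

theorem colIndex_colGraph {u v : Fin L × Fin L} (h : (colGraph L).Adj u v) :
    colIndex u + 1 = colIndex v ∨ colIndex v + 1 = colIndex u := by
  obtain ⟨h1, h2⟩ := h
  rw [SimpleGraph.pathGraph_adj] at h2
  unfold colIndex
  rw [← h1]
  omega

/-- Since the columns run from right to left, a pair in different rows is inverted precisely when
the upper cell is strictly to the left, which matches running sums from the top and the left. A pair
in one row is inverted only if the snake runs to the right there, that is, in even rows. -/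
theorem crossPhase_snake_col (t : Bits (Fin L × Fin L)) :
    crossPhase snakeIndex colIndex t = diagPairs t + rowPairs (parityRows L true) t := by
  have hcond : ∀ u v : Fin L × Fin L, (snakeIndex u < snakeIndex v ∧ colIndex v < colIndex u) ↔
      ((u.1 < v.1 ∧ u.2 < v.2) ∨ (v.1 ∈ parityRows L true ∧ u.1 = v.1 ∧ u.2 < v.2)) := by
    intro u v
    rw [snakeIndex_lt_iff, colIndex_lt_iff]
    simp only [parityRows, Finset.mem_filter, Finset.mem_univ, true_and, iff_true, Fin.lt_def,
      Fin.ext_iff]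
    have := u.2.2
    have := v.2.2
    unfold snakeOffset
    by_cases he : (u.1 : ℕ) = v.1
    · rw [he]
      by_cases hp : Even (v.1 : ℕ)
      · simp [hp]
      · simp [hp]
        omega
    · omega
  have hsum : ∀ u v : Fin L × Fin L,
      (if snakeIndex u < snakeIndex v ∧ colIndex v < colIndex u then t u * t v else 0) =
        (if u.1 < v.1 ∧ u.2 < v.2 then t u * t v else 0) +
          if v.1 ∈ parityRows L true ∧ u.1 = v.1 ∧ u.2 < v.2 then t u * t v else 0 := by
    intro u v
    simp only [hcond]
    by_cases h1 : u.1 < v.1 ∧ u.2 < v.2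
    · rw [if_pos (Or.inl h1), if_pos h1, if_neg, add_zero]
      rintro ⟨-, h2, -⟩
      exact h1.1.ne h2
    · simp only [h1, false_or, if_false, zero_add]
  unfold crossPhase
  rw [Fintype.sum_prod_type_right]
  simp only [hsum, Finset.sum_add_distrib]
  congr 1
  · unfold diagPairs
    rw [Fintype.sum_prod_type]
    refine Finset.sum_congr rfl fun r _ => Finset.sum_congr rfl fun c _ => ?_
    rw [Fintype.sum_prod_type, Finset.mul_sum, ← Finset.sum_filter_add_sum_filter_not
      Finset.univ (fun r' => r' < r), Finset.sum_eq_zero (s := Finset.univ.filter fun r' => ¬ r' < r),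
      add_zero]
    · refine Finset.sum_congr (by ext; simp) fun r' hr' => ?_
      have hr' : r' < r := by simpa using hr'
      simp only [hr', true_and]
      rw [Finset.mul_sum, ← Finset.sum_filter]
      refine Finset.sum_congr (by ext; simp) fun c' _ => mul_comm _ _
    · intro r' hr'
      have hr' : ¬ r' < r := by simpa using hr'
      simp [hr']
  · unfold rowPairs
    rw [Fintype.sum_prod_type, ← Finset.sum_filter_add_sum_filter_not
      Finset.univ (fun r => r ∈ parityRows L true), Finset.sum_eq_zero
      (s := Finset.univ.filter fun r => ¬ r ∈ parityRows L true), add_zero]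
    · refine Finset.sum_congr (by ext; simp) fun r hr => Finset.sum_congr rfl fun c _ => ?_
      have hr : r ∈ parityRows L true := by simpa using hr
      rw [Fintype.sum_prod_type, Finset.sum_eq_single r]
      · simp only [hr, true_and]
        rw [Finset.mul_sum, ← Finset.sum_filter]
        refine Finset.sum_congr (by ext; simp) fun c' _ => mul_comm _ _
      · intro r' _ hne
        simp [hne]
      · intro h
        exact absurd (Finset.mem_univ _) h
    · intro r hr
      have hr : r ∉ parityRows L true := by simpa using hr
      simp [hr]

theorem feasible_crossPhase_snake_col :
    Feasible (gridGraph L) False (16 * L + 10) (mono id (crossPhase (V := Fin L × Fin L) snakeIndex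
      colIndex)) := by
  have h := (feasible_diagPairs (L := L)).add_phase (feasible_rowPairs (parityRows L true))
  convert h.mono_depth (e := 16 * L + 10) (by omega) using 1
  exact mono_congr (fun t => rfl) fun t => crossPhase_snake_col t

/-- Row moves are made in the snake order, column moves in the column order between two changes of
sign: 2 (8L + 2 (16L + 10)) + 8L. -/
theorem feasible_fermPerm_snake (π : Equiv.Perm (Fin L × Fin L)) :
    Feasible (gridGraph L) False (88 * L + 40) (fermPerm snakeIndex π) := by
  obtain ⟨p, q, r, rfl, hp, hq, hr⟩ := exists_col_row_col π
  have hcol : ∀ p : Equiv.Perm (Fin L × Fin L), (∀ v, (p v).2 = v.2) →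
      Feasible (gridGraph L) False (40 * L + 20) (fermPerm snakeIndex p) := by
    intro p hp
    have h1 := (swapDepth_colGraph p hp).feasible_fermPerm (colGraph_le L) colIndex_injective
      fun u v => colIndex_colGraph
    have hΓ := feasible_crossPhase_snake_col (L := L)
    have h2 := (hΓ.mul h1).mul hΓ
    rw [fermPerm_conj snakeIndex_injective colIndex_injective] at h2
    exact h2.mono_depth (by omega)
  have h2 := (swapDepth_rowGraph q hq).feasible_fermPerm (rowGraph_le L) snakeIndex_injective
    fun u v => snakeIndex_rowGraph
  rw [fermPerm_mul snakeIndex_injective, fermPerm_mul snakeIndex_injective, mul_assoc]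
  exact (((hcol p hp).mul h2).mul (hcol r hr)).mono_depth (by omega)

end Snake

/-! ### Maps of labelled qubits -/

section Place

variable {V : Type} [Fintype V] [DecidableEq V] {G : SimpleGraph V} {N : ℕ}

/-- Apply `f` to the bits at the labelled vertices. -/
def placeAct (ℓ : Fin N ↪ V) (f : Bits (Fin N) → Bits (Fin N)) (t : Bits V) : Bits V :=
  Function.extend ℓ (f (t ∘ ℓ)) t

theorem placeAct_apply (ℓ : Fin N ↪ V) (f : Bits (Fin N) → Bits (Fin N)) (t : Bits V)
    (k : Fin N) : placeAct ℓ f t (ℓ k) = f (t ∘ ℓ) k := ℓ.injective.extend_apply _ _ _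

theorem placeAct_of_notMem (ℓ : Fin N ↪ V) (f : Bits (Fin N) → Bits (Fin N)) (t : Bits V)
    {v : V} (hv : v ∉ Set.range ℓ) : placeAct ℓ f t v = t v :=
  Function.extend_apply' _ _ _ fun ⟨k, hk⟩ => hv ⟨k, hk⟩

theorem placeAct_comp_place (ℓ : Fin N ↪ V) (f : Bits (Fin N) → Bits (Fin N)) (t : Bits V) :
    placeAct ℓ f t ∘ ℓ = f (t ∘ ℓ) := funext fun k => placeAct_apply ℓ f t k

theorem bits_ext_place (ℓ : Fin N ↪ V) {s t : Bits V} (h1 : ∀ k, s (ℓ k) = t (ℓ k))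
    (h2 : ∀ v, v ∉ Set.range ℓ → s v = t v) : s = t := by
  funext v
  by_cases hv : v ∈ Set.range ℓ
  · obtain ⟨k, rfl⟩ := hv
    exact h1 k
  · exact h2 v hv

theorem placeAct_comp (ℓ : Fin N ↪ V) (g f : Bits (Fin N) → Bits (Fin N)) (t : Bits V) :
    placeAct ℓ (g ∘ f) t = placeAct ℓ g (placeAct ℓ f t) := by
  refine bits_ext_place ℓ (fun k => ?_) fun v hv => ?_
  · rw [placeAct_apply, placeAct_apply, placeAct_comp_place]
    rfl
  · rw [placeAct_of_notMem _ _ _ hv, placeAct_of_notMem _ _ _ hv, placeAct_of_notMem _ _ _ hv]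

theorem placeAct_id (ℓ : Fin N ↪ V) (t : Bits V) : placeAct ℓ id t = t :=
  bits_ext_place ℓ (fun k => by rw [placeAct_apply]; rfl) fun v hv => placeAct_of_notMem _ _ _ hv

/-- The operator of a map of the bits at the labelled vertices. -/
def placeOp (ℓ : Fin N ↪ V) (f : Bits (Fin N) → Bits (Fin N)) : Operator V :=
  mono (placeAct ℓ f) 0

theorem placeOp_mul (ℓ : Fin N ↪ V) (g f : Bits (Fin N) → Bits (Fin N)) :
    placeOp ℓ (g ∘ f) = placeOp ℓ g * placeOp ℓ f := by
  unfold placeOp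
  rw [mono_mul]
  exact mono_congr (fun t => placeAct_comp ℓ g f t) fun t => by simp

theorem placeOp_id (ℓ : Fin N ↪ V) : placeOp ℓ id = 1 := by
  rw [← mono_one]
  exact mono_congr (fun t => placeAct_id ℓ t) fun t => rfl

theorem placeOp_congr {ℓ : Fin N ↪ V} {f g : Bits (Fin N) → Bits (Fin N)}
    (h : ∀ s, f s = g s) : placeOp ℓ f = placeOp ℓ g := by rw [funext h]

theorem placeOp_mul_qubitPermOp (ℓ : Fin N ↪ V) (σ : Equiv.Perm V)
    (f : Bits (Fin N) → Bits (Fin N)) :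
    placeOp (ℓ.trans σ.toEmbedding) f * qubitPermOp σ = qubitPermOp σ * placeOp ℓ f := by
  unfold placeOp
  rw [qubitPermOp_eq_mono, mono_mul, mono_mul]
  refine mono_congr (fun t => ?_) fun t => by simp
  refine bits_ext_place (ℓ.trans σ.toEmbedding) (fun k => ?_) fun v hv => ?_
  · simp only [Function.comp_apply]
    rw [placeAct_apply]
    simp only [Function.Embedding.trans_apply, Equiv.coe_toEmbedding, Equiv.symm_apply_apply]
    rw [placeAct_apply]
    congr 1
    funext j
    simp
  · simp only [Function.comp_apply]
    rw [placeAct_of_notMem _ _ _ hv, placeAct_of_notMem]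
    · rfl
    · rintro ⟨k, hk⟩
      exact hv ⟨k, by simp [hk]⟩

/-- Route the labelled qubits to other vertices, apply a map and route back. -/
theorem Feasible.conj_perm {ℓ : Fin N ↪ V} {σ : Equiv.Perm V} {f : Bits (Fin N) → Bits (Fin N)}
    {d e : ℕ} (hσ : SwapDepth G e σ)
    (hf : Feasible G True d (placeOp (ℓ.trans σ.toEmbedding) f)) :
    Feasible G True (6 * e + d) (placeOp ℓ f) := by
  have hP := hσ.feasible True
  have h := (hP.mul hf).mul hP.conjTranspose
  rw [placeOp_mul_qubitPermOp, ← mul_assoc, hP.conjTranspose_mul, one_mul] at h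
  exact h.mono_depth (by omega)

theorem feasible_placeOp_addSrc {ℓ : Fin N ↪ V} {S : Finset (Fin N)} {src : Fin N → Fin N}
    (hadj : ∀ k ∈ S, G.Adj (ℓ (src k)) (ℓ k)) (hsrc : ∀ k ∈ S, src k ∉ S)
    (hinj : Set.InjOn src S) : Feasible G True 1 (placeOp ℓ (addSrc S src)) := by
  set src' : V → V := Function.extend ℓ (ℓ ∘ src) id with hsrc'
  have hs : ∀ k, src' (ℓ k) = ℓ (src k) := fun k => ℓ.injective.extend_apply _ _ _
  have hm : IsMatchingOn G (S.map ℓ) src' := by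
    refine ⟨?_, ?_, ?_⟩
    · simp only [Finset.mem_map]
      rintro _ ⟨k, hk, rfl⟩
      rw [hs]
      exact hadj k hk
    · simp only [Finset.mem_map]
      rintro _ ⟨k, hk, rfl⟩ ⟨j, hj, h⟩
      rw [hs] at h
      exact hsrc k hk (ℓ.injective h ▸ hj)
    · rintro _ hk _ hj h
      obtain ⟨k, hk', rfl⟩ := Finset.mem_map.1 hk
      obtain ⟨j, hj', rfl⟩ := Finset.mem_map.1 hj
      rw [hs, hs] at h
      rw [hinj hk' hj' (ℓ.injective h)]
  have h := hm.feasible_cnot (cn := True)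
  convert h using 1
  refine mono_congr (fun t => ?_) fun t => rfl
  refine bits_ext_place ℓ (fun k => ?_) fun v hv => ?_
  · rw [placeAct_apply]
    simp [addSrc, hs]
  · rw [placeAct_of_notMem _ _ _ hv, addSrc, if_neg]
    rw [Finset.mem_map]
    rintro ⟨k, -, rfl⟩
    exact hv ⟨k, rfl⟩

end Place

/-- Routing only prescribes the destinations of some cells; the remaining cells may be permuted in
any way. -/
theorem exists_perm_comp_eq {A D : Type} [Finite D] {g g' : A → D} (hg : Function.Injective g)
    (hg' : Function.Injective g') : ∃ σ : Equiv.Perm D, ∀ a, σ (g a) = g' a := by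
  classical
  have := Fintype.ofFinite D
  let e : {x // x ∈ Set.range g} ≃ {x // x ∈ Set.range g'} :=
    (Equiv.ofInjective g hg).symm.trans (Equiv.ofInjective g' hg')
  refine ⟨e.extendSubtype, fun a => ?_⟩
  rw [Equiv.extendSubtype_apply_of_mem e (g a) ⟨a, rfl⟩]
  have : (Equiv.ofInjective g hg).symm ⟨g a, ⟨a, rfl⟩⟩ = a := by
    rw [Equiv.symm_apply_eq]
    rfl
  simp [e, this]

/-! ### Passes of CNOTs inside squares of growing side -/

section SquarePasses

variable {L N : ℕ}

theorem snakeIndex_lt (v : Fin L × Fin L) : snakeIndex v < L * L := by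
  rw [snakeIndex_eq]
  have h1 := snakeOffset_lt v
  have h2 : (v.1 + 1 : ℕ) * L ≤ L * L := Nat.mul_le_mul_right L v.1.2
  rw [add_mul] at h2
  omega

theorem exists_snakeIndex_eq {i : ℕ} (hi : i < L * L) :
    ∃ v : Fin L × Fin L, snakeIndex v = i := by
  have hinj : Function.Injective fun v : Fin L × Fin L => (⟨snakeIndex v, snakeIndex_lt v⟩ :
      Fin (L * L)) := fun u v h => snakeIndex_injective (Fin.mk.inj_iff.1 h)
  have hbij := (Fintype.bijective_iff_injective_and_card _).2 ⟨hinj, by simp⟩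
  obtain ⟨v, hv⟩ := hbij.2 ⟨i, hi⟩
  exact ⟨v, Fin.mk.inj_iff.1 hv⟩

theorem gridGraph_adj_of_snakeIndex {u v : Fin L × Fin L} (h : snakeIndex u + 1 = snakeIndex v) :
    (gridGraph L).Adj u v := by
  have h1 := snakeOffset_lt u
  have h2 := snakeOffset_lt v
  have hu := u.2.2
  have hv := v.2.2
  rw [snakeIndex_eq, snakeIndex_eq] at h
  have hle : (u.1 : ℕ) ≤ v.1 := by
    by_contra! hlt
    have : (v.1 + 1 : ℕ) * L ≤ u.1 * L := Nat.mul_le_mul_right L hlt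
    rw [add_mul] at this
    omega
  rcases hle.eq_or_lt with he | hlt
  · refine rowGraph_le L ⟨Fin.ext he, ?_⟩
    rw [SimpleGraph.pathGraph_adj]
    unfold snakeOffset at *
    rw [he] at h
    split_ifs at * <;> omega
  · have hge : (v.1 : ℕ) ≤ u.1 + 1 := by
      by_contra! hlt'
      have : (u.1 + 2 : ℕ) * L ≤ v.1 * L := Nat.mul_le_mul_right L hlt'
      rw [add_mul] at this
      omega
    have he : (v.1 : ℕ) = u.1 + 1 := by omega
    rw [he, add_mul] at h
    -- The row changes from offset `L - 1` to offset `0`, and the opposite directions of adjacent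
    -- rows put both into the same column.
    refine colGraph_le L ⟨Fin.ext ?_, ?_⟩
    · have hpar := Nat.even_add_one (n := (u.1 : ℕ))
      unfold snakeOffset at *
      rw [he] at h
      by_cases hp : Even (u.1 : ℕ)
      · rw [if_pos hp, if_neg (by tauto)] at h
        omega
      · rw [if_neg hp, if_pos (by tauto)] at h
        omega
    · rw [SimpleGraph.pathGraph_adj]
      exact Or.inl he.symm

/-- The embedding of the upper left square of side `m`. -/
def squareEmb {m : ℕ} (h : m ≤ L) : Fin m × Fin m ↪ Fin L × Fin L :=
  (Fin.castLEEmb h).prodMap (Fin.castLEEmb h)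

theorem squareEmb_adj {m : ℕ} (h : m ≤ L) (u v : Fin m × Fin m) (huv : (gridGraph m).Adj u v) :
    (gridGraph L).Adj (squareEmb h u) (squareEmb h v) := by
  unfold gridGraph at *
  rw [SimpleGraph.boxProd_adj] at *
  simp only [SimpleGraph.pathGraph_adj, squareEmb, Fin.ext_iff] at *
  exact huv

theorem swapDepth_square {m : ℕ} (h : m ≤ L) (σ : Equiv.Perm (Fin m × Fin m)) :
    SwapDepth (gridGraph L) (6 * m) (σ.viaEmbedding (squareEmb h)) :=
  (swapDepth_gridGraph σ).viaEmbedding _ (squareEmb_adj h)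

/-- A layer of controlled not gates on arbitrary disjoint pairs of qubits in a square. -/
theorem feasible_addSrc_square {m : ℕ} (hm : m ≤ L) {ℓ : Fin N ↪ Fin L × Fin L}
    {S : Finset (Fin N)} {src : Fin N → Fin N} (hsrc : ∀ k ∈ S, src k ∉ S)
    (hinj : Set.InjOn src S)
    (hsq : ∀ k ∈ S, ((ℓ k).1 < m ∧ ((ℓ k).2 : ℕ) < m) ∧
      ((ℓ (src k)).1 < m ∧ ((ℓ (src k)).2 : ℕ) < m)) :
    Feasible (gridGraph L) True (36 * m + 1) (placeOp ℓ (addSrc S src)) := by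
  let toSq (v : Fin L × Fin L) (h : v.1 < m ∧ (v.2 : ℕ) < m) : Fin m × Fin m :=
    (⟨v.1, h.1⟩, ⟨v.2, h.2⟩)
  have htoSq : ∀ v h, squareEmb hm (toSq v h) = v := fun v h => rfl
  -- The present cells of targets and controls. They are sent to the cells `2 * i` and `2 * i + 1`
  -- of the snake in the square, which are adjacent.
  let g : S ⊕ S → Fin m × Fin m := Sum.elim (fun k => toSq (ℓ k) (hsq k k.2).1)
    fun k => toSq (ℓ (src k)) (hsq k k.2).2
  have hg : Function.Injective g := by
    have hg1 : ∀ x, squareEmb hm (g x) = ℓ (Sum.elim (fun k : S => (k : Fin N))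
        (fun k : S => src k) x) := by
      rintro (k | k) <;> rfl
    intro x y hxy
    have h := congrArg (squareEmb hm) hxy
    rw [hg1, hg1] at h
    have h := ℓ.injective h
    rcases x with k | k <;> rcases y with j | j <;> simp only [Sum.elim_inl, Sum.elim_inr] at h
    · rw [Subtype.ext h]
    · exact absurd k.2 (h ▸ hsrc j j.2)
    · exact absurd j.2 (h ▸ hsrc k k.2)
    · rw [Subtype.ext (hinj k.2 j.2 h)]
  have hcard : 2 * S.card ≤ m * m := by
    have := Fintype.card_le_of_injective g hg
    simp at this
    omega
  have hdom : ∀ k : S, ∃ p : (Fin m × Fin m) × (Fin m × Fin m),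
      snakeIndex p.1 = 2 * (S.equivFin k : ℕ) ∧ snakeIndex p.2 = 2 * (S.equivFin k : ℕ) + 1 := by
    intro k
    have := (S.equivFin k).2
    obtain ⟨u, hu⟩ := exists_snakeIndex_eq (L := m) (i := 2 * (S.equivFin k : ℕ)) (by omega)
    obtain ⟨v, hv⟩ := exists_snakeIndex_eq (L := m) (i := 2 * (S.equivFin k : ℕ) + 1) (by omega)
    exact ⟨(u, v), hu, hv⟩
  choose p hp1 hp2 using hdom
  let g' : S ⊕ S → Fin m × Fin m := Sum.elim (fun k => (p k).1) fun k => (p k).2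
  have hg' : Function.Injective g' := by
    intro x y hxy
    have h := congrArg snakeIndex hxy
    rcases x with k | k <;> rcases y with j | j <;>
      simp only [g', Sum.elim_inl, Sum.elim_inr, hp1, hp2] at h
    · rw [S.equivFin.injective (a₁ := k) (a₂ := j) (Fin.ext (by omega))]
    · omega
    · omega
    · rw [S.equivFin.injective (a₁ := k) (a₂ := j) (Fin.ext (by omega))]
  obtain ⟨σ, hσ⟩ := exists_perm_comp_eq hg hg'
  have h1 : ∀ k : S, σ.viaEmbedding (squareEmb hm) (ℓ k) = squareEmb hm (p k).1 := by
    intro k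
    rw [← htoSq (ℓ k) (hsq k k.2).1, Equiv.Perm.viaEmbedding_apply]
    exact congrArg _ (hσ (Sum.inl k))
  have h2 : ∀ k : S, σ.viaEmbedding (squareEmb hm) (ℓ (src k)) = squareEmb hm (p k).2 := by
    intro k
    rw [← htoSq (ℓ (src k)) (hsq k k.2).2, Equiv.Perm.viaEmbedding_apply]
    exact congrArg _ (hσ (Sum.inr k))
  -- Routing takes `6 * m` swap layers, that is `18 * m` layers of CNOTs each way, around a single
  -- layer of gates.
  have := Feasible.conj_perm (ℓ := ℓ) (f := addSrc S src) (swapDepth_square hm σ)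
    (feasible_placeOp_addSrc (G := gridGraph L) (fun k hk => by
      simp only [Function.Embedding.trans_apply, Equiv.coe_toEmbedding]
      rw [h1 ⟨k, hk⟩, h2 ⟨k, hk⟩]
      refine squareEmb_adj hm _ _ (gridGraph_adj_of_snakeIndex ?_).symm
      rw [hp1, hp2]) hsrc hinj)
  exact this.mono_depth (by omega)

theorem card_le_of_embedding (ℓ : Fin N ↪ Fin L × Fin L) : N ≤ L * L := by
  simpa using Fintype.card_le_of_embedding ℓ

/-- The side of a square with room for `2 ^ (d + 1)` qubits, but at most `L`. -/
def levelSide (L d : ℕ) : ℕ := min L (2 ^ (d / 2 + 1))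

theorem levelSide_mono {d e : ℕ} (h : d ≤ e) : levelSide L d ≤ levelSide L e :=
  min_le_min le_rfl (Nat.pow_le_pow_right (by norm_num) (by omega))

theorem le_levelSide_mul {n d : ℕ} (h1 : n ≤ L * L) (h2 : n ≤ 2 ^ (d + 1)) :
    n ≤ levelSide L d * levelSide L d := by
  unfold levelSide
  rcases le_total L (2 ^ (d / 2 + 1)) with h | h
  · rwa [min_eq_left h]
  · rw [min_eq_right h, ← pow_add]
    exact h2.trans (Nat.pow_le_pow_right (by norm_num) (by omega))

/-- By Hall's theorem: a set of labels with largest depth d has at most 2^(d+1) and at most L²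
elements, so the square belonging to d alone has room for it. -/
theorem exists_layout (hN : N ≤ L * L) (dep : Fin N → ℕ)
    (hcount : ∀ d, (Finset.univ.filter fun k => dep k ≤ d).card ≤ 2 ^ (d + 1)) :
    ∃ κ : Fin N ↪ Fin L × Fin L, ∀ k, (κ k).1 < levelSide L (dep k) ∧
      ((κ k).2 : ℕ) < levelSide L (dep k) := by
  let B : ℕ → Finset (Fin L × Fin L) := fun d =>
    Finset.univ.map (squareEmb (L := L) (m := levelSide L d) (min_le_left _ _))
  have hB : ∀ d v, v ∈ B d → v.1 < levelSide L d ∧ (v.2 : ℕ) < levelSide L d := by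
    intro d v hv
    obtain ⟨w, -, rfl⟩ := Finset.mem_map.1 hv
    exact ⟨w.1.2, w.2.2⟩
  obtain ⟨f, hf, hf'⟩ := (Finset.all_card_le_biUnion_card_iff_exists_injective
    (fun k => B (dep k))).1 (by
      intro s
      rcases s.eq_empty_or_nonempty with rfl | hs
      · simp
      obtain ⟨k, hk, hmax⟩ := s.exists_max_image dep hs
      have h1 : s.card ≤ 2 ^ (dep k + 1) := (Finset.card_le_card fun j hj => by
        simpa using hmax j hj).trans (hcount (dep k))
      have h2 : s.card ≤ L * L := (Finset.card_le_univ s).trans (by simpa using hN)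
      calc s.card ≤ (B (dep k)).card := by
            simpa [B] using le_levelSide_mul h2 h1
        _ ≤ _ := Finset.card_le_card (Finset.subset_biUnion_of_mem (fun k => B (dep k)) hk))
  exact ⟨⟨f, hf⟩, fun k => hB _ _ (hf' k)⟩

/-- The composition of `f 0, …, f (n - 1)`, applied in this order. -/
def iterMaps {α : Type} (f : ℕ → α → α) : ℕ → α → α
  | 0 => id
  | n + 1 => f n ∘ iterMaps f n

/-- When `h` grows by two, the two new terms add at most the old bound, and the bound doubles. -/
theorem sum_pow_half_le (h : ℕ) : ∑ d ∈ Finset.range h, 2 ^ (d / 2 + 1) ≤ 4 * 2 ^ ((h + 1) / 2) := by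
  induction h using Nat.strong_induction_on with
  | _ h ih =>
    match h with
    | 0 => simp
    | 1 => simp
    | h + 2 =>
      have h0 := ih h (by omega)
      rw [Finset.sum_range_succ, Finset.sum_range_succ]
      have h1 : 2 ^ (h / 2 + 1) ≤ 2 ^ ((h + 1) / 2 + 1) :=
        Nat.pow_le_pow_right (by norm_num) (by omega)
      rw [show (h + 2 + 1) / 2 = (h + 1) / 2 + 1 by omega]
      rw [pow_succ 2 ((h + 1) / 2)] at *
      omega

/-- A sequence of layers of controlled not gates on disjoint pairs, the layer `d` acting on at most
`2 ^ (d + 1)` qubits, has a circuit whose depth is linear in the side of the grid. -/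
theorem feasible_iterMaps {h : ℕ} (hh : 2 ^ h ≤ 2 * (L * L))
    (ℓ : Fin N ↪ Fin L × Fin L) (dep : Fin N → ℕ)
    (hcount : ∀ d, (Finset.univ.filter fun k => dep k ≤ d).card ≤ 2 ^ (d + 1))
    (S : ℕ → Finset (Fin N)) (src : ℕ → Fin N → Fin N)
    (hsrc : ∀ d, ∀ k ∈ S d, src d k ∉ S d) (hinj : ∀ d, Set.InjOn (src d) (S d))
    (hdep : ∀ d, ∀ k ∈ S d, dep k ≤ d ∧ dep (src d k) ≤ d) :
    Feasible (gridGraph L) True (332 * L)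
      (placeOp ℓ (iterMaps (fun d => addSrc (S d) (src d)) h)) := by
  obtain ⟨κ, hκ⟩ := exists_layout (card_le_of_embedding ℓ) dep hcount
  have hstep : ∀ d, Feasible (gridGraph L) True (37 * 2 ^ (d / 2 + 1))
      (placeOp κ (addSrc (S d) (src d))) := by
    intro d
    have := feasible_addSrc_square (L := L) (m := levelSide L d) (min_le_left _ _) (ℓ := κ)
      (hsrc d) (hinj d) (fun k hk => by
        have h1 := levelSide_mono (L := L) (hdep d k hk).1
        have h2 := levelSide_mono (L := L) (hdep d k hk).2
        have h3 := hκ k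
        have h4 := hκ (src d k)
        omega)
    refine this.mono_depth ?_
    have h1 : levelSide L d ≤ 2 ^ (d / 2 + 1) := min_le_right _ _
    have h2 : 0 < 2 ^ (d / 2 + 1) := by positivity
    omega
  have hall : ∀ n, Feasible (gridGraph L) True (37 * ∑ d ∈ Finset.range n, 2 ^ (d / 2 + 1))
      (placeOp κ (iterMaps (fun d => addSrc (S d) (src d)) n)) := by
    intro n
    induction n with
    | zero => rw [iterMaps, placeOp_id]; exact Feasible.one
    | succ n ih =>
      rw [iterMaps, placeOp_mul]
      exact (ih.mul (hstep n)).mono_depth (by rw [Finset.sum_range_succ]; omega)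
  -- All passes are made in the layout `κ`, which is entered once and left once.
  obtain ⟨σ, hσ⟩ := exists_perm_comp_eq ℓ.injective κ.injective
  have hκσ : ℓ.trans σ.toEmbedding = κ := by
    ext k : 1
    exact hσ k
  have := Feasible.conj_perm (ℓ := ℓ) (swapDepth_gridGraph σ) (by rw [hκσ]; exact hall h)
  refine this.mono_depth ?_
  -- The change of layout costs `36 * L`, the passes at most `37 * 4 * (2 * L)`.
  have h1 := sum_pow_half_le h
  have h2 : 2 ^ ((h + 1) / 2) ≤ 2 * L := by
    refine (Nat.pow_le_pow_iff_left (n := 2) (by norm_num)).1 ?_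
    calc (2 ^ ((h + 1) / 2)) ^ 2 = 2 ^ ((h + 1) / 2 * 2) := by rw [pow_mul]
      _ ≤ 2 ^ (h + 1) := Nat.pow_le_pow_right (by norm_num) (by omega)
      _ = 2 ^ h * 2 := pow_succ _ _
      _ ≤ (2 * L) ^ 2 := by nlinarith
  omega

end SquarePasses

/-! ### The linear encodings of trees -/

section Trees

/-- The bits of the encoding of shape `T`, with labels starting at `o`: every node stores the
parity of the occupation numbers in its left subtree and at the node itself. -/
def treeEnc : BinaryTree Unit → ℕ → (ℕ → Fin 2) → ℕ → Fin 2
  | .nil, _, s => s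
  | .node _ l r, o, s => fun j =>
    if j < o + l.numNodes then treeEnc l o s j
    else if j = o + l.numNodes then ∑ i ∈ Finset.Ico o (o + l.numNodes + 1), s i
    else treeEnc r (o + l.numNodes + 1) s j

/-- The depth of the node with label `j`. -/
def treeDepth : BinaryTree Unit → ℕ → ℕ → ℕ
  | .nil, _, _ => 0
  | .node _ l r, o, j =>
    if j < o + l.numNodes then treeDepth l o j + 1
    else if j = o + l.numNodes then 0
    else treeDepth r (o + l.numNodes + 1) j + 1

/-- The label of the lowest ancestor that has `j` in its left subtree if `b` is true, and in its
right subtree if `b` is false; it is `a` if there is none. -/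
def treePar (b : Bool) : BinaryTree Unit → ℕ → Option ℕ → ℕ → Option ℕ
  | .nil, _, a, _ => a
  | .node _ l r, o, a, j =>
    if j < o + l.numNodes then treePar b l o (if b then some (o + l.numNodes) else a) j
    else if j = o + l.numNodes then a
    else treePar b r (o + l.numNodes + 1) (if b then a else some (o + l.numNodes)) j

theorem sum_Ico_node {M : Type} [AddCommMonoid M] (o a b : ℕ) (F : ℕ → M) :
    ∑ j ∈ Finset.Ico o (o + (a + b + 1)), F j =
      ∑ j ∈ Finset.Ico o (o + a), F j + F (o + a) +
        ∑ j ∈ Finset.Ico (o + a + 1) (o + a + 1 + b), F j := by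
  rw [← Finset.sum_Ico_succ_top (by omega), Finset.sum_Ico_consecutive _ (by omega) (by omega)]
  congr 2
  omega

/-- The outside value `a` survives only along one outer spine. Any other value is a proper ancestor
within the tree, so the depth drops strictly. -/
theorem treePar_mem (b : Bool) (T : BinaryTree Unit) (o : ℕ) (a : Option ℕ) {j : ℕ}
    (hj : j ∈ Finset.Ico o (o + T.numNodes)) :
    treePar b T o a j = a ∨ ∃ p ∈ Finset.Ico o (o + T.numNodes), treePar b T o a j = some p ∧
      treeDepth T o p < treeDepth T o j := by
  induction T generalizing o a with
  | nil => left; rfl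
  | node u l r ihl ihr =>
    simp only [Finset.mem_Ico, BinaryTree.numNodes] at hj ihl ihr ⊢
    rcases lt_trichotomy j (o + l.numNodes) with h | h | h
    · have hd : treeDepth (.node u l r) o j = treeDepth l o j + 1 := by simp [treeDepth, h]
      have hroot : treeDepth (.node u l r) o (o + l.numNodes) = 0 := by simp [treeDepth]
      have hp : treePar b (.node u l r) o a j =
        treePar b l o (if b then some (o + l.numNodes) else a) j := by simp [treePar, h]
      rw [hp]
      rcases ihl o (if b then some (o + l.numNodes) else a) ⟨hj.1, h⟩ with e | ⟨p, hp1, hp2, hp3⟩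
      · rw [e]
        cases b
        · left; rfl
        · right
          exact ⟨o + l.numNodes, by omega, rfl, by omega⟩
      · right
        refine ⟨p, by omega, hp2, ?_⟩
        rw [hd]
        simp only [treeDepth, if_pos hp1.2]
        omega
    · left
      simp [treePar, h]
    · have hn1 : ¬ j < o + l.numNodes := by omega
      have hn2 : j ≠ o + l.numNodes := by omega
      have hd : treeDepth (.node u l r) o j = treeDepth r (o + l.numNodes + 1) j + 1 := by
        simp [treeDepth, hn1, hn2]
      have hroot : treeDepth (.node u l r) o (o + l.numNodes) = 0 := by simp [treeDepth]
      have hp : treePar b (.node u l r) o a j =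
        treePar b r (o + l.numNodes + 1) (if b then a else some (o + l.numNodes)) j := by
        simp [treePar, hn1, hn2]
      rw [hp]
      rcases ihr (o + l.numNodes + 1) (if b then a else some (o + l.numNodes)) (by omega) with
        e | ⟨p, hp1, hp2, hp3⟩
      · rw [e]
        cases b
        · right
          exact ⟨o + l.numNodes, by omega, rfl, by omega⟩
        · left; rfl
      · right
        refine ⟨p, by omega, hp2, ?_⟩
        rw [hd]
        have hn1 : ¬ p < o + l.numNodes := by omega
        have hn2 : p ≠ o + l.numNodes := by omega
        simp only [treeDepth, if_neg hn1, if_neg hn2]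
        omega

/-- The value `a` is no label of a tree with `n` nodes and labels starting at `o`. -/
def IsFresh (a : Option ℕ) (o n : ℕ) : Prop := ∀ p, a = some p → p < o ∨ o + n ≤ p

theorem treePar_ne (b : Bool) (T : BinaryTree Unit) (o : ℕ) (a : Option ℕ) {j q : ℕ}
    (hj : j ∈ Finset.Ico o (o + T.numNodes)) (ha : a ≠ some q)
    (hq : q < o ∨ o + T.numNodes ≤ q) : treePar b T o a j ≠ some q := by
  rcases treePar_mem b T o a hj with e | ⟨p, hp, e, -⟩
  · rwa [e]
  · rw [e]
    rw [Finset.mem_Ico] at hp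
    simp only [ne_eq, Option.some.injEq]
    omega

/-- The nodes with a given parent form the right spine of its left subtree (the left spine of its
right subtree if `b` is false), and a spine has one node at each depth. This makes each pass a
matching. -/
theorem treePar_injOn (b : Bool) (T : BinaryTree Unit) (o : ℕ) (a : Option ℕ)
    (ha : IsFresh a o T.numNodes) {j j' : ℕ} (hj : j ∈ Finset.Ico o (o + T.numNodes))
    (hj' : j' ∈ Finset.Ico o (o + T.numNodes)) (hd : treeDepth T o j = treeDepth T o j')
    (hp : treePar b T o a j = treePar b T o a j') : j = j' := by
  induction T generalizing o a j j' with
  | nil => simp [BinaryTree.numNodes] at hj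
  | node u l r ihl ihr =>
    -- Nodes on different sides of the root never share a parent; freshness of `a` rules out an
    -- accidental coincidence.
    have aux : ∀ i i', i < o + l.numNodes → o + l.numNodes < i' →
        i ∈ Finset.Ico o (o + (BinaryTree.node u l r).numNodes) →
        i' ∈ Finset.Ico o (o + (BinaryTree.node u l r).numNodes) →
        treePar b (.node u l r) o a i ≠ treePar b (.node u l r) o a i' := by
      intro i i' h h' hi hi'
      have hn1 : ¬ i' < o + l.numNodes := by omega
      have hn2 : i' ≠ o + l.numNodes := by omega
      simp only [Finset.mem_Ico, BinaryTree.numNodes] at hi hi'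
      simp only [treePar, if_pos h, if_neg hn1, if_neg hn2]
      simp only [IsFresh, BinaryTree.numNodes] at ha
      rcases treePar_mem b l o (if b then some (o + l.numNodes) else a) (j := i)
        (by rw [Finset.mem_Ico]; omega) with e | ⟨p, hp, e, -⟩ <;>
      rcases treePar_mem b r (o + l.numNodes + 1) (if b then a else some (o + l.numNodes)) (j := i')
        (by rw [Finset.mem_Ico]; omega) with e' | ⟨p', hp', e', -⟩ <;> rw [e, e']
      · cases b
        · intro h; have := ha _ h; omega
        · intro h; have := ha _ h.symm; omega
      · rw [Finset.mem_Ico] at hp'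
        cases b
        · intro h; have := ha _ h; omega
        · intro h; simp at h; omega
      · rw [Finset.mem_Ico] at hp
        cases b
        · intro h; simp at h; omega
        · intro h; have := ha _ h.symm; omega
      · rw [Finset.mem_Ico] at hp hp'
        intro h; simp at h; omega
    have hl : IsFresh (if b then some (o + l.numNodes) else a) o l.numNodes := by
      simp only [IsFresh, BinaryTree.numNodes] at ha ⊢
      cases b
      · intro p hp; have := ha p hp; omega
      · intro p hp; simp at hp; omega
    have hr : IsFresh (if b then a else some (o + l.numNodes)) (o + l.numNodes + 1) r.numNodes := by
      simp only [IsFresh, BinaryTree.numNodes] at ha ⊢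
      cases b
      · intro p hp; simp at hp; omega
      · intro p hp; have := ha p hp; omega
    rcases lt_trichotomy j (o + l.numNodes) with h | h | h <;>
      rcases lt_trichotomy j' (o + l.numNodes) with h' | h' | h'
    · simp only [Finset.mem_Ico, BinaryTree.numNodes] at hj hj'
      simp only [treePar, if_pos h, if_pos h'] at hp
      simp only [treeDepth, if_pos h, if_pos h'] at hd
      exact ihl o _ hl (by rw [Finset.mem_Ico]; omega) (by rw [Finset.mem_Ico]; omega) (by omega) hp
    · simp [treeDepth, h, h'] at hd
    · exact absurd hp (aux j j' h h' hj hj')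
    · simp [treeDepth, h, h'] at hd
    · omega
    · have hn1 : ¬ j' < o + l.numNodes := by omega
      have hn2 : j' ≠ o + l.numNodes := by omega
      simp [treeDepth, h, hn1, hn2] at hd
    · exact absurd hp.symm (aux j' j h' h hj' hj)
    · have hn1 : ¬ j < o + l.numNodes := by omega
      have hn2 : j ≠ o + l.numNodes := by omega
      simp [treeDepth, h', hn1, hn2] at hd
    · have hn1 : ¬ j < o + l.numNodes := by omega
      have hn2 : j ≠ o + l.numNodes := by omega
      have hn1' : ¬ j' < o + l.numNodes := by omega
      have hn2' : j' ≠ o + l.numNodes := by omega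
      simp only [Finset.mem_Ico, BinaryTree.numNodes] at hj hj'
      simp only [treePar, if_neg hn1, if_neg hn2, if_neg hn1', if_neg hn2'] at hp
      simp only [treeDepth, if_neg hn1, if_neg hn2, if_neg hn1', if_neg hn2'] at hd
      exact ihr _ _ hr (by rw [Finset.mem_Ico]; omega) (by rw [Finset.mem_Ico]; omega) (by omega) hp

theorem treeDepth_lt_height (T : BinaryTree Unit) (o : ℕ) {j : ℕ}
    (hj : j ∈ Finset.Ico o (o + T.numNodes)) : treeDepth T o j < T.height := by
  induction T generalizing o with
  | nil => simp [BinaryTree.numNodes] at hj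
  | node u l r ihl ihr =>
    simp only [Finset.mem_Ico, BinaryTree.numNodes] at hj ihl ihr
    rw [treeDepth, BinaryTree.height]
    split_ifs with h1 h2
    · have := ihl o ⟨hj.1, h1⟩
      omega
    · omega
    · have := ihr (o + l.numNodes + 1) (by omega)
      omega

/-- With the summand 1 included, the bounds for the two subtrees add up to exactly the bound for the
tree, root included. -/
theorem card_treeDepth_lt (T : BinaryTree Unit) (o d : ℕ) :
    (∑ j ∈ Finset.Ico o (o + T.numNodes), if treeDepth T o j < d then 1 else 0) + 1 ≤ 2 ^ d := by
  induction T generalizing o d with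
  | nil => simpa [BinaryTree.numNodes] using Nat.one_le_two_pow
  | node u l r ihl ihr =>
    cases d with
    | zero => simp
    | succ d =>
      rw [BinaryTree.numNodes, sum_Ico_node]
      have h1 := ihl o d
      have h2 := ihr (o + l.numNodes + 1) d
      have e1 : ∑ j ∈ Finset.Ico o (o + l.numNodes),
          (if treeDepth (.node u l r) o j < d + 1 then 1 else 0) =
          ∑ j ∈ Finset.Ico o (o + l.numNodes), if treeDepth l o j < d then 1 else 0 := by
        refine Finset.sum_congr rfl fun j hj => ?_
        rw [Finset.mem_Ico] at hj
        simp [treeDepth, hj.2]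
      have e2 : ∑ j ∈ Finset.Ico (o + l.numNodes + 1) (o + l.numNodes + 1 + r.numNodes),
          (if treeDepth (.node u l r) o j < d + 1 then 1 else 0) =
          ∑ j ∈ Finset.Ico (o + l.numNodes + 1) (o + l.numNodes + 1 + r.numNodes),
            if treeDepth r (o + l.numNodes + 1) j < d then 1 else 0 := by
        refine Finset.sum_congr rfl fun j hj => ?_
        rw [Finset.mem_Ico] at hj
        have hn1 : ¬ j < o + l.numNodes := by omega
        have hn2 : j ≠ o + l.numNodes := by omega
        simp [treeDepth, hn1, hn2]
      rw [e1, e2, pow_succ]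
      have e3 : (if treeDepth (.node u l r) o (o + l.numNodes) < d + 1 then 1 else 0) = 1 := by
        simp [treeDepth]
      rw [e3]
      omega

theorem treeEnc_left {u : Unit} {l r : BinaryTree Unit} {o j : ℕ} (s : ℕ → Fin 2)
    (h : j < o + l.numNodes) : treeEnc (.node u l r) o s j = treeEnc l o s j := by
  simp [treeEnc, h]

theorem treeEnc_root {u : Unit} {l r : BinaryTree Unit} {o : ℕ} (s : ℕ → Fin 2) :
    treeEnc (.node u l r) o s (o + l.numNodes) =
      ∑ i ∈ Finset.Ico o (o + l.numNodes + 1), s i := by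
  simp [treeEnc]

theorem treeEnc_right {u : Unit} {l r : BinaryTree Unit} {o j : ℕ} (s : ℕ → Fin 2)
    (h : o + l.numNodes < j) :
    treeEnc (.node u l r) o s j = treeEnc r (o + l.numNodes + 1) s j := by
  have hn1 : ¬ j < o + l.numNodes := by omega
  have hn2 : j ≠ o + l.numNodes := by omega
  simp [treeEnc, hn1, hn2]

theorem treePar_left {b : Bool} {u : Unit} {l r : BinaryTree Unit} {o j : ℕ} (a : Option ℕ)
    (h : j < o + l.numNodes) : treePar b (.node u l r) o a j =
      treePar b l o (if b then some (o + l.numNodes) else a) j := by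
  simp [treePar, h]

theorem treePar_root {b : Bool} {u : Unit} {l r : BinaryTree Unit} {o : ℕ} (a : Option ℕ) :
    treePar b (.node u l r) o a (o + l.numNodes) = a := by
  simp [treePar]

theorem treePar_right {b : Bool} {u : Unit} {l r : BinaryTree Unit} {o j : ℕ} (a : Option ℕ)
    (h : o + l.numNodes < j) : treePar b (.node u l r) o a j =
      treePar b r (o + l.numNodes + 1) (if b then a else some (o + l.numNodes)) j := by
  have hn1 : ¬ j < o + l.numNodes := by omega
  have hn2 : j ≠ o + l.numNodes := by omega
  simp [treePar, hn1, hn2]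

/-- The bits without a lower left ancestor add up to the total parity. -/
theorem sum_treeEnc_top (T : BinaryTree Unit) (o : ℕ) (a : Option ℕ) (s : ℕ → Fin 2)
    (ha : IsFresh a o T.numNodes) :
    (∑ j ∈ Finset.Ico o (o + T.numNodes),
      if treePar true T o a j = a then treeEnc T o s j else 0) =
      ∑ j ∈ Finset.Ico o (o + T.numNodes), s j := by
  induction T generalizing o a with
  | nil => simp [BinaryTree.numNodes]
  | node u l r ihl ihr =>
    simp only [IsFresh, BinaryTree.numNodes] at ha ihr ⊢
    rw [sum_Ico_node, sum_Ico_node, treePar_root, if_pos rfl, treeEnc_root,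
      Finset.sum_Ico_succ_top (by omega)]
    congr 1
    -- In the left subtree every parent is the root or a node below it, never the fresh `a`. So only
    -- the root and the right subtree contribute.
    · rw [Finset.sum_eq_zero, zero_add]
      intro j hj
      have hj' := Finset.mem_Ico.1 hj
      rw [treePar_left _ hj'.2, if_neg]
      rcases treePar_mem true l o (if true then some (o + l.numNodes) else a) hj with
        e | ⟨p, hp, e, -⟩ <;> rw [e] <;> intro h <;> have := ha _ h.symm
      · omega
      · rw [Finset.mem_Ico] at hp
        omega
    · rw [← ihr (o + l.numNodes + 1) a fun p hp => by have := ha p hp; omega]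
      refine Finset.sum_congr rfl fun j hj => ?_
      rw [Finset.mem_Ico] at hj
      rw [treePar_right _ (by omega), treeEnc_right _ (by omega)]
      rfl

/-- The children of `k` form the right spine of its left subtree, whose bits add up to the parity of
that subtree. Adding it to the stored parity leaves the occupation number of `k`. -/
theorem sum_treeEnc_children (T : BinaryTree Unit) (o : ℕ) (a : Option ℕ) (s : ℕ → Fin 2)
    (ha : IsFresh a o T.numNodes) {k : ℕ} (hk : k ∈ Finset.Ico o (o + T.numNodes)) :
    treeEnc T o s k + (∑ j ∈ Finset.Ico o (o + T.numNodes),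
      if treePar true T o a j = some k then treeEnc T o s j else 0) = s k := by
  induction T generalizing o a with
  | nil => simp [BinaryTree.numNodes] at hk
  | node u l r ihl ihr =>
    have hk0 := hk
    simp only [IsFresh, BinaryTree.numNodes, Finset.mem_Ico] at ha hk ihl ihr ⊢
    rw [sum_Ico_node, treePar_root, if_neg (fun h => by have := ha _ h; omega), add_zero]
    have hL : ∑ j ∈ Finset.Ico o (o + l.numNodes),
        (if treePar true (.node u l r) o a j = some k then treeEnc (.node u l r) o s j else 0) =
        ∑ j ∈ Finset.Ico o (o + l.numNodes),
          if treePar true l o (some (o + l.numNodes)) j = some k then treeEnc l o s j else 0 := by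
      refine Finset.sum_congr rfl fun j hj => ?_
      rw [Finset.mem_Ico] at hj
      rw [treePar_left _ hj.2, treeEnc_left _ hj.2]
      rfl
    have hR : ∑ j ∈ Finset.Ico (o + l.numNodes + 1) (o + l.numNodes + 1 + r.numNodes),
        (if treePar true (.node u l r) o a j = some k then treeEnc (.node u l r) o s j else 0) =
        ∑ j ∈ Finset.Ico (o + l.numNodes + 1) (o + l.numNodes + 1 + r.numNodes),
          if treePar true r (o + l.numNodes + 1) a j = some k then
            treeEnc r (o + l.numNodes + 1) s j else 0 := by
      refine Finset.sum_congr rfl fun j hj => ?_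
      rw [Finset.mem_Ico] at hj
      rw [treePar_right _ (by omega), treeEnc_right _ (by omega)]
      rfl
    have hR0 : k < o + l.numNodes + 1 →
        ∑ j ∈ Finset.Ico (o + l.numNodes + 1) (o + l.numNodes + 1 + r.numNodes),
          (if treePar true r (o + l.numNodes + 1) a j = some k then
            treeEnc r (o + l.numNodes + 1) s j else 0) = 0 := fun hk' =>
      Finset.sum_eq_zero fun j hj => if_neg (treePar_ne true r _ _ hj
        (fun h => by have := ha _ h; omega) (Or.inl hk'))
    rw [hL, hR]
    rcases lt_trichotomy k (o + l.numNodes) with h | h | h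
    · rw [hR0 (by omega), add_zero, treeEnc_left _ h]
      exact ihl o _ (fun p hp => by simp at hp; omega) ⟨hk.1, h⟩
    · rw [hR0 (by omega), add_zero, h, sum_treeEnc_top l o _ s
        (fun p hp => by simp at hp; omega), treeEnc_root, Finset.sum_Ico_succ_top (by omega)]
      generalize ∑ j ∈ Finset.Ico o (o + l.numNodes), s j = x
      generalize s (o + l.numNodes) = y
      revert x y
      decide
    · rw [Finset.sum_eq_zero (s := Finset.Ico o (o + l.numNodes)), zero_add, treeEnc_right _ h]
      · exact ihr _ a (fun p hp => by have := ha p hp; omega) (by omega)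
      · intro j hj
        exact if_neg (treePar_ne true l _ _ hj (by simp; omega) (Or.inr h.le))

/-- The parity of the first `i + 1` bits is the bit at `i` plus the parity up to the lowest right
ancestor. -/
theorem treeEnc_add_prefix (T : BinaryTree Unit) (o : ℕ) (a : Option ℕ) (s : ℕ → Fin 2)
    (ha : a.elim 0 (fun p => ∑ i ∈ Finset.range (p + 1), s i) = ∑ i ∈ Finset.range o, s i)
    {j : ℕ} (hj : j ∈ Finset.Ico o (o + T.numNodes)) :
    treeEnc T o s j +
        (treePar false T o a j).elim 0 (fun p => ∑ i ∈ Finset.range (p + 1), s i) =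
      ∑ i ∈ Finset.range (j + 1), s i := by
  induction T generalizing o a with
  | nil => simp [BinaryTree.numNodes] at hj
  | node u l r ihl ihr =>
    simp only [Finset.mem_Ico, BinaryTree.numNodes] at hj ihl ihr
    -- Going left changes neither `o` nor `a`. Going right makes the root the new reference, just
    -- before the new start, so the condition on `a` holds by definition.
    rcases lt_trichotomy j (o + l.numNodes) with h | h | h
    · rw [treeEnc_left _ h, treePar_left _ h]
      exact ihl o a ha ⟨hj.1, h⟩
    · subst h
      rw [treePar_root, treeEnc_root, ha, add_comm, Finset.sum_range_add_sum_Ico _ (by omega)]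
    · rw [treeEnc_right _ h, treePar_right _ h]
      exact ihr _ _ rfl (by omega)

theorem numNodes_leftSpine (n : ℕ) : (leftSpine n).numNodes = n := by
  induction n with
  | zero => rfl
  | succ n ih => simp [leftSpine, BinaryTree.numNodes, ih]

theorem numNodes_rightSpine (n : ℕ) : (rightSpine n).numNodes = n := by
  induction n with
  | zero => rfl
  | succ n ih => simp [rightSpine, BinaryTree.numNodes, ih]

theorem treeEnc_leftSpine (n o : ℕ) (s : ℕ → Fin 2) {j : ℕ} (hj : j ∈ Finset.Ico o (o + n)) :
    treeEnc (leftSpine n) o s j = ∑ i ∈ Finset.Ico o (j + 1), s i := by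
  induction n with
  | zero => simp at hj
  | succ n ih =>
    rw [Finset.mem_Ico] at hj ih
    rw [leftSpine]
    rcases lt_or_eq_of_le (Nat.lt_succ_iff.1 (show j < (o + n).succ by omega)) with h | h
    · rw [treeEnc_left _ (by rwa [numNodes_leftSpine]), ih ⟨hj.1, h⟩]
    · have := treeEnc_root (u := ()) (l := leftSpine n) (r := .nil) (o := o) s
      rw [numNodes_leftSpine] at this
      rw [h, this]

theorem treeEnc_rightSpine (n o : ℕ) (s : ℕ → Fin 2) {j : ℕ} (hj : j ∈ Finset.Ico o (o + n)) :
    treeEnc (rightSpine n) o s j = s j := by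
  induction n generalizing o with
  | zero => simp at hj
  | succ n ih =>
    rw [Finset.mem_Ico] at hj
    simp only [Finset.mem_Ico] at ih
    rw [rightSpine]
    rcases eq_or_lt_of_le hj.1 with h | h
    · subst h
      simpa [BinaryTree.numNodes] using
        treeEnc_root (u := ()) (l := .nil) (r := rightSpine n) (o := o) s
    · rw [treeEnc_right _ (by simpa [BinaryTree.numNodes] using h)]
      exact ih _ (by simp [BinaryTree.numNodes]; omega)

theorem exists_tree_height_le (h n : ℕ) (hn : n < 2 ^ h) :
    ∃ T : BinaryTree Unit, T.numNodes = n ∧ T.height ≤ h := by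
  induction h generalizing n with
  | zero => exact ⟨.nil, by simp at hn; simp [BinaryTree.numNodes, hn], le_rfl⟩
  | succ h ih =>
    cases n with
    | zero => exact ⟨.nil, rfl, Nat.zero_le _⟩
    | succ n =>
      rw [pow_succ] at hn
      obtain ⟨T, hT, hT'⟩ := ih (n / 2) (by omega)
      obtain ⟨T', hT1, hT1'⟩ := ih (n - n / 2) (by omega)
      refine ⟨.node () T T', ?_, ?_⟩
      · rw [BinaryTree.numNodes, hT, hT1]
        omega
      · rw [BinaryTree.height]
        omega

theorem two_pow_size_le {n m : ℕ} (h : n ≤ m) (hm : 1 ≤ m) : 2 ^ n.size ≤ 2 * m := by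
  rcases Nat.eq_zero_or_pos n.size with h0 | h0
  · rw [h0]; omega
  · have : 2 ^ (n.size - 1) ≤ n := Nat.lt_size.1 (by omega)
    rw [show n.size = n.size - 1 + 1 by omega, pow_succ]
    omega

end Trees

/-! ### Conversion circuits -/

section Conversion

variable {L N : ℕ}

/-- A forest on `Fin N` with a depth, given by its parent relation, such that different nodes of
the same depth have different parents. -/
structure IsLevelForest (dep : Fin N → ℕ) (P : Fin N → Fin N → Prop) : Prop where
  dep_lt : ∀ j p, P j p → dep p < dep j
  unique_child : ∀ j j' p, dep j = dep j' → P j p → P j' p → j = j'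
  unique_parent : ∀ j p p', P j p → P j p' → p = p'

open Classical in
/-- Add the bits of all children to every bit, level by level. -/
theorem IsLevelForest.feasible_gather {dep : Fin N → ℕ} {P : Fin N → Fin N → Prop}
    (hP : IsLevelForest dep P) {h : ℕ} (hh : 2 ^ h ≤ 2 * (L * L)) (ℓ : Fin N ↪ Fin L × Fin L)
    (hcount : ∀ d, (Finset.univ.filter fun k => dep k ≤ d).card ≤ 2 ^ (d + 1))
    (hdep : ∀ k, dep k < h) :
    Feasible (gridGraph L) True (332 * L)
      (placeOp ℓ fun t p => t p + ∑ j, if P j p then t j else 0) := by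
  -- Pass `d` adds to each node the bit of its unique child of depth `d`, if there is one.
  let S : ℕ → Finset (Fin N) := fun d => Finset.univ.filter fun p => ∃ j, dep j = d ∧ P j p
  let src : ℕ → Fin N → Fin N := fun d p =>
    if hp : ∃ j, dep j = d ∧ P j p then Classical.choose hp else p
  have hS : ∀ d, ∀ p ∈ S d, dep (src d p) = d ∧ P (src d p) p := by
    intro d p hp
    have hp' : ∃ j, dep j = d ∧ P j p := (Finset.mem_filter.1 hp).2
    simp only [src, dif_pos hp']
    exact Classical.choose_spec hp'
  have hstep : ∀ d t p, addSrc (S d) (src d) t p =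
      t p + ∑ j, if dep j = d ∧ P j p then t j else 0 := by
    intro d t p
    by_cases hp : p ∈ S d
    · obtain ⟨h1, h2⟩ := hS d p hp
      rw [addSrc, if_pos hp, Finset.sum_eq_single (src d p), if_pos ⟨h1, h2⟩]
      · intro j _ hj
        refine if_neg ?_
        rintro ⟨h3, h4⟩
        exact hj (hP.unique_child _ _ p (h3.trans h1.symm) h4 h2)
      · intro h
        exact absurd (Finset.mem_univ _) h
    · rw [addSrc, if_neg hp, Finset.sum_eq_zero, add_zero]
      intro j _
      refine if_neg fun hj => hp (Finset.mem_filter.2 ⟨Finset.mem_univ _, j, hj⟩)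
  have hiter : ∀ n t p, iterMaps (fun d => addSrc (S d) (src d)) n t p =
      t p + ∑ j, if dep j < n ∧ P j p then t j else 0 := by
    intro n t
    induction n with
    | zero => intro p; simp [iterMaps]
    | succ n ih =>
      intro p
      rw [iterMaps, Function.comp_apply, hstep, ih, add_assoc, ← Finset.sum_add_distrib]
      congr 1
      refine Finset.sum_congr rfl fun j _ => ?_
      by_cases hj : P j p
      · rcases lt_trichotomy (dep j) n with hlt | heq | hgt
        · rw [if_pos ⟨hlt, hj⟩, if_neg (fun h => hlt.ne h.1), if_pos ⟨by omega, hj⟩, add_zero]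
        -- When `j` is read it still holds its original bit, because its own children are deeper and
        -- come in later passes.
        · rw [if_neg (fun h => h.1.ne heq), if_pos ⟨heq, hj⟩, if_pos ⟨by omega, hj⟩, zero_add, ih,
            Finset.sum_eq_zero, add_zero]
          intro i _
          refine if_neg ?_
          rintro ⟨h1, h2⟩
          have := hP.dep_lt _ _ h2
          omega
        · rw [if_neg (fun h => by omega), if_neg (fun h => by omega), if_neg (fun h => by omega),
            add_zero]
      · simp [hj]
  have := feasible_iterMaps hh ℓ dep hcount S src (fun d p hp hp' => by
      have h1 := hS d p hp
      have h2 := hS d _ hp'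
      have := hP.dep_lt _ _ h2.2
      omega) (fun d p hp p' hp' h => by
      have h1 := hS d p hp
      have h2 := hS d p' hp'
      rw [h] at h1
      exact hP.unique_parent _ _ _ h1.2 h2.2) (fun d p hp => by
      have h1 := hS d p hp
      have := hP.dep_lt _ _ h1.2
      omega)
  convert this using 1
  refine placeOp_congr fun t => ?_
  funext p
  rw [hiter]
  simp only [hdep, true_and]

open Classical in
/-- Add to every bit the final value of the bit of its parent, level by level. -/
theorem IsLevelForest.exists_feasible_scatter {dep : Fin N → ℕ} {P : Fin N → Fin N → Prop}
    (hP : IsLevelForest dep P) {h : ℕ} (hh : 2 ^ h ≤ 2 * (L * L)) (ℓ : Fin N ↪ Fin L × Fin L)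
    (hcount : ∀ d, (Finset.univ.filter fun k => dep k ≤ d).card ≤ 2 ^ (d + 1))
    (hdep : ∀ k, dep k < h) :
    ∃ f : Bits (Fin N) → Bits (Fin N), Feasible (gridGraph L) True (332 * L) (placeOp ℓ f) ∧
      ∀ t y : Bits (Fin N), (∀ k p, P k p → t k + y p = y k) →
        (∀ k, (∀ p, ¬ P k p) → t k = y k) → f t = y := by
  let S : ℕ → Finset (Fin N) := fun d => Finset.univ.filter fun k => dep k = d ∧ ∃ p, P k p
  let src : ℕ → Fin N → Fin N := fun d k =>
    if hk : ∃ p, P k p then Classical.choose hk else k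
  have hS : ∀ d, ∀ k ∈ S d, dep k = d ∧ P k (src d k) := by
    intro d k hk
    have hk' := (Finset.mem_filter.1 hk).2
    refine ⟨hk'.1, ?_⟩
    simp only [src, dif_pos hk'.2]
    exact Classical.choose_spec hk'.2
  refine ⟨iterMaps (fun d => addSrc (S d) (src d)) h, ?_, fun t y h1 h2 => ?_⟩
  · refine feasible_iterMaps hh ℓ dep hcount S src (fun d k hk hk' => ?_)
      (fun d k hk k' hk' e => ?_) fun d k hk => ?_
    · have h1 := hS d k hk
      have h2 := hS d _ hk'
      have := hP.dep_lt _ _ h1.2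
      omega
    · have h1 := hS d k hk
      have h2 := hS d k' hk'
      rw [e] at h1
      exact hP.unique_child _ _ _ (h1.1.trans h2.1.symm) h1.2 h2.2
    · have h1 := hS d k hk
      have := hP.dep_lt _ _ h1.2
      omega
  -- The passes go downwards, so the bit of a parent is final when it is added.
  · have key : ∀ n k, iterMaps (fun d => addSrc (S d) (src d)) n t k =
        if dep k < n then y k else t k := by
      intro n
      induction n with
      | zero => intro k; simp [iterMaps]
      | succ n ih =>
        intro k
        rw [iterMaps, Function.comp_apply, addSrc]
        by_cases hk : k ∈ S n
        · obtain ⟨h3, h4⟩ := hS n k hk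
          have h5 := hP.dep_lt _ _ h4
          rw [if_pos hk, ih, ih, if_neg (by omega), if_pos (by omega), if_pos (by omega)]
          exact h1 k _ h4
        · rw [if_neg hk, ih]
          rcases lt_trichotomy (dep k) n with hlt | heq | hgt
          · rw [if_pos hlt, if_pos (by omega)]
          · rw [if_neg (by omega), if_pos (by omega)]
            exact h2 k fun p hp => hk (Finset.mem_filter.2 ⟨Finset.mem_univ _, heq, p, hp⟩)
          · rw [if_neg (by omega), if_neg (by omega)]
    funext k
    rw [key, if_pos (hdep k)]

/-- Extend a bit string by zeros. -/
def extendBits (s : Bits (Fin N)) (i : ℕ) : Fin 2 := if h : i < N then s ⟨i, h⟩ else 0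

theorem extendBits_val (s : Bits (Fin N)) (k : Fin N) : extendBits s k = s k := by
  simp [extendBits]

/-- The bits of the encoding of shape `T`. -/
def encBits (T : BinaryTree Unit) (s : Bits (Fin N)) : Bits (Fin N) :=
  fun k => treeEnc T 0 (extendBits s) k

theorem mem_Ico_of_fin {T : BinaryTree Unit} (hT : T.numNodes = N) (k : Fin N) :
    (k : ℕ) ∈ Finset.Ico 0 (0 + T.numNodes) := by
  rw [Finset.mem_Ico]
  have := k.2
  omega

theorem isLevelForest_tree {T : BinaryTree Unit} (hT : T.numNodes = N) (b : Bool) :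
    IsLevelForest (fun k : Fin N => treeDepth T 0 k)
      fun j p => treePar b T 0 none j = some (p : ℕ) where
  dep_lt j p h := by
    rcases treePar_mem b T 0 none (mem_Ico_of_fin hT j) with e | ⟨q, -, e, hq⟩
    · rw [e] at h; simp at h
    · rw [e, Option.some.injEq] at h
      rwa [← h]
  unique_child j j' p hd h h' := Fin.ext (treePar_injOn b T 0 none (fun p hp => by simp at hp)
    (mem_Ico_of_fin hT j) (mem_Ico_of_fin hT j') hd (h.trans h'.symm))
  unique_parent j p p' h h' := by
    rw [h, Option.some.injEq] at h'
    exact Fin.ext h'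

theorem card_treeDepth_le {T : BinaryTree Unit} (hT : T.numNodes = N) (d : ℕ) :
    (Finset.univ.filter fun k : Fin N => treeDepth T 0 k ≤ d).card ≤ 2 ^ (d + 1) := by
  have h := card_treeDepth_lt T 0 (d + 1)
  rw [zero_add, hT, ← Finset.range_eq_Ico,
    ← Fin.sum_univ_eq_sum_range (fun j => if treeDepth T 0 j < d + 1 then 1 else 0)] at h
  rw [Finset.card_filter]
  simp only [Nat.lt_succ_iff] at h
  omega

/-- Gathering over the forest of left ancestors realises `sum_treeEnc_children` at all nodes. -/
theorem feasible_decode {T : BinaryTree Unit} (hT : T.numNodes = N)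
    (hh : 2 ^ T.height ≤ 2 * (L * L)) (ℓ : Fin N ↪ Fin L × Fin L) :
    ∃ f : Bits (Fin N) → Bits (Fin N), Feasible (gridGraph L) True (332 * L) (placeOp ℓ f) ∧
      ∀ s, f (encBits T s) = s := by
  refine ⟨_, (isLevelForest_tree hT true).feasible_gather hh ℓ (card_treeDepth_le hT)
    fun k => treeDepth_lt_height T 0 (mem_Ico_of_fin hT k), fun s => ?_⟩
  funext p
  have h := sum_treeEnc_children T 0 none (extendBits s) (fun p hp => by simp at hp)
    (mem_Ico_of_fin hT p)
  rw [extendBits_val, zero_add, hT, ← Finset.range_eq_Ico, ← Fin.sum_univ_eq_sum_range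
    (fun j => if treePar true T 0 none j = some (p : ℕ) then
      treeEnc T 0 (extendBits s) j else 0)] at h
  rw [← h]
  simp only [encBits]
  congr 1
  refine Finset.sum_congr rfl fun j _ => ?_
  congr

/-- Scattering over the forest of right ancestors solves the recursion `treeEnc_add_prefix` from the
top; prefix parities are the bits of the left spine. -/
theorem feasible_prefix {T : BinaryTree Unit} (hT : T.numNodes = N)
    (hh : 2 ^ T.height ≤ 2 * (L * L)) (ℓ : Fin N ↪ Fin L × Fin L) :
    ∃ f : Bits (Fin N) → Bits (Fin N), Feasible (gridGraph L) True (332 * L) (placeOp ℓ f) ∧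
      ∀ s, f (encBits T s) = encBits (leftSpine N) s := by
  obtain ⟨f, hf, hf'⟩ := (isLevelForest_tree hT false).exists_feasible_scatter hh ℓ
    (card_treeDepth_le hT) fun k => treeDepth_lt_height T 0 (mem_Ico_of_fin hT k)
  refine ⟨f, hf, fun s => ?_⟩
  have hls : ∀ k : Fin N, encBits (leftSpine N) s k =
      ∑ i ∈ Finset.range (k + 1), extendBits s i := by
    intro k
    rw [encBits, treeEnc_leftSpine N 0 _ (by rw [Finset.mem_Ico]; have := k.2; omega),
      Finset.range_eq_Ico]
  have hpre : ∀ k : Fin N, _ := fun k => treeEnc_add_prefix T 0 none (extendBits s) (by simp)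
    (mem_Ico_of_fin hT k)
  refine hf' _ _ (fun k p hp => ?_) fun k hk => ?_
  · rw [hls, hls, ← hpre k, hp]
    rfl
  · rw [hls, ← hpre k]
    rcases treePar_mem false T 0 none (mem_Ico_of_fin hT k) with e | ⟨q, hq, e, -⟩
    · rw [e]
      simp [encBits]
    · rw [Finset.mem_Ico] at hq
      exact absurd e (hk ⟨q, by omega⟩)

/-- The conversion circuit from the encoding of a balanced tree or a left spine. -/
theorem exists_feasible_conversion (hL : 1 ≤ L) {T : BinaryTree Unit} (hT : T.numNodes = N)
    (hbal : IsBalanced T ∨ T = leftSpine N) (ℓ : Fin N ↪ Fin L × Fin L) :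
    ∃ U, Feasible (gridGraph L) True (664 * L) U ∧ U * placeOp ℓ (encBits T) = 1 := by
  -- A reference tree whose height is at most the bit length of `N`. It bounds the height of a
  -- balanced `T` and serves as the intermediate encoding for the left spine.
  obtain ⟨T', hT', hh'⟩ := exists_tree_height_le N.size N (Nat.lt_size_self N)
  have hsize : 2 ^ N.size ≤ 2 * (L * L) :=
    two_pow_size_le (card_le_of_embedding ℓ) (Nat.mul_pos hL hL)
  rcases hbal with hbal | rfl
  · have hh := (hbal T' (hT'.trans hT.symm)).trans hh'
    obtain ⟨f, hf, hf'⟩ := feasible_decode hT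
      ((Nat.pow_le_pow_right (by norm_num) hh).trans hsize) ℓ
    refine ⟨_, hf.mono_depth (by omega), ?_⟩
    rw [← placeOp_mul, ← placeOp_id ℓ]
    exact placeOp_congr hf'
  -- The left spine has `N` levels, too many for passes. The inverse of the prefix circuit leads
  -- from Parity to the encoding of `T'`, which is then decoded.
  · have hh2 := (Nat.pow_le_pow_right (by norm_num) hh').trans hsize
    obtain ⟨f, hf, hf'⟩ := feasible_decode hT' hh2 ℓ
    obtain ⟨g, hg, hg'⟩ := feasible_prefix hT' hh2 ℓ
    refine ⟨_, (hg.conjTranspose.mul hf).mono_depth (by omega), ?_⟩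
    have e1 : placeOp ℓ (encBits (leftSpine N)) = placeOp ℓ g * placeOp ℓ (encBits T') := by
      rw [← placeOp_mul]
      exact placeOp_congr fun s => (hg' s).symm
    rw [e1, mul_assoc, ← mul_assoc (placeOp ℓ g)ᴴ, hg.conjTranspose_mul, one_mul, ← placeOp_mul,
      ← placeOp_id ℓ]
    exact placeOp_congr hf'

end Conversion

/-! ### Majorana operators in the occupation number basis -/

section LeafStrings

/-- Flip the bit at `m`. -/
def flipAt (m : ℕ) (s : ℕ → Fin 2) : ℕ → Fin 2 := fun k => s k + if k = m then 1 else 0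

theorem treeEnc_congr (T : BinaryTree Unit) (o : ℕ) {s s' : ℕ → Fin 2}
    (h : ∀ k ∈ Finset.Ico o (o + T.numNodes), s k = s' k) {j : ℕ}
    (hj : j ∈ Finset.Ico o (o + T.numNodes)) : treeEnc T o s j = treeEnc T o s' j := by
  induction T generalizing o with
  | nil => simp [BinaryTree.numNodes] at hj
  | node u l r ihl ihr =>
    simp only [Finset.mem_Ico, BinaryTree.numNodes] at hj h ihl ihr
    rcases lt_trichotomy j (o + l.numNodes) with h' | h' | h'
    · rw [treeEnc_left _ h', treeEnc_left _ h']
      exact ihl o (fun k hk => h k (by omega)) ⟨hj.1, h'⟩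
    · subst h'
      rw [treeEnc_root, treeEnc_root]
      refine Finset.sum_congr rfl fun k hk => h k ?_
      rw [Finset.mem_Ico] at hk
      omega
    · rw [treeEnc_right _ h', treeEnc_right _ h']
      exact ihr _ (fun k hk => h k (by omega)) (by omega)

theorem treeEnc_flipAt_of_notMem (T : BinaryTree Unit) (o m : ℕ) (s : ℕ → Fin 2)
    (hm : m ∉ Finset.Ico o (o + T.numNodes)) {j : ℕ}
    (hj : j ∈ Finset.Ico o (o + T.numNodes)) :
    treeEnc T o (flipAt m s) j = treeEnc T o s j := by
  refine treeEnc_congr T o (fun k hk => ?_) hj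
  rw [flipAt, if_neg (fun e : k = m => hm (e ▸ hk)), add_zero]

theorem sum_flipAt_of_notMem (S : Finset ℕ) (m : ℕ) (s : ℕ → Fin 2) (hm : m ∉ S) :
    ∑ k ∈ S, flipAt m s k = ∑ k ∈ S, s k :=
  Finset.sum_congr rfl fun k hk => by rw [flipAt, if_neg (fun e : k = m => hm (e ▸ hk)), add_zero]

theorem sum_flipAt_of_mem (S : Finset ℕ) (m : ℕ) (s : ℕ → Fin 2) (hm : m ∈ S) :
    ∑ k ∈ S, flipAt m s k = ∑ k ∈ S, s k + 1 := by
  simp only [flipAt, Finset.sum_add_distrib]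
  rw [Finset.sum_ite_eq' S m, if_pos hm]

/-- The amplitude of the `i`-th Majorana operator on the occupation numbers `s`. -/
def majoranaAmp (o i : ℕ) (s : ℕ → Fin 2) : ℂ :=
  (if i % 2 = 1 then Complex.I else 1) * sgn (∑ k ∈ Finset.Ico o (o + (i + 1) / 2), s k)

/-- The Pauli string `p` acts on the encoded bits as the `i`-th Majorana operator acts on the
occupation numbers; `x` are the flips and `c` the amplitudes of its factors. -/
structure IsMajoranaString (T : BinaryTree Unit) (o i : ℕ) (p : ℕ → Matrix (Fin 2) (Fin 2) ℂ)
    (x : ℕ → Fin 2) (c : ℕ → Fin 2 → ℂ) : Prop where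
  apply_eq : ∀ k a b, p k a b = if a = b + x k then c k b else 0
  x_eq_zero : ∀ k, k ∉ Finset.Ico o (o + T.numNodes) → x k = 0
  c_eq_one : ∀ k, k ∉ Finset.Ico o (o + T.numNodes) → c k = 1
  flip : ∀ s, ∀ j ∈ Finset.Ico o (o + T.numNodes),
    treeEnc T o (flipAt (o + i / 2) s) j = treeEnc T o s j + x j
  amp : ∀ s, ∏ j ∈ Finset.Ico o (o + T.numNodes), c j (treeEnc T o s j) = majoranaAmp o i s

theorem pauliX_apply (a b : Fin 2) : pauliX a b = if a = b + 1 then (1 : Fin 2 → ℂ) b else 0 := by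
  fin_cases a <;> fin_cases b <;> simp [pauliX]

theorem pauliY_apply (a b : Fin 2) : pauliY a b = if a = b + 1 then Complex.I * sgn b else 0 := by
  fin_cases a <;> fin_cases b <;> simp [pauliY, sgn]

theorem pauliZ_apply (a b : Fin 2) : pauliZ a b = if a = b + 0 then sgn b else 0 := by
  fin_cases a <;> fin_cases b <;> simp [pauliZ, sgn]

theorem one_apply_bit (a b : Fin 2) :
    (1 : Matrix (Fin 2) (Fin 2) ℂ) a b = if a = b + 0 then (1 : Fin 2 → ℂ) b else 0 := by
  rw [add_zero, Matrix.one_apply]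
  rfl

theorem prod_Ico_node {M : Type} [CommMonoid M] (o a b : ℕ) (F : ℕ → M) :
    ∏ j ∈ Finset.Ico o (o + (a + b + 1)), F j =
      (∏ j ∈ Finset.Ico o (o + a), F j) * F (o + a) *
        ∏ j ∈ Finset.Ico (o + a + 1) (o + a + 1 + b), F j :=
  sum_Ico_node (M := Additive M) o a b F

theorem update_apply_eq {p : ℕ → Matrix (Fin 2) (Fin 2) ℂ} {x : ℕ → Fin 2} {c : ℕ → Fin 2 → ℂ}
    (h : ∀ k a b, p k a b = if a = b + x k then c k b else 0) (m : ℕ)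
    {P : Matrix (Fin 2) (Fin 2) ℂ} {y : Fin 2} {e : Fin 2 → ℂ}
    (hP : ∀ a b, P a b = if a = b + y then e b else 0) (k : ℕ) (a b : Fin 2) :
    Function.update p m P k a b =
      if a = b + Function.update x m y k then Function.update c m e k b else 0 := by
  by_cases hk : k = m
  · subst hk
    simp only [Function.update_self]
    exact hP a b
  · simp only [Function.update_of_ne hk]
    exact h k a b

theorem length_leafStrings (T : BinaryTree Unit) (o : ℕ) :
    (leafStrings T o).length = 2 * T.numNodes + 1 := by
  induction T generalizing o with
  | nil => rfl
  | node u l r ihl ihr =>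
    simp only [leafStrings, List.length_append, List.length_map, List.length_cons, ihl, ihr,
      BinaryTree.numNodes]
    omega

variable {u : Unit} {l r : BinaryTree Unit} {o i : ℕ} {p : ℕ → Matrix (Fin 2) (Fin 2) ℂ}
  {x : ℕ → Fin 2} {c : ℕ → Fin 2 → ℂ}

/-- `X` has no sign, and the parity at the root does flip: the flipped mode lies in the left subtree
or, for `i = 2 * l.numNodes`, is the root itself. -/
theorem IsMajoranaString.left (h : IsMajoranaString l o i p x c) (hi : i ≤ 2 * l.numNodes) :
    IsMajoranaString (.node u l r) o i (Function.update p (o + l.numNodes) pauliX)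
      (Function.update x (o + l.numNodes) 1) (Function.update c (o + l.numNodes) 1) where
  apply_eq := update_apply_eq h.apply_eq _ pauliX_apply
  x_eq_zero k hk := by
    simp only [Finset.mem_Ico, BinaryTree.numNodes] at hk
    rw [Function.update_of_ne (by omega)]
    exact h.x_eq_zero k (by rw [Finset.mem_Ico]; omega)
  c_eq_one k hk := by
    simp only [Finset.mem_Ico, BinaryTree.numNodes] at hk
    rw [Function.update_of_ne (by omega)]
    exact h.c_eq_one k (by rw [Finset.mem_Ico]; omega)
  flip s j hj := by
    simp only [Finset.mem_Ico, BinaryTree.numNodes] at hj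
    rcases lt_trichotomy j (o + l.numNodes) with h' | h' | h'
    · rw [treeEnc_left _ h', treeEnc_left _ h', Function.update_of_ne h'.ne]
      exact h.flip s j (Finset.mem_Ico.2 ⟨hj.1, h'⟩)
    · subst h'
      rw [treeEnc_root, treeEnc_root, Function.update_self, sum_flipAt_of_mem]
      rw [Finset.mem_Ico]
      omega
    · rw [treeEnc_right _ h', treeEnc_right _ h', Function.update_of_ne h'.ne',
        h.x_eq_zero j (by rw [Finset.mem_Ico]; omega), add_zero, treeEnc_flipAt_of_notMem] <;>
      · rw [Finset.mem_Ico]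
        omega
  amp s := by
    rw [BinaryTree.numNodes, prod_Ico_node, Function.update_self, Finset.prod_congr rfl
      (g := fun j => c j (treeEnc l o s j)), h.amp, Finset.prod_eq_one, Pi.one_apply, mul_one,
      mul_one]
    · intro j hj
      rw [Finset.mem_Ico] at hj
      rw [Function.update_of_ne (by omega), h.c_eq_one j (by rw [Finset.mem_Ico]; omega),
        Pi.one_apply]
    · intro j hj
      rw [Finset.mem_Ico] at hj
      rw [Function.update_of_ne (by omega), treeEnc_left _ hj.2]

/-- The root stores the parity up to and including its own mode, so `Y` supplies the full sign of an
odd Majorana operator. -/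
theorem isMajoranaString_middle :
    IsMajoranaString (.node u l r) o (2 * l.numNodes + 1)
      (Function.update (fun _ => 1) (o + l.numNodes) pauliY)
      (Function.update (fun _ => 0) (o + l.numNodes) 1)
      (Function.update (fun _ => 1) (o + l.numNodes) fun b => Complex.I * sgn b) where
  apply_eq := update_apply_eq (fun _ => one_apply_bit) _ pauliY_apply
  x_eq_zero k hk := by
    simp only [Finset.mem_Ico, BinaryTree.numNodes] at hk
    rw [Function.update_of_ne (by omega)]
  c_eq_one k hk := by
    simp only [Finset.mem_Ico, BinaryTree.numNodes] at hk
    rw [Function.update_of_ne (by omega)]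
  flip s j hj := by
    simp only [Finset.mem_Ico, BinaryTree.numNodes] at hj
    rcases lt_trichotomy j (o + l.numNodes) with h' | h' | h'
    · rw [treeEnc_left _ h', treeEnc_left _ h', Function.update_of_ne h'.ne, add_zero,
        treeEnc_flipAt_of_notMem] <;>
      · rw [Finset.mem_Ico]
        omega
    · subst h'
      rw [treeEnc_root, treeEnc_root, Function.update_self, sum_flipAt_of_mem]
      rw [Finset.mem_Ico]
      omega
    · rw [treeEnc_right _ h', treeEnc_right _ h', Function.update_of_ne h'.ne', add_zero,
        treeEnc_flipAt_of_notMem] <;>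
      · rw [Finset.mem_Ico]
        omega
  amp s := by
    rw [BinaryTree.numNodes, prod_Ico_node, Function.update_self, Finset.prod_eq_one,
      Finset.prod_eq_one, one_mul, mul_one, treeEnc_root, majoranaAmp, if_pos (by omega)]
    · congr 4
      omega
    · intro j hj
      rw [Finset.mem_Ico] at hj
      rw [Function.update_of_ne (by omega), Pi.one_apply]
    · intro j hj
      rw [Finset.mem_Ico] at hj
      rw [Function.update_of_ne (by omega), Pi.one_apply]

/-- `Z` reads the parity of the left subtree and the root, which is the part of the Jordan–Wigner
string in front of the right subtree. -/
theorem IsMajoranaString.right (h : IsMajoranaString r (o + l.numNodes + 1) i p x c) :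
    IsMajoranaString (.node u l r) o (2 * l.numNodes + 2 + i)
      (Function.update p (o + l.numNodes) pauliZ)
      (Function.update x (o + l.numNodes) 0) (Function.update c (o + l.numNodes) sgn) where
  apply_eq := update_apply_eq h.apply_eq _ pauliZ_apply
  x_eq_zero k hk := by
    simp only [Finset.mem_Ico, BinaryTree.numNodes] at hk
    rw [Function.update_of_ne (by omega)]
    exact h.x_eq_zero k (by rw [Finset.mem_Ico]; omega)
  c_eq_one k hk := by
    simp only [Finset.mem_Ico, BinaryTree.numNodes] at hk
    rw [Function.update_of_ne (by omega)]
    exact h.c_eq_one k (by rw [Finset.mem_Ico]; omega)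
  flip s j hj := by
    simp only [Finset.mem_Ico, BinaryTree.numNodes] at hj
    have e : o + (2 * l.numNodes + 2 + i) / 2 = o + l.numNodes + 1 + i / 2 := by omega
    rw [e]
    rcases lt_trichotomy j (o + l.numNodes) with h' | h' | h'
    · rw [treeEnc_left _ h', treeEnc_left _ h', Function.update_of_ne h'.ne,
        h.x_eq_zero j (by rw [Finset.mem_Ico]; omega), add_zero, treeEnc_flipAt_of_notMem] <;>
      · rw [Finset.mem_Ico]
        omega
    · subst h'
      rw [treeEnc_root, treeEnc_root, Function.update_self, sum_flipAt_of_notMem, add_zero]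
      rw [Finset.mem_Ico]
      omega
    · rw [treeEnc_right _ h', treeEnc_right _ h', Function.update_of_ne h'.ne']
      exact h.flip s j (by rw [Finset.mem_Ico]; omega)
  amp s := by
    rw [BinaryTree.numNodes, prod_Ico_node, Function.update_self, Finset.prod_eq_one,
      Finset.prod_congr rfl (s₁ := Finset.Ico (o + l.numNodes + 1) _)
      (g := fun j => c j (treeEnc r (o + l.numNodes + 1) s j)), h.amp, one_mul, treeEnc_root]
    · unfold majoranaAmp
      have e1 : (2 * l.numNodes + 2 + i) % 2 = i % 2 := by omega
      have e2 : o + (2 * l.numNodes + 2 + i + 1) / 2 = o + l.numNodes + 1 + (i + 1) / 2 := by omega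
      rw [e1, e2, ← Finset.sum_Ico_consecutive s (m := o) (n := o + l.numNodes + 1)
        (k := o + l.numNodes + 1 + (i + 1) / 2) (by omega) (by omega), sgn_add]
      ring
    · intro j hj
      rw [Finset.mem_Ico] at hj
      rw [Function.update_of_ne (by omega), treeEnc_right _ (by omega)]
    · intro j hj
      rw [Finset.mem_Ico] at hj
      rw [Function.update_of_ne (by omega), h.c_eq_one j (by rw [Finset.mem_Ico]; omega),
        Pi.one_apply]

/-- The last string `i = 2 * T.numNodes`, unused at top level, is needed in the induction: at the
end of a left subtree it becomes the even Majorana operator of the root. -/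
theorem exists_isMajoranaString (T : BinaryTree Unit) (o i : ℕ) (hi : i ≤ 2 * T.numNodes) :
    ∃ x c, IsMajoranaString T o i ((leafStrings T o).getD i fun _ => 1) x c := by
  induction T generalizing o i with
  | nil =>
    have hi0 : i = 0 := by simpa [BinaryTree.numNodes] using hi
    subst hi0
    refine ⟨fun _ => 0, fun _ => 1, fun _ => one_apply_bit, fun _ _ => rfl, fun _ _ => rfl, ?_, ?_⟩
    · intro s j hj
      simp [BinaryTree.numNodes] at hj
    · intro s
      simp [BinaryTree.numNodes, majoranaAmp, sgn_zero]
  | node u l r ihl ihr =>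
    simp only [BinaryTree.numNodes] at hi
    rcases lt_trichotomy i (2 * l.numNodes + 1) with h | h | h
    · obtain ⟨x, c, hxc⟩ := ihl o i (by omega)
      refine ⟨Function.update x (o + l.numNodes) 1, Function.update c (o + l.numNodes) 1, ?_⟩
      rw [leafStrings, List.getD_append _ _ _ _ (by rw [List.length_map, length_leafStrings]; omega)]
      -- The mapped function does not fix the default string, so the entry is taken at an index
      -- known to be in range.
      rw [List.getD_eq_getElem _ _ (by rw [length_leafStrings]; omega)] at hxc
      rw [List.getD_eq_getElem _ _ (by rw [List.length_map, length_leafStrings]; omega),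
        List.getElem_map]
      exact hxc.left (by omega)
    · refine ⟨Function.update (fun _ => 0) (o + l.numNodes) 1,
        Function.update (fun _ => 1) (o + l.numNodes) fun b => Complex.I * sgn b, ?_⟩
      rw [leafStrings, List.getD_append_right _ _ _ _
        (by rw [List.length_map, length_leafStrings]; omega), List.length_map, length_leafStrings,
        h, Nat.sub_self, List.getD_cons_zero]
      exact isMajoranaString_middle
    · obtain ⟨k, rfl⟩ : ∃ k, i = 2 * l.numNodes + 2 + k := ⟨i - (2 * l.numNodes + 2), by omega⟩
      obtain ⟨x, c, hxc⟩ := ihr (o + l.numNodes + 1) k (by omega)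
      refine ⟨Function.update x (o + l.numNodes) 0, Function.update c (o + l.numNodes) sgn, ?_⟩
      rw [leafStrings, List.getD_append_right _ _ _ _
        (by rw [List.length_map, length_leafStrings]; omega), List.length_map, length_leafStrings,
        show 2 * l.numNodes + 2 + k - (2 * l.numNodes + 1) = k + 1 by omega, List.getD_cons_succ]
      rw [List.getD_eq_getElem _ _ (by rw [length_leafStrings]; omega)] at hxc
      rw [List.getD_eq_getElem _ _ (by rw [List.length_map, length_leafStrings]; omega),
        List.getElem_map]
      exact hxc.right

end LeafStrings

/-! ### Majorana operators as signed bit flips -/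

section Majoranas

variable {V : Type} [Fintype V] [DecidableEq V] {N : ℕ}

/-- Flip the bit at the vertex `w`. -/
def flipBit (w : V) (t : Bits V) : Bits V := Function.update t w (t w + 1)

/-- The Majorana operator `2 * j + α` of the Jordan–Wigner encoding. -/
def jwOp (ℓ : Fin N ↪ V) (j : Fin N) (α : Fin 2) : Operator V :=
  (if α = 1 then Complex.I else 1) •
    mono (flipBit (ℓ j)) fun t => ∑ m ∈ Finset.range (j + α), extendBits (t ∘ ℓ) m

theorem tensorOp_extend_apply (ℓ : Fin N ↪ V) (p : Fin N → Matrix (Fin 2) (Fin 2) ℂ)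
    (x : Fin N → Fin 2) (c : Fin N → Fin 2 → ℂ)
    (h : ∀ k a b, p k a b = if a = b + x k then c k b else 0) (s t : Bits V) :
    tensorOp (Function.extend ℓ p fun _ => 1) s t =
      if s = placeAct ℓ (fun b k => b k + x k) t then ∏ k, c k (t (ℓ k)) else 0 := by
  change ∏ v, Function.extend ℓ p (fun _ => 1) v (s v) (t v) = _
  by_cases hs : s = placeAct ℓ (fun b k => b k + x k) t
  · rw [if_pos hs]
    refine (Fintype.prod_of_injective ℓ ℓ.injective _ _ (fun v hv => ?_) fun k => ?_).symm
    · rw [Function.extend_apply' _ _ _ hv, hs, placeAct_of_notMem _ _ _ hv, Matrix.one_apply_eq]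
    · rw [ℓ.injective.extend_apply, h, if_pos]
      rw [hs, placeAct_apply]
      rfl
  · rw [if_neg hs]
    have : ∃ v, s v ≠ placeAct ℓ (fun b k => b k + x k) t v := by
      by_contra! hall
      exact hs (funext hall)
    obtain ⟨v, hv⟩ := this
    refine Finset.prod_eq_zero (Finset.mem_univ v) ?_
    by_cases hr : v ∈ Set.range ℓ
    · obtain ⟨k, rfl⟩ := hr
      rw [placeAct_apply] at hv
      rw [ℓ.injective.extend_apply, h]
      exact if_neg hv
    · rw [placeAct_of_notMem _ _ _ hr] at hv
      rw [Function.extend_apply' _ _ _ hr, Matrix.one_apply_ne hv]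

theorem flipBit_comp (ℓ : Fin N ↪ V) (j : Fin N) (t : Bits V) :
    flipBit (ℓ j) t ∘ ℓ = flipBit j (t ∘ ℓ) := by
  funext k
  by_cases hk : k = j
  · subst hk
    simp [flipBit]
  · have : ℓ k ≠ ℓ j := fun e => hk (ℓ.injective e)
    simp [flipBit, hk, this]

theorem extendBits_flipBit (j : Fin N) (b : Bits (Fin N)) :
    extendBits (flipBit j b) = flipAt j (extendBits b) := by
  funext k
  unfold extendBits flipAt flipBit
  by_cases hk : k < N
  · simp only [dif_pos hk]
    by_cases hkj : k = j
    · subst hkj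
      simp
    · have : (⟨k, hk⟩ : Fin N) ≠ j := fun e => hkj (by rw [← e])
      simp [this, hkj]
  · have : k ≠ j := fun e => hk (e ▸ j.2)
    simp [hk, this]

/-- The encoding map intertwines the Jordan–Wigner encoding with the encoding of shape `T`. -/
theorem semiconjBy_encBits {T : BinaryTree Unit} (hT : T.numNodes = N) (ℓ : Fin N ↪ V)
    (j : Fin N) (α : Fin 2) :
    SemiconjBy (placeOp ℓ (encBits T)) (jwOp ℓ j α) (majorana T ℓ (2 * (j : ℕ) + α)) := by
  have hj := j.2
  have hα := α.2
  obtain ⟨x, c, h⟩ := exists_isMajoranaString T 0 (2 * j + α) (by omega)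
  have hi : 0 + (2 * (j : ℕ) + α) / 2 = j := by omega
  change placeOp ℓ (encBits T) * jwOp ℓ j α = majorana T ℓ (2 * (j : ℕ) + α) * placeOp ℓ (encBits T)
  ext s t
  unfold jwOp placeOp
  rw [mono_mul_apply, Matrix.mul_smul, Matrix.smul_apply, mono_mul, mono_apply, majorana,
    tensorOp_extend_apply ℓ _ (fun k => x k) (fun k => c k) (fun k => h.apply_eq k)]
  simp only [Pi.zero_apply, sgn_zero, mul_one, add_zero]
  -- In each column, `hflip` locates the nonzero entry of both sides and `hamp` compares its value.
  have hflip : placeAct ℓ (fun b k => b k + x k) (placeAct ℓ (encBits T) t) =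
      placeAct ℓ (encBits T) (flipBit (ℓ j) t) := by
    refine bits_ext_place ℓ (fun k => ?_) fun v hv => ?_
    · rw [placeAct_apply, placeAct_apply, placeAct_comp_place, flipBit_comp]
      simp only [encBits]
      rw [extendBits_flipBit]
      have := h.flip (extendBits (t ∘ ℓ)) k (mem_Ico_of_fin hT k)
      rw [hi] at this
      exact this.symm
    · rw [placeAct_of_notMem _ _ _ hv, placeAct_of_notMem _ _ _ hv, placeAct_of_notMem _ _ _ hv]
      exact (Function.update_of_ne (fun e => hv ⟨j, e.symm⟩) _ _).symm
  rw [hflip]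
  have hamp : ∏ k : Fin N, c k (placeAct ℓ (encBits T) t (ℓ k)) =
      (if α = 1 then Complex.I else 1) *
        sgn (∑ m ∈ Finset.range (j + α), extendBits (t ∘ ℓ) m) := by
    have h1 := h.amp (extendBits (t ∘ ℓ))
    rw [zero_add, hT, ← Finset.range_eq_Ico, ← Fin.prod_univ_eq_prod_range
      (fun k => c k (treeEnc T 0 (extendBits (t ∘ ℓ)) k)), majoranaAmp, zero_add] at h1
    rw [Finset.prod_congr rfl fun k _ => by rw [placeAct_apply]]
    refine h1.trans ?_
    rw [← Finset.range_eq_Ico, show (2 * (j : ℕ) + α + 1) / 2 = j + α by omega]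
    congr 1
    have : (2 * (j : ℕ) + α) % 2 = 1 ↔ α = 1 := by
      rw [Fin.ext_iff]
      simp
      omega
    simp only [this]
  rw [hamp]
  simp only [Function.comp_apply, smul_eq_mul, mul_ite, mul_zero]

theorem encBits_rightSpine (s : Bits (Fin N)) : encBits (rightSpine N) s = s := by
  funext k
  rw [encBits, treeEnc_rightSpine N 0 _ (by rw [Finset.mem_Ico]; have := k.2; omega),
    extendBits_val]

theorem majorana_rightSpine (ℓ : Fin N ↪ V) (j : Fin N) (α : Fin 2) :
    majorana (rightSpine N) ℓ (2 * (j : ℕ) + α) = jwOp ℓ j α := by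
  have h := semiconjBy_encBits (numNodes_rightSpine N) ℓ j α
  have e : placeOp ℓ (encBits (rightSpine N)) = 1 := by
    rw [← placeOp_id ℓ]
    exact placeOp_congr encBits_rightSpine
  rw [e] at h
  simpa [SemiconjBy] using h.symm

/-- Moving the qubits moves the Majorana operators. -/
theorem semiconjBy_qubitPermOp_jwOp (ρ : Equiv.Perm V) (ℓ : Fin N ↪ V) (j : Fin N) (α : Fin 2) :
    SemiconjBy (qubitPermOp ρ) (jwOp ℓ j α) (jwOp (ℓ.trans ρ.toEmbedding) j α) := by
  rw [SemiconjBy, qubitPermOp_eq_mono]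
  unfold jwOp
  rw [Matrix.mul_smul, Matrix.smul_mul, mono_mul, mono_mul]
  congr 1
  refine mono_congr (fun t => ?_) fun t => ?_
  · funext v
    simp only [Function.comp_apply, flipBit, Function.update_apply, Function.Embedding.trans_apply,
      Equiv.coe_toEmbedding, Equiv.symm_apply_apply, Equiv.symm_apply_eq]
  · have : (t ∘ ρ.symm) ∘ (ℓ.trans ρ.toEmbedding) = t ∘ ℓ := by
      funext k
      simp
    rw [this]
    simp

theorem semiconjBy_qubitPermOp_X (ρ : Equiv.Perm V) (v : V) :
    SemiconjBy (qubitPermOp ρ) (onQubit v pauliX) (onQubit (ρ v) pauliX) := by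
  rw [SemiconjBy, qubitPermOp_eq_mono, onQubit_pauliX_eq_mono, onQubit_pauliX_eq_mono, mono_mul,
    mono_mul]
  refine mono_congr (fun t => ?_) fun t => rfl
  funext w
  simp only [Function.comp_apply, Function.update_apply, Equiv.symm_apply_apply,
    Equiv.symm_apply_eq]

theorem semiconjBy_qubitPermOp_Z (ρ : Equiv.Perm V) (v : V) :
    SemiconjBy (qubitPermOp ρ) (onQubit v pauliZ) (onQubit (ρ v) pauliZ) := by
  rw [SemiconjBy, qubitPermOp_eq_mono, onQubit_pauliZ_eq_mono, onQubit_pauliZ_eq_mono, mono_mul,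
    mono_mul]
  exact mono_congr (fun t => rfl) fun t => by simp

theorem isTrivialOff_placeOp (ℓ : Fin N ↪ V) (f : Bits (Fin N) → Bits (Fin N)) :
    IsTrivialOff ℓ (placeOp ℓ f) := by
  intro v hv
  rw [onQubit_pauliX_eq_mono, onQubit_pauliZ_eq_mono, placeOp, commute_iff_eq, commute_iff_eq,
    mono_mul, mono_mul, mono_mul, mono_mul]
  have hne : ∀ k, ℓ k ≠ v := fun k e => hv ⟨k, e⟩
  constructor
  · refine mono_congr (fun t => ?_) fun t => rfl
    have hcomp : Function.update t v (t v + 1) ∘ ℓ = t ∘ ℓ := by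
      funext k
      simp [hne]
    refine bits_ext_place ℓ (fun k => ?_) fun w hw => ?_
    · simp only [Function.comp_apply]
      rw [Function.update_of_ne (hne k), placeAct_apply, placeAct_apply, hcomp]
    · simp only [Function.comp_apply]
      rw [placeAct_of_notMem _ _ _ hw, Function.update_apply, Function.update_apply,
        placeAct_of_notMem _ _ _ hw, placeAct_of_notMem _ _ _ hv]
  · refine mono_congr (fun t => rfl) fun t => ?_
    rw [placeAct_of_notMem _ _ _ hv]
    simp

end Majoranas

/-! ### Fermionic permutations in the Jordan–Wigner encoding -/

section FermionicPerm

variable {V : Type} [Fintype V] [DecidableEq V] {N : ℕ}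

/-- The parity of the bits below `w` in the order of the key `k`. -/
def parityBelow (k : V → ℕ) (w : V) (t : Bits V) : Fin 2 := ∑ v, if k v < k w then t v else 0

theorem parityBelow_comp (k : V → ℕ) (π : Equiv.Perm V) (w : V) (t : Bits V) :
    parityBelow (k ∘ π) w t = parityBelow k (π w) (t ∘ π.symm) := by
  unfold parityBelow
  rw [← Equiv.sum_comp π fun v => if k v < k (π w) then (t ∘ π.symm) v else 0]
  simp

/-- The phase is a quadratic form. Flipping `w` toggles its pairs with occupied `v` on which the
orders disagree, and these are the `v` below `w` in exactly one order. -/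
theorem crossPhase_flipBit {k k' : V → ℕ} (hk : Function.Injective k)
    (hk' : Function.Injective k') (w : V) (t : Bits V) :
    crossPhase k k' (flipBit w t) =
      crossPhase k k' t + (parityBelow k w t + parityBelow k' w t) := by
  have hδ : ∀ v, flipBit w t v = t v + if v = w then 1 else 0 := by
    intro v
    by_cases hv : v = w
    · subst hv; simp [flipBit]
    · simp [flipBit, hv]
  have hsplit : ∀ p : V × V,
      (if k p.1 < k p.2 ∧ k' p.2 < k' p.1 then flipBit w t p.1 * flipBit w t p.2 else 0) =
        (if k p.1 < k p.2 ∧ k' p.2 < k' p.1 then t p.1 * t p.2 else 0) +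
        ((if p.1 = w then (if k w < k p.2 ∧ k' p.2 < k' w then t p.2 else 0) else 0) +
          if p.2 = w then (if k p.1 < k w ∧ k' w < k' p.1 then t p.1 else 0) else 0) := by
    rintro ⟨u, v⟩
    simp only [hδ]
    by_cases hu : u = w <;> by_cases hv : v = w
    · subst hu; subst hv; simp
    · subst hu
      simp only [hv, if_true, if_false, add_zero]
      split_ifs <;> ring
    · subst hv
      simp only [hu, if_true, if_false, add_zero]
      split_ifs <;> ring
    · simp [hu, hv]
  unfold crossPhase parityBelow
  rw [Finset.sum_congr rfl fun p _ => hsplit p, Finset.sum_add_distrib, Finset.sum_add_distrib]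
  congr 1
  rw [Fintype.sum_prod_type_right, Fintype.sum_prod_type]
  simp only [Finset.sum_ite_eq', Finset.mem_univ, if_true]
  rw [← Finset.sum_add_distrib, ← Finset.sum_add_distrib]
  refine Finset.sum_congr rfl fun v _ => ?_
  by_cases hv : v = w
  · subst hv; simp
  · have h1 := hk.ne hv
    have h2 := hk'.ne hv
    rcases h1.lt_or_gt with h1 | h1 <;> rcases h2.lt_or_gt with h2 | h2 <;>
      simp [h1, h2, h1.le.not_gt, h2.le.not_gt, bit_add_self]

/-- The labelled vertices occupy the keys `0` to `N - 1`, so no unlabelled vertex enters a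
Jordan–Wigner string. -/
theorem sum_range_extendBits {k : V → ℕ} (hk : Function.Injective k) {ℓ : Fin N ↪ V}
    (hℓ : ∀ i, k (ℓ i) = i) (j : Fin N) (t : Bits V) :
    ∑ m ∈ Finset.range j, extendBits (t ∘ ℓ) m = parityBelow k (ℓ j) t := by
  have h1 : ∑ m ∈ Finset.range j, extendBits (t ∘ ℓ) m =
      ∑ m : Fin N, if (m : ℕ) < j then t (ℓ m) else 0 := by
    have e : ∀ m : Fin N, (if (m : ℕ) < j then t (ℓ m) else 0) =
        (fun m : ℕ => if m < j then extendBits (t ∘ ℓ) m else 0) m := by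
      intro m
      simp only [extendBits_val]
      rfl
    rw [Finset.sum_congr rfl fun m _ => e m, Fin.sum_univ_eq_sum_range
      (fun m : ℕ => if m < j then extendBits (t ∘ ℓ) m else 0), ← Finset.sum_filter]
    congr 1
    ext m
    have := j.2
    simp only [Finset.mem_range, Finset.mem_filter]
    omega
  rw [h1, parityBelow]
  refine Fintype.sum_of_injective ℓ ℓ.injective _ _ (fun v hv => if_neg fun h => ?_) fun m => ?_
  · rw [hℓ] at h
    have := j.2
    exact hv ⟨⟨k v, by omega⟩, hk (by rw [hℓ])⟩
  · rw [hℓ, hℓ]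

/-- A flip changes the inversion sign by the parities below the mode in the old and the new order,
which are the Jordan–Wigner strings before and after the permutation. -/
theorem semiconjBy_fermPerm_jwOp {k : V → ℕ} (hk : Function.Injective k) {ℓ : Fin N ↪ V}
    (hℓ : ∀ i, k (ℓ i) = i) (π : Equiv.Perm (Fin N)) (j : Fin N) (α : Fin 2) :
    SemiconjBy (fermPerm k (π.viaEmbedding ℓ)) (jwOp ℓ j α) (jwOp ℓ (π j) α) := by
  set σ := π.viaEmbedding ℓ with hσ
  have hσj : σ (ℓ j) = ℓ (π j) := Equiv.Perm.viaEmbedding_apply π ℓ j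
  rw [SemiconjBy]
  unfold jwOp fermPerm
  rw [Matrix.mul_smul, Matrix.smul_mul, mono_mul, mono_mul]
  congr 1
  refine mono_congr (fun t => ?_) fun t => ?_
  · funext v
    simp only [Function.comp_apply, flipBit, Function.update_apply, Equiv.symm_apply_eq, hσj]
    rw [← hσj, Equiv.symm_apply_apply]
  · have key : ∀ (i : Fin N) (s : Bits V), ∑ m ∈ Finset.range (i + α), extendBits (s ∘ ℓ) m =
        parityBelow k (ℓ i) s + (if α = 1 then s (ℓ i) else 0) := by
      intro i s
      rcases bit_cases α with rfl | rfl
      · simp [sum_range_extendBits hk hℓ]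
      · rw [Fin.val_one, Finset.sum_range_succ, sum_range_extendBits hk hℓ, extendBits_val]
        simp
    rw [key, key, crossPhase_flipBit hk (hk.comp σ.injective), parityBelow_comp, hσj]
    have e : (t ∘ σ.symm) (ℓ (π j)) = t (ℓ j) := by
      rw [← hσj]; simp
    rw [e]
    generalize parityBelow k (ℓ j) t = a
    generalize parityBelow k (ℓ (π j)) (t ∘ σ.symm) = b
    generalize crossPhase k (k ∘ σ) t = c
    generalize (if α = 1 then t (ℓ j) else 0) = d
    revert a b c d
    decide

/-- An unlabelled vertex is fixed and lies after all labelled ones in the order, so its bit takes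
part in no inversion with them. -/
theorem isTrivialOff_fermPerm {k : V → ℕ} (hk : Function.Injective k) {ℓ : Fin N ↪ V}
    (hℓ : ∀ i, k (ℓ i) = i) (π : Equiv.Perm (Fin N)) :
    IsTrivialOff ℓ (fermPerm k (π.viaEmbedding ℓ)) := by
  intro v hv
  set σ := π.viaEmbedding ℓ with hσ
  have hσv : ∀ w, w ∉ Set.range ℓ → σ w = w := fun w hw =>
    Equiv.Perm.viaEmbedding_apply_of_notMem π ℓ w hw
  have hsv : σ.symm v = v := by rw [Equiv.symm_apply_eq, hσv v hv]
  rw [onQubit_pauliX_eq_mono, onQubit_pauliZ_eq_mono, fermPerm, commute_iff_eq, commute_iff_eq,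
    mono_mul, mono_mul, mono_mul, mono_mul]
  constructor
  · refine mono_congr (fun t => ?_) fun t => ?_
    · funext w
      have : σ.symm w = v ↔ w = v := by rw [Equiv.symm_apply_eq, hσv v hv]
      simp only [Function.comp_apply, Function.update_apply, this, hsv]
    · have hb : parityBelow (k ∘ σ) v t = parityBelow k v t := by
        unfold parityBelow
        refine Finset.sum_congr rfl fun u _ => ?_
        have hkv : N ≤ k v := by
          by_contra! h
          exact hv ⟨⟨k v, h⟩, hk (by rw [hℓ])⟩
        simp only [Function.comp_apply, hσv v hv]
        by_cases hu : u ∈ Set.range ℓ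
        · obtain ⟨i, rfl⟩ := hu
          have h1 : σ (ℓ i) = ℓ (π i) := Equiv.Perm.viaEmbedding_apply π ℓ i
          have h2 := i.2
          have h3 := (π i).2
          rw [h1, hℓ, hℓ, if_pos (by omega), if_pos (by omega)]
        · rw [hσv u hu]
      have := crossPhase_flipBit hk (hk.comp σ.injective) v t
      rw [hb, bit_add_self, add_zero] at this
      simp only [Pi.zero_apply, zero_add, add_zero]
      exact this
  · refine mono_congr (fun t => rfl) fun t => ?_
    simp only [Function.comp_apply, id, hsv, add_comm]

end FermionicPerm

/-! ### Assembly -/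

section Assembly

theorem semiconjBy_of_inverse {M : Type} [Monoid M] {E U x y : M} (h : SemiconjBy E x y)
    (h1 : U * E = 1) (h2 : E * U = 1) : SemiconjBy U y x := by
  calc U * y = U * (y * E) * U := by rw [mul_assoc, mul_assoc, h2, mul_one]
    _ = x * U := by rw [← h.eq, ← mul_assoc, h1, one_mul]

variable {V : Type} [Fintype V] [DecidableEq V] {G : SimpleGraph V} {N : ℕ}

theorem Circuit.semiconjBy_reverse (c : Circuit G) {x y : Operator V}
    (h : SemiconjBy (Circuit.op c) x y) : SemiconjBy (Circuit.op c.reverse) y x := by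
  rw [Circuit.op_reverse]
  exact semiconjBy_of_inverse h c.conjTranspose_mul_op c.op_mul_conjTranspose

theorem Circuit.conj_eq (c : Circuit G) {x y : Operator V} (h : SemiconjBy (Circuit.op c) x y) :
    Circuit.op c * x * (Circuit.op c)ᴴ = y := by
  rw [h.eq, mul_assoc, c.op_mul_conjTranspose, mul_one]

/-- The way back starts from the image under `J`, so `A` and `R` have to be controlled on the
operators of both `j` and `π j`. -/
theorem Circuit.semiconjBy_sandwich {A R J : Circuit G} {a b c c' b' a' : Operator V}
    (hA : SemiconjBy (Circuit.op A) a b) (hR : SemiconjBy (Circuit.op R) b c)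
    (hJ : SemiconjBy (Circuit.op J) c c') (hR' : SemiconjBy (Circuit.op R) b' c')
    (hA' : SemiconjBy (Circuit.op A) a' b') :
    SemiconjBy (Circuit.op (A ++ R ++ J ++ R.reverse ++ A.reverse)) a a' := by
  rw [Circuit.op_append, Circuit.op_append, Circuit.op_append, Circuit.op_append]
  exact (A.semiconjBy_reverse hA').mul_left
    ((R.semiconjBy_reverse hR').mul_left (hJ.mul_left (hR.mul_left hA)))

theorem exists_snake_placement {L : ℕ} (ℓ : Fin N ↪ Fin L × Fin L) :
    ∃ ρ : Equiv.Perm (Fin L × Fin L), ∀ i, snakeIndex (ρ (ℓ i)) = i := by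
  have hN := card_le_of_embedding ℓ
  have : ∀ i : Fin N, ∃ v : Fin L × Fin L, snakeIndex v = i := fun i =>
    exists_snakeIndex_eq (by have := i.2; omega)
  choose g hg using this
  have hinj : Function.Injective g := fun i j h => Fin.ext (by rw [← hg, ← hg, h])
  obtain ⟨ρ, hρ⟩ := exists_perm_comp_eq ℓ.injective hinj
  exact ⟨ρ, fun i => by rw [hρ, hg]⟩

/-- The circuit for grids of positive side. -/
theorem exists_fermionicPerm_circuit {L : ℕ} (hL : 1 ≤ L) {T : BinaryTree Unit}
    (hT : T.numNodes = N) (hbal : IsBalanced T ∨ T = leftSpine N) (ℓ : Fin N ↪ Fin L × Fin L)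
    (π : Equiv.Perm (Fin N)) :
    ∃ (A R J : Circuit (gridGraph L)) (ρ : Equiv.Perm (Fin L × Fin L)),
      A.IsCNOTOnly ∧
      ConvertsEncoding T (rightSpine N) ℓ (Circuit.op A) ∧
      (∀ i : Fin N, snakeIndex (ρ (ℓ i)) = i) ∧
      Circuit.op R = qubitPermOp ρ ∧
      ImplementsFermionicPerm (rightSpine N) (ℓ.trans ρ.toEmbedding) π (Circuit.op J) ∧
      ImplementsFermionicPerm T ℓ π
        (Circuit.op (A ++ R ++ J ++ R.reverse ++ A.reverse)) ∧
      Circuit.depth (A ++ R ++ J ++ R.reverse ++ A.reverse) ≤ 1600 * L := by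
  obtain ⟨ρ, hρ⟩ := exists_snake_placement ℓ
  obtain ⟨U, ⟨A, hA1, hA2, rfl⟩, hU⟩ := exists_feasible_conversion hL hT hbal ℓ
  obtain ⟨R, -, hR2, hR3⟩ := (swapDepth_gridGraph ρ).feasible False
  set ℓ' := ℓ.trans ρ.toEmbedding with hℓ'
  have hsn : ∀ i, snakeIndex (ℓ' i) = i := hρ
  obtain ⟨J, -, hJ2, hJ3⟩ := feasible_fermPerm_snake (π.viaEmbedding ℓ')
  -- `A` is a left inverse of the encoding operator, and for square matrices a two-sided one, so
  -- every intertwining relation can be reversed.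
  have hAE : ∀ {x y}, SemiconjBy (placeOp ℓ (encBits T)) x y →
      SemiconjBy (Circuit.op A) y x := fun h =>
    semiconjBy_of_inverse h hU (mul_eq_one_comm.1 hU)
  have hAoff : IsTrivialOff ℓ (Circuit.op A) := fun v hv =>
    ⟨hAE (isTrivialOff_placeOp ℓ _ v hv).1, hAE (isTrivialOff_placeOp ℓ _ v hv).2⟩
  have hAmaj : ∀ (j : Fin N) (α : Fin 2), SemiconjBy (Circuit.op A)
      (majorana T ℓ (2 * (j : ℕ) + α)) (jwOp ℓ j α) := fun j α => hAE (semiconjBy_encBits hT ℓ j α)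
  have hJmaj : ∀ j α, SemiconjBy (Circuit.op J) (jwOp ℓ' j α) (jwOp ℓ' (π j) α) := fun j α => by
    rw [hJ3]
    exact semiconjBy_fermPerm_jwOp snakeIndex_injective hsn π j α
  have hJoff : IsTrivialOff ℓ' (Circuit.op J) := by
    rw [hJ3]
    exact isTrivialOff_fermPerm snakeIndex_injective hsn π
  have hRmaj : ∀ j α, SemiconjBy (Circuit.op R) (jwOp ℓ j α) (jwOp ℓ' j α) := fun j α => by
    rw [hR3]
    exact semiconjBy_qubitPermOp_jwOp ρ ℓ j α
  refine ⟨A, R, J, ρ, hA1 trivial, ⟨fun i hi => ?_, hAoff⟩, hρ, hR3, ⟨fun j α => ?_, hJoff⟩,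
    ⟨fun j α => ?_, fun v hv => ?_⟩, ?_⟩
  · have h := A.conj_eq (hAmaj ⟨i / 2, by omega⟩ ⟨i % 2, by omega⟩)
    rw [← majorana_rightSpine] at h
    simpa only [Nat.div_add_mod] using h
  · rw [majorana_rightSpine, majorana_rightSpine]
    exact J.conj_eq (hJmaj j α)
  · exact Circuit.conj_eq _ (Circuit.semiconjBy_sandwich (hAmaj j α) (hRmaj j α) (hJmaj j α)
      (hRmaj (π j) α) (hAmaj (π j) α))
  -- A Pauli operator at the unused cell `v` passes `A`, is carried by `R` to `ρ v`, which is unused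
  -- in the new placement, passes `J`, and returns.
  · have hv' : ρ v ∉ Set.range ℓ' := by
      rintro ⟨i, hi⟩
      exact hv ⟨i, ρ.injective hi⟩
    have hX := semiconjBy_qubitPermOp_X ρ v
    have hZ := semiconjBy_qubitPermOp_Z ρ v
    rw [← hR3] at hX hZ
    exact ⟨Circuit.semiconjBy_sandwich (hAoff v hv).1 hX (hJoff _ hv').1 hX (hAoff v hv).1,
      Circuit.semiconjBy_sandwich (hAoff v hv).2 hZ (hJoff _ hv').2 hZ (hAoff v hv).2⟩
  -- The total is 2 · 664L + 2 · 18L + 88L + 40, and the constant is absorbed by `1 ≤ L`.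
  · simp only [Circuit.depth, List.length_append, List.length_reverse] at *
    omega

end Assembly

end FermionicPermutation

end

open FermionicPermutation in
theorem mainTheorem4 :
    ∃ C : ℕ, ∀ (L N : ℕ) (T : BinaryTree Unit),
      T.numNodes = N →
      (IsBalanced T ∨ T = leftSpine N) →
      ∀ (ℓ : Fin N ↪ Fin L × Fin L) (π : Equiv.Perm (Fin N)),
        ∃ (A R J : Circuit (gridGraph L)) (ρ : Equiv.Perm (Fin L × Fin L)),
          A.IsCNOTOnly ∧
          ConvertsEncoding T (rightSpine N) ℓ A.op ∧
          (∀ i : Fin N, snakeIndex (ρ (ℓ i)) = i) ∧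
          R.op = qubitPermOp ρ ∧
          ImplementsFermionicPerm (rightSpine N) (ℓ.trans ρ.toEmbedding) π J.op ∧
          ImplementsFermionicPerm T ℓ π
            (Circuit.op (A ++ R ++ J ++ R.reverse ++ A.reverse)) ∧
          Circuit.depth (A ++ R ++ J ++ R.reverse ++ A.reverse) ≤ C * L ∧
          Circuit.size (A ++ R ++ J ++ R.reverse ++ A.reverse) ≤ C * L ^ 3 := by
  refine ⟨1600, fun L N T hT hbal ℓ π => ?_⟩
  rcases Nat.eq_zero_or_pos L with rfl | hL
  -- The depth bound for `J` has an additive constant, so the empty grid is treated separately, with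
  -- empty circuits.
  · have hN : N = 0 := by
      have := card_le_of_embedding ℓ
      omega
    subst hN
    exact ⟨[], [], [], 1, fun l hl => absurd hl List.not_mem_nil,
      ⟨fun i hi => absurd hi (by omega), fun v => v.1.elim0⟩, fun i => i.elim0,
      qubitPermOp_one.symm, ⟨fun j => j.elim0, fun v => v.1.elim0⟩,
      ⟨fun j => j.elim0, fun v => v.1.elim0⟩, le_rfl, le_rfl⟩
  · obtain ⟨A, R, J, ρ, h1, h2, h3, h4, h5, h6, h7⟩ :=
      exists_fermionicPerm_circuit hL hT hbal ℓ π
    refine ⟨A, R, J, ρ, h1, h2, h3, h4, h5, h6, h7, (Circuit.size_le _).trans ?_⟩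
    calc _ ≤ 1600 * L * (L * L) := by
          simpa using Nat.mul_le_mul_right (L * L) h7
      _ = 1600 * L ^ 3 := by ring
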